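/- **Setting.** Let $\mathcal G=(\mathcal V,\mathcal E)$ be a finite connected simple graph with conductances $c_{u,v}=c_{v,u}>0$ on its edges. Let $\mathcal D\subset\mathcal V$, and let $\mathcal G_s$ be the graph obtained by adding a root $s$ joined by an edge of unit conductance to each vertex of $\mathcal D$. Write $\Delta$ for the Laplacian of $\mathcal G_s$ with the row and column of $s$ removed: $$\Delta_{u,u}=\sum_{w\sim u}c_{u,w}+\mathbf 1_{u\in\mathcal D},\qquad \Delta_{u,v}=-c_{u,v}\ \text{ if }\{u,v\}\in\mathcal E,$$ and $0$ otherwise. For nonzero parallel transports $\phi_{v,u}=\phi_{u,v}^{-1}$, the line bundle Laplacian $\mathbf\Delta$ is the same matrix with the entries $-c_{u,v}$ replaced by $-c_{u,v}\,\phi_{u,v}^{-1}$. Let $\mathcal G$ be cellularly embedded in a closed oriented surface (given by the counterclockwise cyclic order of the edges at each vertex), with a distinguished outer face $o$. (Boundary curves of a surface with boundary are filled with discs; the one carrying $u_1,u_2$ lies in $o$.) Let $u_1\ne u_2$ be vertices on the boundary of $o$, with a chosen corner of $o$ at each of them, and let $f\neq o$ be a face. Close a simple path $\gamma$ of $\mathcal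 G$ from $u_1$ to $u_2$ by a curve in $o$ joining the two corners. We say that $\gamma$ *leaves $f$ to its left* (resp. *right*) if, in the complement of this closed curve, $f$ is in the same component as the left (resp. right) side of some edge of $\gamma$. Assume that the surface has genus $0$ or, more generally, that each simple path from $u_1$ to $u_2$ leaves $f$ on exactly one side. A *zipper* is a path in the dual graph from $f$ to $o$ (with distinct faces) whose last crossed edge lies on the clockwise boundary path from $u_1$ to $u_2$, the part of the boundary walk of $o$, with $o$ on its left, from the corner at $u_1$ to the corner at $u_2$. Fix a zipper. Put $\phi_{k,l}=z\in\mathbb C^*$ (and $\phi_{l,k}=z^{-1}$) on the oriented edges $(k,l)$ which it crosses from left to right, so that a counterclockwise cycle around $f$ has monodromy $z$, and $\phi=1$ on all other edges. Let $\mathbf\Delta(z)$ be the corresponding line bundle Laplacian. The *spanning forest measure* gives to a simple path $\gamma$ from $u_1$ to $u_2$ in $\mathcal G$ a probability proportional to the sum of $\prod_{e\in F}c_e$ over the spanning forests $F\supset\gamma$ of $\mathcal G_s$ with exactly two components, one containing $\gamma$ and the other one $s$. Let $P_{\mathrm L}$ be the probability that the path leaves $f$ to its left. **Claim.** Each simple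 path from $u_1$ to $u_2$ leaves $f$ on exactly one side, and the following hold. 1. (*Root.*) Let $\mathcal D\neq\varnothing$. Then $\Delta$ is invertible, $G=\Delta^{-1}$ satisfies $G_{u_1,u_2}>0$, and $\mathbf G(z)=\mathbf\Delta(z)^{-1}$ has the derivative $$\partial_z\mathbf G_{u,v}\big|_{z=1}=G'_{u,v}:=\sum_{(k,l):\,\phi_{k,l}=z}c_{k,l}\,\big(G_{u,l}G_{k,v}-G_{u,k}G_{l,v}\big).$$ Moreover $$P_{\mathrm L}=\lim_{z\to1}\frac{(\mathbf G_{u_2,u_1}-z^{-2}\mathbf G_{u_1,u_2})\det\mathbf\Delta}{1-z^{-2}}\cdot\frac1{\mathbf G_{u_1,u_2}\det\mathbf\Delta}=1-\frac{G'_{u_1,u_2}}{G_{u_1,u_2}}.$$ 2. (*Free boundary.*) Let $\mathcal D=\varnothing$ and $\mathcal N=|\mathcal V|$. Write $\Delta_0$ and $\mathbf\Delta_0(z)$ for the two Laplacians in this case. Let $\mathcal P_0$ be the matrix with all entries $1/\mathcal N$, let $G=\sum_{\lambda\ne0}\lambda^{-1}|f_\lambda\rangle\langle f_\lambda|$ be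 the regularized Green function ($f_\lambda$ orthonormal eigenvectors of $\Delta_0$), define $G'$ from this $G$ as above, and let $$\widetilde G'_{u,v}=\sum_{(k,l):\,\phi_{k,l}=z}c_{k,l}\,\big(G_{u,l}+G_{k,v}-G_{u,k}-G_{l,v}\big).$$ For $t\in\mathbb C\setminus\{0\}$, the matrix $\Delta_0+t\mathcal P_0$ is invertible and $\mathbf G_t(z)=(\mathbf\Delta_0(z)+t\mathcal P_0)^{-1}$ satisfies $\partial_z\mathbf G_t|_{z=1}=G'+t^{-1}\mathcal N^{-1}\widetilde G'$. Moreover $$P_{\mathrm L}=\lim_{t\to0}\lim_{z\to1}\frac{\big((\mathbf G_t)_{u_2,u_1}-z^{-2}(\mathbf G_t)_{u_1,u_2}\big)\det(\mathbf\Delta_0+t\mathcal P_0)}{1-z^{-2}}\cdot\frac1{(\mathbf G_t)_{u_1,u_2}\det(\mathbf\Delta_0+t\mathcal P_0)}=1-\widetilde G'_{u_1,u_2},$$ where the inner limit exists for all $t\neq0$ close to $0$. 3. (*Loop-erased random walk.*) $P_{\mathrm L}$ is also the probability that the loop-erased random walk from $u_1$ to $u_2$ leaves $f$ to its left. Here the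 walk on $\mathcal G_s$ has transition probabilities proportional to the conductances and is stopped at $s$. If $u_2\in\mathcal D$, it is started at $u_1$ and conditioned to reach $s$ through the edge $(u_2,s)$, and its chronological loop erasure with $s$ removed is the path. If $u_2\notin\mathcal D$ (in particular if $\mathcal D=\varnothing$), an edge $(u_2,s)$ of transition probability $\varepsilon$ is added, the other transition probabilities from $u_2$ are multiplied by $1-\varepsilon$, and $P_{\mathrm L}$ is the limit as $\varepsilon\to0^+$ of the corresponding probabilities. (The sums over walks involved converge, for $\varepsilon\in(0,1)$ in the second case.) -/

import Mathlib

open Filter Topology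

namespace Schramm

variable {V : Type*}

/-! ### Graphs embedded in oriented surfaces

A cellular embedding of a connected graph in a closed oriented surface is recorded, as usual, by
its rotation system: the counterclockwise cyclic order of the darts (oriented edges) leaving each
vertex.  The boundary curves of a surface with boundary are capped off with discs, so that the
boundary component carrying the two marked vertices lies in one distinguished face. -/

/-- A rotation system: `rot d` is the next dart leaving the same vertex, counterclockwise. -/
structure RotationSystem (G : SimpleGraph V) where
  rot : Equiv.Perm G.Dart
  fst_rot : ∀ d, (rot d).fst = d.fst
  sameCycle : ∀ d e : G.Dart, d.fst = e.fst → rot.SameCycle d e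

namespace RotationSystem

variable {G : SimpleGraph V} (M : RotationSystem G)

/-- The successor of a dart on the boundary walk of the face lying to its left: reverse the dart
and take the previous dart (clockwise) at its head. -/
def facePerm : Equiv.Perm G.Dart :=
  M.rot⁻¹ * Function.Involutive.toPerm _ (SimpleGraph.Dart.symm_involutive (G := G))

/-- The faces: orbits of the face permutation. -/
def Face : Type _ := Quotient (Equiv.Perm.SameCycle.setoid M.facePerm)

/-- The face to the left of a dart. -/
def face (d : G.Dart) : M.Face := Quotient.mk _ d

/-- Genus zero, through Euler's formula `|V| - |E| + |F| = 2` (for connected graphs). -/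
def IsPlanar : Prop :=
  Nat.card V + Nat.card M.Face = Nat.card G.edgeSet + 2

/-- `d` is on the part of the boundary walk of the outer face that starts with the dart `a₁` and
ends just before the dart `a₂`.  As the outer face is on its left, this walk is the clockwise
boundary path from the tail of `a₁` to the tail of `a₂`. -/
def OnArc (a₁ a₂ d : G.Dart) : Prop :=
  ∃ k : ℕ, (M.facePerm ^ k) a₁ = d ∧ ∀ j ≤ k, (M.facePerm ^ j) a₁ ≠ a₂

/-- One step in the complement of the closed curve that consists of the path `γ` and of a curve
through the outer face joining its corners at `a₁` and `a₂` (the corner at a dart `a` is the sector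
immediately to the left of `a` at its tail).  A dart stands for the thin strip on its left; one may
move along the boundary of a face, without crossing the two corners, and one may cross the edges
that are not in `γ`. -/
def Step (a₁ a₂ : G.Dart) {u v : V} (γ : G.Walk u v) (d e : G.Dart) : Prop :=
  (e = M.facePerm d ∧ e ≠ a₁ ∧ e ≠ a₂) ∨ (e = d.symm ∧ d.edge ∉ γ.edges)

/-- Being in the same component of the complement of that closed curve. -/
def SameSide (a₁ a₂ : G.Dart) {u v : V} (γ : G.Walk u v) : G.Dart → G.Dart → Prop :=
  Relation.EqvGen (M.Step a₁ a₂ γ)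

/-- The path `γ` leaves the face `f` to its left. -/
def LeavesLeft (a₁ a₂ : G.Dart) (f : M.Face) {u v : V} (γ : G.Walk u v) : Prop :=
  ∃ d ∈ γ.darts, ∃ e, M.face e = f ∧ M.SameSide a₁ a₂ γ d e

/-- The path `γ` leaves the face `f` to its right. -/
def LeavesRight (a₁ a₂ : G.Dart) (f : M.Face) {u v : V} (γ : G.Walk u v) : Prop :=
  ∃ d ∈ γ.darts, ∃ e, M.face e = f ∧ M.SameSide a₁ a₂ γ d.symm e

/-- A zipper from the face `f` to the outer face: a path in the dual graph, given by the list of the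
darts that it crosses from left to right, which reaches the outer face through an edge of the
clockwise boundary path from the tail of `a₁` to the tail of `a₂`. -/
structure IsZipper (a₁ a₂ : G.Dart) (f : M.Face) (ζ : List G.Dart) : Prop where
  head : ∃ d ∈ ζ.head?, M.face d = f
  chain : ζ.IsChain fun d e => M.face d.symm = M.face e
  last : ∃ d ∈ ζ.getLast?, M.OnArc a₁ a₂ d.symm
  nodup : (f :: ζ.map fun d => M.face d.symm).Nodup

end RotationSystem

noncomputable section

variable [Fintype V] [DecidableEq V] (G : SimpleGraph V) [DecidableRel G.Adj]
  (c : Sym2 V → ℝ) (D : Finset V)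

/-! ### Laplacians and Green functions

`c` gives the conductances of the edges; the vertices of `D` are joined to the root by edges of
unit conductance. -/

/-- Weighted degree in the extended graph. -/
def deg (u : V) : ℝ := (∑ w ∈ G.neighborFinset u, c s(u, w)) + if u ∈ D then 1 else 0

/-- The Laplacian with Dirichlet condition at the root (for `D = ∅`, the Laplacian of `G`). -/
def laplacian : Matrix V V ℝ := Matrix.of fun u v =>
  if u = v then deg G c D u else if G.Adj u v then -c s(u, v) else 0

/-- The line bundle Laplacian for the parallel transports `φ`. -/
def lineLaplacian (φ : V → V → ℂ) : Matrix V V ℂ := Matrix.of fun u v =>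
  if u = v then (deg G c D u : ℂ) else if G.Adj u v then -(c s(u, v) : ℂ) * (φ u v)⁻¹ else 0

open Classical in
/-- The connection with parallel transport `z` on the darts of `ζ`, `z⁻¹` on the reversed darts and
`1` elsewhere. -/
def transport {G : SimpleGraph V} (ζ : List G.Dart) (z : ℂ) (u v : V) : ℂ :=
  if ∃ d ∈ ζ, d.fst = u ∧ d.snd = v then z
  else if ∃ d ∈ ζ, d.fst = v ∧ d.snd = u then z⁻¹ else 1

/-- The Dirichlet Green function. -/
def green : Matrix V V ℝ := (laplacian G c D)⁻¹

/-- The line bundle Laplacian `𝚫(z)` for the connection carried by `ζ`. -/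
def zipLaplacian (ζ : List G.Dart) (z : ℂ) : Matrix V V ℂ :=
  lineLaplacian G c D (transport ζ z)

/-- The line bundle Green function `𝐆(z) = 𝚫(z)⁻¹`. -/
def zipGreen (ζ : List G.Dart) (z : ℂ) : Matrix V V ℂ := (zipLaplacian G c D ζ z)⁻¹

variable {G} in
/-- The matrix `G'`, as a function of the matrix `g` in the role of the Green function; the sum is
over the oriented edges `(k, l)` with parallel transport `z`. -/
def greenDeriv (g : Matrix V V ℝ) (ζ : List G.Dart) (u v : V) : ℝ :=
  ∑ d ∈ ζ.toFinset, c d.edge * (g u d.snd * g d.fst v - g u d.fst * g d.snd v)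

variable {G} in
/-- The matrix `G̃'`, as a function of the matrix `g` in the role of the Green function. -/
def greenDerivTilde (g : Matrix V V ℝ) (ζ : List G.Dart) (u v : V) : ℝ :=
  ∑ d ∈ ζ.toFinset, c d.edge * (g u d.snd + g d.fst v - g u d.fst - g d.snd v)

theorem laplacian_isHermitian : (laplacian G c D).IsHermitian := by
  ext u v
  by_cases h : u = v
  · subst h; simp [laplacian]
  · simp [laplacian, h, Ne.symm h, G.adj_comm v u, Sym2.eq_swap (a := v) (b := u)]

/-- The regularized Green function `∑_{λ ≠ 0} λ⁻¹ |f_λ⟩⟨f_λ|` of the Laplacian of `G` (no root). -/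
def regGreen : Matrix V V ℝ := Matrix.of fun u v =>
  let h := laplacian_isHermitian G c ∅
  ∑ i with h.eigenvalues i ≠ 0,
    (h.eigenvalues i)⁻¹ * (h.eigenvectorBasis i u * h.eigenvectorBasis i v)

/-- `𝚫₀(z) + t 𝒫₀`, where all the entries of `𝒫₀` are `1 / |V|`. -/
def zipLaplacianFree (ζ : List G.Dart) (t z : ℂ) : Matrix V V ℂ :=
  zipLaplacian G c ∅ ζ z + t • Matrix.of fun _ _ => (Fintype.card V : ℂ)⁻¹

/-- `𝐆_t(z) = (𝚫₀(z) + t 𝒫₀)⁻¹`. -/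
def zipGreenFree (ζ : List G.Dart) (t z : ℂ) : Matrix V V ℂ := (zipLaplacianFree G c ζ t z)⁻¹

/-! ### The spanning forest measure on paths -/

/-- The extended graph: the root `none` is joined to the vertices of `D`. -/
def extGraph : SimpleGraph (Option V) where
  Adj
    | some u, some v => G.Adj u v
    | some u, none => u ∈ D
    | none, some v => v ∈ D
    | none, none => False
  symm := ⟨by
    rintro (_ | u) (_ | v) h
    · exact h
    · exact h
    · exact h
    · exact G.symm.symm _ _ h⟩
  loopless := ⟨by
    rintro (_ | u) h
    · exact h
    · exact G.loopless.irrefl u h⟩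

/-- Conductances on the extended graph. -/
def extCond : Sym2 (Option V) → ℝ :=
  Sym2.lift ⟨fun
    | some u, some v => c s(u, v)
    | _, _ => 1, by
      rintro (_ | u) (_ | v)
      · rfl
      · rfl
      · rfl
      · simp [Sym2.eq_swap]⟩

/-- `F` is a spanning forest of the extended graph with exactly two components, one of which
contains `u` and `v`, and the other one the root. -/
def IsTwoForest (u v : V) (F : SimpleGraph (Option V)) : Prop :=
  F ≤ extGraph G D ∧ F.IsAcyclic ∧ F.Reachable (some u) (some v) ∧
    ¬ F.Reachable (some u) none ∧ ∀ x, F.Reachable x (some u) ∨ F.Reachable x none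

open Classical in
/-- The weight of a forest: the product of the conductances of its edges. -/
def forestWeight (F : SimpleGraph (Option V)) : ℝ := ∏ e ∈ F.edgeFinset, extCond c e

open Classical in
/-- The weight of a path `γ` from `u` to `v` on `G`: the weighted sum of the two-component spanning
forests in which `γ` belongs to one tree and the root to the other. -/
def pathWeight {u v : V} (γ : G.Path u v) : ℝ :=
  ∑ F : SimpleGraph (Option V) with
    IsTwoForest G D u v F ∧ ∀ e ∈ γ.1.edges, e.map some ∈ F.edgeSet, forestWeight c F

open Classical in
/-- The probability, for the spanning forest measure on paths from `u` to `v`, of a set `A` of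
paths.  There are finitely many paths, so that `∑ᶠ` is the finite sum. -/
def pathProb {u v : V} (A : G.Path u v → Prop) : ℝ :=
  (∑ᶠ γ : G.Path u v, if A γ then pathWeight G c D γ else 0) / ∑ᶠ γ : G.Path u v, pathWeight G c D γ

/-! ### Loop-erased random walk -/

/-- Transition matrix, restricted to `V`, of the random walk on the extended graph, in which an
extra probability `ε` to step from `v` to the root is introduced. -/
def stepProb (v : V) (ε : ℝ) (x y : V) : ℝ :=
  (if x = v then 1 - ε else 1) * if G.Adj x y then c s(x, y) / deg G c D x else 0

/-- Weight of the random walk that follows `ω` from `u` to `v` and then steps from `v` to the root,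
where it stops. -/
def walkWeight (ε : ℝ) {u v : V} (ω : G.Walk u v) : ℝ :=
  (ω.darts.map fun d => stepProb G c D v ε d.fst d.snd).prod * (1 - ∑ y, stepProb G c D v ε v y)

variable {G} in
/-- Chronological loop erasure.  Mathlib's `bypass` (through `toPath`) erases loops starting from
the end of the walk, hence the two reversals. -/
def loopErasure {u v : V} (ω : G.Walk u v) : G.Path u v := ω.reverse.toPath.reverse

open Classical in
/-- The probability that the loop erasure is in `A`, for the random walk that starts at `u`, stops
at the root, and is conditioned to reach the root through a step from `v`. -/
def lerwProb (ε : ℝ) {u v : V} (A : G.Path u v → Prop) : ℝ :=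
  (∑' ω : G.Walk u v, if A (loopErasure ω) then walkWeight G c D ε ω else 0) /
    ∑' ω : G.Walk u v, walkWeight G c D ε ω

end

end Schramm

/-! The proof expands cofactors over simple paths. For a matrix A supported on the edges and the
diagonal, the entry (u, v) of the adjugate is the sum over simple paths γ from u to v of the product
of the entries of -A along γ, times the principal minor of A on the complement of γ
(`adjugate_eq_sum_path`). For the Laplacian, the rooted matrix-tree theorem identifies each term
with the spanning forest weight of γ (`pathWeight_eq`), so that det Δ times G is the total weight of
the paths (`det_mul_green`).

For the line bundle Laplacian the product along γ acquires the factor z^(-n), where n is the signed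
number of crossings of γ and the zipper. The indicator of the component to the left of γ jumps by
one across γ. Telescoped along the zipper, which ends on the left of γ, it gives n = 0 when f is on
the left and n = -1 when f is on the right (`RotationSystem.crossing_eq`). In genus 0 the two sides
exclude each other by a Jordan theorem of homological nature: Euler's formula and connectedness
force every cycle to be the boundary of a combination of faces
(`RotationSystem.IsPlanar.exists_faceBoundary_eq`).

Replacing z by its inverse transposes the matrix, so determinants and principal minors are
stationary at z = 1. Only the factors z^(-n) contribute to the derivative of a cofactor, which is
therefore the total weight of the paths leaving f to the right; divided by the cofactor itself, it
is both G'/G and the probability of the right side. The limit in the theorem is the same number,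
computed from first derivatives (`tendsto_leftPassage`).

Without a root, Δ₀ is singular but its cofactors are positive. The quotient of the derivative of a
cofactor by the cofactor is continuous in t down to t = 0, while for t ≠ 0 the inverse is the
explicit matrix G + t⁻¹ 𝒫₀; the terms of order t⁻¹ are those that survive (`greenDerivTilde_eq`).

For the random walk, the weight of the walks with a given loop erasure is bounded above, by
induction on the length, by a determinantal weight. The path expansion of the inverse of 1 - w shows
that these bounds have the correct sum, so each is an equality (`tsum_bypass_eq`). Up to a factor
common to all paths, these weights are the forest weights. -/

namespace Schramm

/-! ### Cofactors as sums over simple paths. -/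

section PathExpansion

variable {V : Type*} {R : Type*} [CommRing R]

/-- The product of the weights of the steps of a walk. -/
def walkProd {G : SimpleGraph V} (w : V → V → R) {u v : V} (γ : G.Walk u v) : R :=
  (γ.darts.map fun d => w d.fst d.snd).prod

@[simp] theorem walkProd_nil {G : SimpleGraph V} (w : V → V → R) (u : V) :
    walkProd w (SimpleGraph.Walk.nil : G.Walk u u) = 1 := by simp [walkProd]

@[simp] theorem walkProd_cons {G : SimpleGraph V} (w : V → V → R) {u v x : V} (h : G.Adj u x)
    (γ : G.Walk x v) : walkProd w (SimpleGraph.Walk.cons h γ) = w u x * walkProd w γ := by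
  simp [walkProd]

theorem walkProd_append {G : SimpleGraph V} (w : V → V → R) {u v x : V} (γ : G.Walk u x)
    (δ : G.Walk x v) : walkProd w (γ.append δ) = walkProd w γ * walkProd w δ := by
  simp [walkProd]

theorem walkProd_reverse {G : SimpleGraph V} (w : V → V → R) {u v : V} (γ : G.Walk u v) :
    walkProd w γ.reverse = walkProd (fun x y => w y x) γ := by
  induction γ with
  | nil => simp
  | cons h p ih => simp [SimpleGraph.Walk.reverse_cons, walkProd_append, ih, mul_comm]

variable [DecidableEq V]

/-- Replace the rows with index in `S` by those of the identity matrix. -/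
def killRows (A : Matrix V V R) (S : Finset V) : Matrix V V R :=
  Matrix.of fun i j => if i ∈ S then (1 : Matrix V V R) i j else A i j

theorem killRows_empty (A : Matrix V V R) : killRows A ∅ = A := by
  ext i j; simp [killRows]

theorem killRows_insert (A : Matrix V V R) (S : Finset V) (u : V) :
    killRows A (insert u S) = (killRows A S).updateRow u (Pi.single u 1) := by
  ext i j
  by_cases h : i = u
  · subst h; simp [killRows, Matrix.one_apply, Pi.single_apply, eq_comm]
  · simp [killRows, h]

theorem killRows_insert_union (A : Matrix V V R) (S T : Finset V) (u : V) :
    killRows A (insert u S ∪ T) = killRows A (S ∪ insert u T) := by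
  rw [Finset.insert_union, Finset.union_insert]

variable [Fintype V]

/-- With unit vectors in the rows of `S` the matrix is block triangular. Killing rows thus encodes
principal minors, and absorbing vertices, without changing the index type. -/
theorem det_killRows (A : Matrix V V R) (S : Finset V) :
    (killRows A S).det = (A.toSquareBlockProp fun x => x ∉ S).det := by
  rw [Matrix.twoBlockTriangular_det _ (fun x => x ∉ S) fun i hi j hj => by
    rw [not_not] at hi
    have : i ≠ j := fun h => hj (h ▸ hi)
    simp [killRows, hi, this]]
  have h1 : (killRows A S).toSquareBlockProp (fun i => ¬ i ∉ S) = 1 := by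
    ext ⟨i, hi⟩ ⟨j, hj⟩
    rw [not_not] at hi
    simp [Matrix.toSquareBlockProp, killRows, hi, Matrix.one_apply]
  have h2 : (killRows A S).toSquareBlockProp (fun x => x ∉ S) =
      A.toSquareBlockProp fun x => x ∉ S := by
    ext ⟨i, hi⟩ ⟨j, hj⟩
    simp [Matrix.toSquareBlockProp, killRows, hi]
  rw [h1, h2, Matrix.det_one, mul_one]

theorem det_killRows_transpose (A : Matrix V V R) (S : Finset V) :
    (killRows A.transpose S).det = (killRows A S).det := by
  rw [det_killRows, det_killRows, ← Matrix.det_transpose]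
  rfl

theorem det_killRows_mul_left (r : V → R) (A : Matrix V V R) (S : Finset V) :
    (killRows (Matrix.of fun i j => r i * A i j) S).det = (∏ i ∈ Sᶜ, r i) * (killRows A S).det := by
  have h : killRows (Matrix.of fun i j => r i * A i j) S =
      Matrix.of fun i j => (if i ∈ S then 1 else r i) * killRows A S i j := by
    ext i j
    by_cases hi : i ∈ S <;> simp [killRows, hi]
  rw [h, Matrix.det_mul_column, ← Finset.prod_mul_prod_compl S,
    Finset.prod_eq_one (fun x hx => if_pos hx), one_mul]
  congr 1
  exact Finset.prod_congr rfl fun x hx => if_neg (Finset.mem_compl.1 hx)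

theorem adjugate_self_eq_det (A : Matrix V V R) (u : V) :
    A.adjugate u u = (A.updateRow u (Pi.single u 1)).det := Matrix.adjugate_apply A u u

/-- The cofactor is the determinant with row `v` replaced by the unit vector at `u`; row `u` is
expanded by linearity. The term `x = u` has two equal rows. In the others, exchanging rows `u` and
`v` costs a sign and leaves a cofactor of the matrix in which `u` is killed: the first step of a
path that never returns to `u`. -/
theorem adjugate_eq_sum_row (A : Matrix V V R) {u v : V} (h : u ≠ v) :
    A.adjugate u v =
      ∑ x, if x = u then 0 else -A u x * (A.updateRow u (Pi.single u 1)).adjugate x v := by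
  have key : A.adjugate u v = ∑ x, A u x *
      ((A.updateRow v (Pi.single u 1)).updateRow u (Pi.single x 1)).det := by
    rw [Matrix.adjugate_apply]
    have h1 : A.updateRow v (Pi.single u 1) =
        (A.updateRow v (Pi.single u 1)).updateRow u (∑ x, A u x • Pi.single x 1) := by
      have h2 : (∑ x, A u x • (Pi.single x 1 : V → R)) = A u := by
        ext j; simp [Finset.sum_apply, Pi.single_apply]
      rw [h2]
      ext i j
      by_cases hi : i = u
      · subst hi; simp [h]
      · simp [hi]
    conv_lhs => rw [h1]
    have := (Matrix.detRowAlternating (R := R) (n := V)).toMultilinearMap.map_update_sum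
      (t := Finset.univ) (i := u) (g := fun x => A u x • (Pi.single x 1 : V → R))
      (m := A.updateRow v (Pi.single u 1))
    refine this.trans (Finset.sum_congr rfl fun x _ => ?_)
    exact Matrix.det_updateRow_smul _ _ _ _
  rw [key]
  refine Finset.sum_congr rfl fun x _ => ?_
  split_ifs with hx
  · subst hx
    rw [Matrix.det_zero_of_row_eq h, mul_zero]
    ext j; simp [h.symm]
  · rw [Matrix.adjugate_apply, neg_mul, ← mul_neg]
    congr 1
    have hsw : ((A.updateRow u (Pi.single u 1)).updateRow v (Pi.single x 1)) =
        ((A.updateRow v (Pi.single u 1)).updateRow u (Pi.single x 1)).submatrix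
          (Equiv.swap u v) id := by
      ext i j
      by_cases hi : i = u
      · subst hi; simp [h, h.symm]
      · by_cases hi' : i = v
        · subst hi'; simp
        · simp [hi, hi', Equiv.swap_apply_of_ne_of_ne hi hi']
    rw [hsw, Matrix.det_permute, Equiv.Perm.sign_swap h]
    simp

variable (G : SimpleGraph V) [DecidableRel G.Adj]

theorem sum_path_eq_sum_cons {M : Type*} [AddCommMonoid M] {u v : V} (huv : u ≠ v)
    (F : G.Walk u v → M) :
    ∑ γ : G.Path u v, F γ.1 = ∑ x : {x // G.Adj u x}, ∑ δ : G.Path x.1 v,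
      if u ∉ δ.1.support then F (SimpleGraph.Walk.cons x.2 δ.1) else 0 := by
  classical
  have h1 : ∀ x : {x // G.Adj u x}, (∑ δ : G.Path x.1 v,
      if u ∉ δ.1.support then F (SimpleGraph.Walk.cons x.2 δ.1) else 0) =
      ∑ δ : {δ : G.Path x.1 v // u ∉ δ.1.support}, F (SimpleGraph.Walk.cons x.2 δ.1.1) := by
    intro x
    rw [← Finset.sum_filter]
    exact Finset.sum_subtype (p := fun δ : G.Path x.1 v => u ∉ δ.1.support) _ (by simp)
      (fun δ => F (SimpleGraph.Walk.cons x.2 δ.1))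
  rw [Finset.sum_congr rfl fun x _ => h1 x, ← Fintype.sum_sigma']
  symm
  refine Fintype.sum_bijective
    (fun s : (x : {x // G.Adj u x}) × {δ : G.Path x.1 v // u ∉ δ.1.support} =>
      (⟨SimpleGraph.Walk.cons s.1.2 s.2.1.1, s.2.1.2.cons s.2.2⟩ : G.Path u v))
    ⟨?_, ?_⟩ _ _ fun s => rfl
  · rintro ⟨⟨x, hx⟩, ⟨⟨δ, hδ⟩, hδ'⟩⟩ ⟨⟨y, hy⟩, ⟨⟨δ', h'δ⟩, h'δ'⟩⟩ h
    simp only [Subtype.mk.injEq, SimpleGraph.Walk.cons.injEq] at h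
    obtain ⟨rfl, h⟩ := h
    obtain rfl := eq_of_heq h
    rfl
  · rintro ⟨γ, hγ⟩
    cases γ with
    | nil => exact absurd rfl huv
    | cons h p =>
      rw [SimpleGraph.Walk.cons_isPath_iff] at hγ
      exact ⟨⟨⟨_, h⟩, ⟨⟨p, hγ.1⟩, hγ.2⟩⟩, rfl⟩

/-- Iteration of the first-step expansion. Each step kills the vertex just left, so the visited
vertices are distinct and outside `S`, and the recursion stops at `v` with the remaining minor. The
induction is on the number of rows still alive. -/
theorem adjugate_killRows (A : Matrix V V R) (hA : ∀ x y, x ≠ y → ¬ G.Adj x y → A x y = 0)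
    (S : Finset V) (u v : V) (hv : v ∉ S) :
    (killRows A S).adjugate u v = ∑ γ : G.Path u v,
      if Disjoint S γ.1.support.toFinset then walkProd (fun x y => -A x y) γ.1 *
        (killRows A (S ∪ γ.1.support.toFinset)).det else 0 := by
  induction hn : Sᶜ.card using Nat.strong_induction_on generalizing S u with
  | _ n ih =>
  by_cases hu : u ∈ S
  · have huv : u ≠ v := fun h => hv (h ▸ hu)
    -- Row `u` is already the unit vector that the cofactor puts in row `v`; on the other side, no
    -- path starting at `u` avoids `S`.
    rw [Finset.sum_eq_zero, Matrix.adjugate_apply, Matrix.det_zero_of_row_eq huv]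
    · ext j; simp [huv, killRows, hu, Matrix.one_apply, Pi.single_apply, eq_comm]
    · intro γ _
      rw [if_neg]
      exact Finset.not_disjoint_iff.2 ⟨u, hu, by simp⟩
  by_cases huv : u = v
  · subst huv
    rw [Fintype.sum_eq_single SimpleGraph.Path.nil
      (fun γ h => absurd (SimpleGraph.Path.loop_eq γ) h)]
    rw [adjugate_self_eq_det, ← killRows_insert]
    simp [SimpleGraph.Path.nil, hu, Finset.union_comm S]
  rw [adjugate_eq_sum_row _ huv, ← killRows_insert,
    sum_path_eq_sum_cons G huv (fun γ => if Disjoint S γ.support.toFinset then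
      walkProd (fun x y => -A x y) γ * (killRows A (S ∪ γ.support.toFinset)).det else 0)]
  have hlt : (insert u S)ᶜ.card < n := by
    rw [← hn]
    refine Finset.card_lt_card ⟨fun x hx => ?_, fun h => ?_⟩
    · simp only [Finset.mem_compl, Finset.mem_insert, not_or] at hx ⊢
      exact hx.2
    · have := h (Finset.mem_compl.2 hu)
      simp at this
  have hv' : v ∉ insert u S := by simp [Ne.symm huv, hv]
  have hs : ∀ g : V → R, (∀ x, ¬ G.Adj u x → g x = 0) →
      ∑ x, g x = ∑ x : {x // G.Adj u x}, g x.1 := by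
    intro g hg
    rw [← Finset.sum_subtype (Finset.univ.filter (G.Adj u)) (by simp) g, Finset.sum_filter]
    exact Finset.sum_congr rfl fun x _ => by split_ifs with h <;> simp [h, hg]
  rw [hs _ fun x hx => by
    split_ifs with h
    · rfl
    · simp [killRows, hu, hA u x (Ne.symm h) hx]]
  refine Finset.sum_congr rfl fun x _ => ?_
  rw [if_neg x.2.ne', ih _ hlt _ x.1 hv' rfl, Finset.mul_sum]
  refine Finset.sum_congr rfl fun δ _ => ?_
  have e1 : killRows A S u x.1 = A u x.1 := by simp [killRows, hu]
  by_cases h1 : u ∈ δ.1.support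
  · rw [if_neg (by simp [h1]), if_neg (by simp [h1]), mul_zero]
  · by_cases h2 : Disjoint S δ.1.support.toFinset
    · rw [if_pos (by simp [h1, h2]), if_pos h1, if_pos (by simp [h2, hu]), killRows_insert_union,
        e1, walkProd_cons, SimpleGraph.Walk.support_cons, List.toFinset_cons, mul_assoc]
    · rw [if_neg (by simp [h2]), if_pos h1, if_neg (by simp [h2]), mul_zero]

theorem adjugate_eq_sum_path (A : Matrix V V R) (hA : ∀ x y, x ≠ y → ¬ G.Adj x y → A x y = 0)
    (u v : V) :
    A.adjugate u v = ∑ γ : G.Path u v,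
      walkProd (fun x y => -A x y) γ.1 * (killRows A γ.1.support.toFinset).det := by
  have := adjugate_killRows G A hA ∅ u v (by simp)
  simpa [killRows_empty] using this

end PathExpansion


/-! ### Parent maps and the directed matrix-tree theorem. -/

section RootedMaps

variable {X : Type*}

/-- `p` maps every vertex outside the root set `S` to its parent in a forest rooted at `S`. -/
def IsRooted (S : Finset X) (p : X → X) : Prop :=
  (∀ x ∈ S, p x = x) ∧ ∃ b : X → ℕ, ∀ x ∉ S, b (p x) < b x

theorem IsRooted.induction {S : Finset X} {p : X → X} (hp : IsRooted S p) {Q : X → Prop}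
    (h0 : ∀ x ∈ S, Q x) (h1 : ∀ x ∉ S, Q (p x) → Q x) (x : X) : Q x := by
  obtain ⟨b, hb⟩ := hp.2
  induction hn : b x using Nat.strong_induction_on generalizing x with
  | _ n ih =>
    by_cases hx : x ∈ S
    · exact h0 x hx
    · exact h1 x hx (ih _ (hn ▸ hb x hx) _ rfl)

theorem IsRooted.exists_depth {S : Finset X} {p : X → X} (hp : IsRooted S p) :
    ∃ b : X → ℕ, (∀ x ∉ S, b (p x) < b x) ∧ ∀ n x, b (p^[n] x) ≤ b x := by
  obtain ⟨b, hb⟩ := hp.2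
  refine ⟨b, hb, fun n => ?_⟩
  induction n with
  | zero => exact fun x => le_rfl
  | succ n ih =>
    intro x
    rw [Function.iterate_succ_apply]
    refine (ih _).trans ?_
    by_cases hx : x ∈ S
    · rw [hp.1 x hx]
    · exact (hb x hx).le

theorem isRooted_iff {S : Finset X} {p : X → X} :
    IsRooted S p ↔ (∀ x ∈ S, p x = x) ∧ ∀ x, ∃ n, p^[n] x ∈ S := by
  classical
  constructor
  · intro h
    exact ⟨h.1, h.induction (fun x hx => ⟨0, hx⟩) fun x _ ⟨n, hn⟩ => ⟨n + 1, hn⟩⟩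
  · rintro ⟨h, h'⟩
    refine ⟨h, fun x => Nat.find (h' x), fun x hx => ?_⟩
    have h1 := Nat.find_spec (h' x)
    have h2 : Nat.find (h' x) ≠ 0 := fun h0 => hx (by rw [h0] at h1; exact h1)
    obtain ⟨m, hm⟩ := Nat.exists_eq_succ_of_ne_zero h2
    rw [hm] at h1
    refine lt_of_lt_of_eq ?_ hm.symm
    exact Nat.lt_succ_of_le (Nat.find_min' (h' (p x)) h1)

theorem IsRooted.apply_ne {S : Finset X} {p : X → X} (hp : IsRooted S p) {x : X} (hx : x ∉ S) :
    p x ≠ x := by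
  obtain ⟨b, hb⟩ := hp.2
  intro h
  have := hb x hx
  rw [h] at this
  exact this.false

variable [Fintype X] [DecidableEq X]

/-- Parents are strictly less deep, so the matrix is block triangular for the depth, with identity
blocks. -/
theorem det_one_sub_rooted {S : Finset X} {p : X → X} (hp : IsRooted S p) :
    (Matrix.of fun x y : X => (if x = y then (1 : ℝ) else 0) -
      if x ∈ S then 0 else if p x = y then 1 else 0).det = 1 := by
  obtain ⟨b, hb⟩ := hp.2
  set M : Matrix X X ℝ := Matrix.of fun x y : X => (if x = y then (1 : ℝ) else 0) -
      if x ∈ S then 0 else if p x = y then 1 else 0 with hM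
  have hT : M.BlockTriangular (OrderDual.toDual ∘ b) := by
    intro i j hij
    have hij : b i < b j := hij
    have h1 : i ≠ j := fun h => by rw [h] at hij; exact hij.false
    simp only [hM, Matrix.of_apply, if_neg h1, zero_sub, neg_eq_zero]
    split_ifs with h2 h3
    · rfl
    · have := hb i h2
      rw [h3] at this
      exact absurd hij this.not_gt
    · rfl
  rw [hT.det]
  refine Finset.prod_eq_one fun k _ => ?_
  suffices h : M.toSquareBlock (OrderDual.toDual ∘ b) k = 1 by rw [h, Matrix.det_one]
  ext ⟨i, hi⟩ ⟨j, hj⟩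
  simp only [Matrix.toSquareBlock_def, hM, Matrix.of_apply, Matrix.one_apply, Subtype.mk.injEq]
  have : (if i ∈ S then (0 : ℝ) else if p i = j then 1 else 0) = 0 := by
    split_ifs with h2 h3
    · rfl
    · have h4 := hb i h2
      have h5 : b i = b j := OrderDual.toDual.injective (hi.trans hj.symm)
      rw [h3, h5] at h4
      exact absurd h4 (lt_irrefl _)
    · rfl
  rw [this, sub_zero]

/-- Some orbit never meets `S`. The indicator of the points with this property is in the kernel: it
vanishes on `S`, and outside `S` a point has the property exactly when its parent does. -/
theorem det_one_sub_not_rooted {S : Finset X} {p : X → X} (hS : ∀ x ∈ S, p x = x)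
    (hp : ¬ IsRooted S p) :
    (Matrix.of fun x y : X => (if x = y then (1 : ℝ) else 0) -
      if x ∈ S then 0 else if p x = y then 1 else 0).det = 0 := by
  classical
  have h : ∃ x, ∀ n, p^[n] x ∉ S := by
    by_contra! h
    exact hp (isRooted_iff.2 ⟨hS, h⟩)
  obtain ⟨x₀, hx₀⟩ := h
  obtain ⟨v, hv⟩ : ∃ v : X → ℝ, ∀ x, v x = if ∀ n, p^[n] x ∉ S then 1 else 0 := ⟨_, fun _ => rfl⟩
  refine Matrix.exists_mulVec_eq_zero_iff.1 ⟨v, fun h => ?_, ?_⟩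
  · have := congr_fun h x₀
    simp [hv, hx₀] at this
  · ext x
    by_cases hx : x ∈ S
    · have h0 : v x = 0 := by rw [hv, if_neg fun h => h 0 hx]
      simp [Matrix.mulVec, dotProduct, hx, h0]
    · have : (∀ n, p^[n] x ∉ S) ↔ ∀ n, p^[n] (p x) ∉ S :=
        ⟨fun h n => h (n + 1), fun h n => by
          cases n with
          | zero => exact hx
          | succ n => exact h n⟩
      have h0 : v x = v (p x) := by rw [hv, hv]; exact if_congr this rfl rfl
      simp [Matrix.mulVec, dotProduct, hx, sub_mul, h0]

/-- The Laplacian of a directed weighted graph. -/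
def dirLaplacian (w : X → X → ℝ) : Matrix X X ℝ :=
  Matrix.of fun x j => ∑ y, w x y * ((if x = j then 1 else 0) - if y = j then 1 else 0)

open Classical in
/-- The weighted number of forests rooted at `S` whose parent map is in `C`. -/
noncomputable def rootedSum (w : X → X → ℝ) (S : Finset X) (C : (X → X) → Prop) : ℝ :=
  ∑ p : X → X with IsRooted S p ∧ C p, ∏ x ∈ Sᶜ, w x (p x)

/-- Matrix-tree theorem by multilinearity: expanding every row chooses a parent for every vertex,
and the determinant left over is 1 if all orbits end in `S` and 0 otherwise. -/
theorem det_killRows_dirLaplacian (w : X → X → ℝ) (S : Finset X) :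
    (killRows (dirLaplacian w) S).det = rootedSum w S fun _ => True := by
  classical
  -- In the rows of `S` only the choice `y = x` is nonzero, so the expansion runs over all maps and
  -- only those fixing `S` survive.
  set g : X → X → X → ℝ := fun x y => if x ∈ S then (if y = x then Pi.single x 1 else 0) else
    w x y • (fun j => (if x = j then 1 else 0) - if y = j then 1 else 0) with hg
  have h1 : killRows (dirLaplacian w) S = fun x => ∑ y, g x y := by
    ext x j
    rw [Finset.sum_apply]
    by_cases hx : x ∈ S
    · simp only [killRows, Matrix.of_apply, hx, if_true, hg]
      rw [Fintype.sum_eq_single x (fun y hy => by simp [hy])]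
      simp [Matrix.one_apply, Pi.single_apply, eq_comm]
    · simp [killRows, hx, hg, dirLaplacian]
  have h2 := (Matrix.detRowAlternating (R := ℝ) (n := X)).toMultilinearMap.map_sum g
  have h3 : (killRows (dirLaplacian w) S).det = ∑ p : X → X, (Matrix.of fun x => g x (p x)).det := by
    rw [h1]; exact h2
  rw [h3, rootedSum, Finset.sum_filter]
  refine Finset.sum_congr rfl fun p _ => ?_
  by_cases hS : ∀ x ∈ S, p x = x
  · have h4 : (Matrix.of fun x => g x (p x)) = Matrix.of fun x j => (if x ∈ S then 1 else w x (p x)) *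
        (Matrix.of fun x y : X => (if x = y then (1 : ℝ) else 0) -
          if x ∈ S then 0 else if p x = y then 1 else 0) x j := by
      ext x j
      by_cases hx : x ∈ S
      · simp [hg, hx, hS x hx, Pi.single_apply, eq_comm]
      · simp [hg, hx]
    rw [h4, Matrix.det_mul_column]
    have h5 : ∏ x, (if x ∈ S then 1 else w x (p x)) = ∏ x ∈ Sᶜ, w x (p x) := by
      rw [← Finset.prod_mul_prod_compl S, Finset.prod_eq_one (fun x hx => if_pos hx), one_mul]
      exact Finset.prod_congr rfl fun x hx => if_neg (Finset.mem_compl.1 hx)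
    rw [h5]
    by_cases hp : IsRooted S p
    · rw [det_one_sub_rooted hp, if_pos ⟨hp, trivial⟩, mul_one]
    · rw [det_one_sub_not_rooted hS hp, if_neg (fun h => hp h.1), mul_zero]
  · rw [if_neg fun h => hS h.1.1]
    push Not at hS
    obtain ⟨x, hx, hx'⟩ := hS
    refine Matrix.det_eq_zero_of_row_eq_zero x fun j => ?_
    simp [hg, hx, hx']

/-- Cutting the edge from `x` to its parent `r` makes `x` a root and releases the factor `w x r`.
The hypothesis on `C` says that it ignores the parent of `x`. -/
theorem rootedSum_insert (w : X → X → ℝ) {S : Finset X} {r x : X} (hr : r ∈ S) (hx : x ∉ S)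
    {C : (X → X) → Prop} (hC : ∀ p y, C (Function.update p x y) ↔ C p) :
    rootedSum w S (fun p => p x = r ∧ C p) = w x r * rootedSum w (insert x S) C := by
  classical
  have hrx : r ≠ x := fun h => hx (h ▸ hr)
  rw [rootedSum, rootedSum, Finset.mul_sum]
  refine Finset.sum_bij' (fun p _ => Function.update p x x) (fun p _ => Function.update p x r)
    ?_ ?_ ?_ ?_ ?_
  · intro p hp
    simp only [Finset.mem_filter_univ] at hp ⊢
    obtain ⟨⟨h1, b, hb⟩, h2, h3⟩ := hp
    refine ⟨⟨fun y hy => ?_, b, fun y hy => ?_⟩, (hC _ _).2 h3⟩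
    · rcases Finset.mem_insert.1 hy with rfl | hy
      · simp
      · rw [Function.update_of_ne (ne_of_mem_of_not_mem hy hx), h1 y hy]
    · rw [Finset.mem_insert, not_or] at hy
      rw [Function.update_of_ne hy.1]
      exact hb y hy.2
  · intro p hp
    simp only [Finset.mem_filter_univ] at hp ⊢
    obtain ⟨⟨h1, b, hb⟩, h3⟩ := hp
    refine ⟨⟨fun y hy => ?_, fun y => if y ∈ S then 0 else b y + 1, fun y hy => ?_⟩, by simp,
      (hC _ _).2 h3⟩
    · rw [Function.update_of_ne (ne_of_mem_of_not_mem hy hx), h1 y (Finset.mem_insert_of_mem hy)]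
    · by_cases hyx : y = x
      · subst hyx
        simp [hr, hx]
      · rw [Function.update_of_ne hyx]
        have := hb y (by simp [hyx, hy])
        simp only [hy, if_false]
        split_ifs <;> omega
  · intro p hp
    simp only [Finset.mem_filter_univ] at hp
    simp [← hp.2.1]
  · intro p hp
    simp only [Finset.mem_filter_univ] at hp
    have : p x = x := hp.1.1 x (Finset.mem_insert_self _ _)
    rw [Function.update_idem]
    nth_rw 2 [← this]
    simp
  · intro p hp
    simp only [Finset.mem_filter_univ] at hp
    have : Sᶜ = insert x (insert x S)ᶜ := by
      ext y; by_cases hy : y = x <;> simp [hy, hx]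
    rw [this, Finset.prod_insert (by simp), hp.2.1]
    congr 1
    refine Finset.prod_congr rfl fun y hy => ?_
    rw [Function.update_of_ne]
    rintro rfl
    simp at hy

theorem rootedSum_congr (w : X → X → ℝ) (S : Finset X) {C C' : (X → X) → Prop}
    (h : ∀ p, IsRooted S p → (C p ↔ C' p)) : rootedSum w S C = rootedSum w S C' := by
  classical
  unfold rootedSum
  congr 1
  ext p
  simp only [Finset.mem_filter_univ]
  exact and_congr_right (h p)

/-- The edges of the path are cut one at a time from the root `u` on, each vertex reached becoming
the root for the next edge. The weights are read backwards because parents point towards `u`. -/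
theorem rootedSum_walk (w : X → X → ℝ) {H : SimpleGraph X} {u v : X} (γ : H.Walk u v)
    (hγ : γ.IsPath) (S : Finset X) (hu : u ∈ S) (hS : ∀ x ∈ γ.support, x ∈ S → x = u) :
    rootedSum w S (fun p => ∀ d ∈ γ.darts, p d.snd = d.fst) =
      walkProd (fun x y => w y x) γ * rootedSum w (S ∪ γ.support.toFinset) fun _ => True := by
  induction γ generalizing S with
  | nil => simp [hu, Finset.union_comm S]
  | @cons u x v h δ ih =>
    rw [SimpleGraph.Walk.cons_isPath_iff] at hγ
    have hx : x ∉ S := fun hx => h.ne (hS x (by simp) hx).symm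
    have := ih hγ.1 (insert x S) (by simp) (fun y hy hy' => by
      rcases Finset.mem_insert.1 hy' with rfl | hy'
      · rfl
      · have := hS y (by simp [hy]) hy'
        exact absurd (this ▸ hy) hγ.2)
    have hsup : insert x S ∪ δ.support.toFinset =
        S ∪ (SimpleGraph.Walk.cons h δ).support.toFinset := by
      ext y
      simp only [Finset.mem_union, Finset.mem_insert, List.mem_toFinset,
        SimpleGraph.Walk.support_cons, List.mem_cons]
      constructor
      · rintro ((rfl | h) | h) <;> simp [*]
      · rintro (h | rfl | h) <;> simp [*]
    rw [walkProd_cons, mul_assoc, ← hsup, ← this, ← rootedSum_insert w hu hx]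
    · simp
    · intro p y
      refine forall₂_congr fun d hd => ?_
      rw [Function.update_of_ne]
      rintro rfl
      rw [SimpleGraph.Walk.isPath_def, ← SimpleGraph.Walk.cons_map_snd_darts] at hγ
      exact (List.nodup_cons.1 hγ.1).1 (List.mem_map_of_mem hd)

end RootedMaps


/-! ### Spanning forests as parent maps. -/

section Forests

variable {X : Type*}

/-- The graph whose edges join the points to their parents. -/
def parentGraph (p : X → X) : SimpleGraph X := SimpleGraph.fromRel fun x y => p x = y

theorem parentGraph_adj {p : X → X} {x y : X} :
    (parentGraph p).Adj x y ↔ x ≠ y ∧ (p x = y ∨ p y = x) := SimpleGraph.fromRel_adj _ _ _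

/-- A spanning forest each of whose trees contains exactly one point of `S`. -/
def IsRootedForest (S : Finset X) (F : SimpleGraph X) : Prop :=
  F.IsAcyclic ∧ (∀ x, ∃ r ∈ S, F.Reachable x r) ∧ ∀ r ∈ S, ∀ r' ∈ S, F.Reachable r r' → r = r'

theorem IsRooted.parentGraph_adj {S : Finset X} {p : X → X} (hp : IsRooted S p) {x : X}
    (hx : x ∉ S) : (parentGraph p).Adj x (p x) :=
  Schramm.parentGraph_adj.2 ⟨(hp.apply_ne hx).symm, Or.inl rfl⟩

theorem IsRooted.exists_root [Finite X] {S : Finset X} {p : X → X} (hp : IsRooted S p) :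
    ∃ ρ : X → X, (∀ r ∈ S, ρ r = r) ∧ ∀ x, ρ (p x) = ρ x := by
  have hfix : ∀ n, ∀ r ∈ S, p^[n] r = r := fun n r hr => Function.iterate_fixed (hp.1 r hr) n
  choose n hn using (isRooted_iff.1 hp).2
  obtain ⟨B, hB⟩ := Finite.exists_le n
  refine ⟨p^[B], fun r hr => hfix B r hr, fun x => ?_⟩
  rw [← Function.iterate_succ_apply, Function.iterate_succ_apply']
  obtain ⟨k, hk⟩ := Nat.exists_eq_add_of_le' (hB x)
  rw [hk, Function.iterate_add_apply, hfix _ _ (hn x), hp.1 _ (hn x)]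

/-- The set of points whose orbit passes through `x` is preserved by all edges other than the one
from `x` to its parent. It contains `x` but, by depth, not the parent. -/
theorem IsRooted.isBridge {S : Finset X} {p : X → X} (hp : IsRooted S p) {x : X} (hx : x ∉ S) :
    (parentGraph p).IsBridge s(x, p x) := by
  obtain ⟨b, hb, hb'⟩ := hp.exists_depth
  rw [SimpleGraph.isBridge_iff]
  have key : ∀ z, z ≠ x → ((∃ n, p^[n] z = x) ↔ ∃ n, p^[n] (p z) = x) := fun z hz => by
    refine ⟨fun ⟨n, hn⟩ => ?_, fun ⟨n, hn⟩ => ⟨n + 1, hn⟩⟩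
    cases n with
    | zero => exact absurd hn hz
    | succ n => exact ⟨n, hn⟩
  have hr : ∀ z z', ((parentGraph p).deleteEdges {s(x, p x)}).Reachable z z' →
      ((∃ n, p^[n] z = x) ↔ ∃ n, p^[n] z' = x) := by
    rintro z z' ⟨γ⟩
    induction γ with
    | nil => rfl
    | @cons z y z' h q ih =>
      rw [SimpleGraph.deleteEdges_adj, Schramm.parentGraph_adj, Set.mem_singleton_iff] at h
      rw [← ih]
      obtain ⟨⟨-, rfl | rfl⟩, h2⟩ := h
      · exact key _ fun h => h2 (by rw [h])
      · exact (key _ fun h => h2 (by rw [h, Sym2.eq_swap])).symm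
  intro h
  obtain ⟨n, hn⟩ := (hr _ _ h).1 ⟨0, rfl⟩
  have h1 := hb' n (p x)
  rw [hn] at h1
  exact (hb x hx).not_ge h1

theorem IsRooted.reachable_root {S : Finset X} {p : X → X} (hp : IsRooted S p) (x : X) :
    ∃ r ∈ S, (parentGraph p).Reachable x r := by
  refine hp.induction (Q := fun x => ∃ r ∈ S, (parentGraph p).Reachable x r)
    (fun x hx => ⟨x, hx, SimpleGraph.Reachable.refl _⟩) (fun x hx => ?_) x
  rintro ⟨r, hr, h⟩
  exact ⟨r, hr, (hp.parentGraph_adj hx).reachable.trans h⟩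

theorem IsRooted.isRootedForest [Finite X] {S : Finset X} {p : X → X} (hp : IsRooted S p) :
    IsRootedForest S (parentGraph p) := by
  refine ⟨SimpleGraph.isAcyclic_iff_forall_adj_isBridge.2 fun x y h => ?_, hp.reachable_root,
    fun r hr r' hr' h => ?_⟩
  · rw [Schramm.parentGraph_adj] at h
    obtain ⟨h1, rfl | rfl⟩ := h
    · exact hp.isBridge fun h => h1 (hp.1 x h).symm
    · rw [Sym2.eq_swap]
      exact hp.isBridge fun h => h1 (hp.1 y h)
  · obtain ⟨ρ, h1, h2⟩ := hp.exists_root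
    have : ∀ z z', (parentGraph p).Reachable z z' → ρ z = ρ z' := by
      rintro z z' ⟨γ⟩
      induction γ with
      | nil => rfl
      | @cons z y z' h q ih =>
        rw [← ih]
        obtain ⟨-, rfl | rfl⟩ := Schramm.parentGraph_adj.1 h
        · exact (h2 _).symm
        · exact h2 _
    rw [← h1 r hr, ← h1 r' hr', this r r' h]

/-- Induction from the roots. If the maps agree at `p x`, the edge between `x` and `p x` cannot be
the parent edge of `p x` for the second map, since `p (p x) = x` contradicts the depth. -/
theorem IsRooted.eq_of_parentGraph_eq {S : Finset X} {p p' : X → X} (hp : IsRooted S p)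
    (hp' : IsRooted S p') (h : parentGraph p = parentGraph p') : p = p' := by
  obtain ⟨b, hb, hb'⟩ := hp.exists_depth
  funext x
  refine hp.induction (Q := fun x => p x = p' x) (fun x hx => by rw [hp.1 x hx, hp'.1 x hx])
    (fun x hx ih => ?_) x
  have h1 := hp.parentGraph_adj hx
  rw [h, Schramm.parentGraph_adj] at h1
  rcases h1.2 with h2 | h2
  · exact h2.symm
  · have h3 := hb' 2 x
    have h4 := hb x hx
    have h5 := hb' 1 (p x)
    rw [Function.iterate_one, ih, h2] at h5
    exact absurd h4 h5.not_gt

/-- The parent is a neighbour closer to the root of the component. Any edge of `F` not of this form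
would be a bridge whose ends are still joined through their common root. -/
theorem IsRootedForest.exists_parent {S : Finset X} {F : SimpleGraph X} (hF : IsRootedForest S F) :
    ∃ p, IsRooted S p ∧ parentGraph p = F := by
  classical
  obtain ⟨hac, hr, huniq⟩ := hF
  choose r hrS hr using hr
  have hrr : ∀ x y, F.Reachable x y → r x = r y := fun x y h =>
    huniq _ (hrS x) _ (hrS y) ((hr x).symm.trans (h.trans (hr y)))
  have hstep : ∀ x, x ∉ S → ∃ y, F.Adj x y ∧ F.dist y (r y) < F.dist x (r x) := by
    intro x hx
    obtain ⟨q, hq⟩ := (hr x).exists_walk_length_eq_dist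
    generalize hz : r x = z at q
    cases q with
    | nil => exact absurd (hz ▸ hrS x) hx
    | @cons _ y _ h q =>
      refine ⟨y, h, ?_⟩
      rw [← hrr x y h.reachable, hz]
      rw [SimpleGraph.Walk.length_cons] at hq
      have := SimpleGraph.dist_le q
      omega
  choose! p hp using hstep
  set p' : X → X := fun x => if x ∈ S then x else p x with hp'
  have hroot : IsRooted S p' := by
    refine ⟨fun x hx => by simp [hp', hx], fun x => F.dist x (r x), fun x hx => ?_⟩
    simpa [hp', hx] using (hp x hx).2
  have hle : parentGraph p' ≤ F := by
    intro x y h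
    obtain ⟨h1, h2⟩ := parentGraph_adj.1 h
    rcases h2 with rfl | rfl
    · have hx : x ∉ S := fun h => h1 (hroot.1 x h).symm
      simpa [hp', hx] using (hp x hx).1
    · have hx : y ∉ S := fun h => h1 (hroot.1 y h)
      simpa [hp', hx] using (hp y hx).1.symm
  refine ⟨p', hroot, le_antisymm hle fun x y h => ?_⟩
  by_contra hn
  have hb := (SimpleGraph.isAcyclic_iff_forall_adj_isBridge.1 hac) h
  rw [SimpleGraph.isBridge_iff] at hb
  have hle' : parentGraph p' ≤ F.deleteEdges {s(x, y)} := by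
    intro z z' hz
    rw [SimpleGraph.deleteEdges_adj]
    refine ⟨hle hz, fun hzz => hn ?_⟩
    rw [Set.mem_singleton_iff] at hzz
    rw [← SimpleGraph.mem_edgeSet, ← hzz]
    exact hz
  obtain ⟨s, hs, hxs⟩ := hroot.reachable_root x
  obtain ⟨t, ht, hyt⟩ := hroot.reachable_root y
  have hst : s = t := huniq s hs t ht
    ((hxs.mono hle).symm.trans (h.reachable.trans (hyt.mono hle)))
  subst hst
  exact hb ((hxs.trans hyt.symm).mono hle')

/-- A path issuing from a root can only go down the tree: its first edge is not a parent edge of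
`u`, hence it is the parent edge of the next vertex, and simplicity passes this on to the following
edges. -/
theorem walk_edges_parentGraph_iff {H : SimpleGraph X} {p : X → X} {u v : X} (γ : H.Walk u v)
    (hγ : γ.IsPath) (hu : p u = u) :
    (∀ e ∈ γ.edges, e ∈ (parentGraph p).edgeSet) ↔ ∀ d ∈ γ.darts, p d.snd = d.fst := by
  constructor
  · have : ∀ x ∈ γ.support.tail, p u ≠ x := by
      rintro x hx rfl
      rw [hu] at hx
      rw [SimpleGraph.Walk.isPath_def, ← SimpleGraph.Walk.cons_tail_support,
        List.nodup_cons] at hγ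
      exact hγ.1 hx
    clear hu
    induction γ with
    | nil => simp
    | @cons u x v h δ ih =>
      rw [SimpleGraph.Walk.cons_isPath_iff] at hγ
      intro he
      simp only [SimpleGraph.Walk.edges_cons, List.mem_cons, forall_eq_or_imp,
        SimpleGraph.mem_edgeSet, parentGraph_adj] at he
      have h1 : p x = u := by
        rcases he.1.2 with h1 | h1
        · exact absurd h1 (this x (by simp))
        · exact h1
      simp only [SimpleGraph.Walk.darts_cons, List.mem_cons, forall_eq_or_imp]
      refine ⟨h1, ih hγ.1 (fun y hy hxy => hγ.2 ?_) he.2⟩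
      rw [← h1, hxy]
      exact List.mem_of_mem_tail hy
  · intro h e he
    obtain ⟨d, hd, rfl⟩ := List.mem_map.1 he
    exact parentGraph_adj.2 ⟨d.adj.ne, Or.inr (h d hd)⟩

variable [Fintype X] [DecidableEq X]

theorem IsRooted.prod_edgeFinset {S : Finset X} {p : X → X} (hp : IsRooted S p)
    (c : Sym2 X → ℝ) [Fintype (parentGraph p).edgeSet] :
    ∏ e ∈ (parentGraph p).edgeFinset, c e = ∏ x ∈ Sᶜ, c s(x, p x) := by
  have himg : (parentGraph p).edgeFinset = Sᶜ.image fun x => s(x, p x) := by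
    ext e
    induction e using Sym2.ind with | _ x y
    simp only [SimpleGraph.mem_edgeFinset, SimpleGraph.mem_edgeSet, Finset.mem_image,
      Finset.mem_compl]
    constructor
    · intro h
      obtain ⟨h1, rfl | rfl⟩ := Schramm.parentGraph_adj.1 h
      · exact ⟨x, fun h => h1 (hp.1 x h).symm, rfl⟩
      · exact ⟨y, fun h => h1 (hp.1 y h), Sym2.eq_swap⟩
    · rintro ⟨z, hz, h⟩
      rw [← SimpleGraph.mem_edgeSet, ← h]
      exact hp.parentGraph_adj hz
  rw [himg, Finset.prod_image]
  intro x hx y hy hxy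
  simp only [Finset.coe_compl, Set.mem_compl_iff, Finset.mem_coe] at hx hy
  obtain ⟨b, hb⟩ := hp.2
  rcases Sym2.eq_iff.1 hxy with ⟨h, -⟩ | ⟨h1, h2⟩
  · exact h
  · have h3 := hb x hx
    have h4 := hb y hy
    rw [← h1] at h4
    rw [h2] at h3
    omega

-- Forests are replaced by their parent maps, and the edge weights become a product over the
-- vertices outside `S`. Non-edges get weight zero, which enforces `F ≤ H`.
open Classical in
theorem sum_rootedForest (H : SimpleGraph X) (c : Sym2 X → ℝ) (S : Finset X)
    (Q : SimpleGraph X → Prop) :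
    ∑ F : SimpleGraph X with F ≤ H ∧ IsRootedForest S F ∧ Q F, ∏ e ∈ F.edgeFinset, c e =
      rootedSum (fun x y => if H.Adj x y then c s(x, y) else 0) S fun p => Q (parentGraph p) := by
  have h1 : rootedSum (fun x y => if H.Adj x y then c s(x, y) else 0) S
      (fun p => Q (parentGraph p)) = ∑ p : X → X with
        (IsRooted S p ∧ Q (parentGraph p)) ∧ ∀ x ∉ S, H.Adj x (p x), ∏ x ∈ Sᶜ, c s(x, p x) := by
    unfold rootedSum
    refine Eq.trans (Finset.sum_congr rfl fun p _ => ?_)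
      ((Finset.sum_filter _ _).symm.trans (Finset.sum_congr (Finset.filter_filter _ _ _) fun _ _ => rfl))
    split_ifs with h
    · exact Finset.prod_congr rfl fun x hx => if_pos (h x (Finset.mem_compl.1 hx))
    · push Not at h
      obtain ⟨x, hx, h⟩ := h
      exact Finset.prod_eq_zero (Finset.mem_compl.2 hx) (if_neg h)
  rw [h1]
  symm
  refine Finset.sum_bij (fun p _ => parentGraph p) ?_ ?_ ?_ ?_
  · intro p hp
    simp only [Finset.mem_filter_univ] at hp ⊢
    refine ⟨fun x y h => ?_, hp.1.1.isRootedForest, hp.1.2⟩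
    obtain ⟨h1, rfl | rfl⟩ := parentGraph_adj.1 h
    · exact hp.2 x fun h => h1 (hp.1.1.1 x h).symm
    · exact (hp.2 y fun h => h1 (hp.1.1.1 y h)).symm
  · intro p hp p' hp' h
    simp only [Finset.mem_filter_univ] at hp hp'
    exact hp.1.1.eq_of_parentGraph_eq hp'.1.1 h
  · intro F hF
    simp only [Finset.mem_filter_univ] at hF
    obtain ⟨p, hp, rfl⟩ := hF.2.1.exists_parent
    refine ⟨p, ?_, rfl⟩
    simp only [Finset.mem_filter_univ]
    exact ⟨⟨hp, hF.2.2⟩, fun x hx => hF.1 (hp.parentGraph_adj hx)⟩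
  · intro p hp
    simp only [Finset.mem_filter_univ] at hp
    exact (hp.1.1.prod_edgeFinset c).symm

end Forests


/-! ### Path weights as principal minors of the Laplacian. -/

section ForestDeterminant

variable {V : Type*} (G : SimpleGraph V) (D : Finset V)

/-- The inclusion of the graph into the extended graph. -/
def someHom : G →g extGraph G D := ⟨some, fun h => h⟩

@[simp] theorem someHom_apply (x : V) : someHom G D x = some x := rfl

theorem walkProd_map {W : Type*} {H : SimpleGraph W} {R : Type*} [CommRing R] (f : G →g H)
    (w : W → W → R) {u v : V} (γ : G.Walk u v) :
    walkProd w (γ.map f) = walkProd (fun x y => w (f x) (f y)) γ := by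
  induction γ with
  | nil => simp
  | cons h p ih => simp [ih]

theorem walkProd_congr {R : Type*} [CommRing R] {w w' : V → V → R}
    (h : ∀ x y, G.Adj x y → w x y = w' x y) {u v : V} (γ : G.Walk u v) :
    walkProd w γ = walkProd w' γ := by
  induction γ with
  | nil => simp
  | cons h' p ih => simp [ih, h _ _ h']

open Classical in
/-- The weights of the steps in the extended graph. -/
noncomputable def extWeight (G : SimpleGraph V) (c : Sym2 V → ℝ) (D : Finset V) (x y : Option V) : ℝ :=
  if (extGraph G D).Adj x y then extCond c s(x, y) else 0

theorem extWeight_some [DecidableRel G.Adj] (c : Sym2 V → ℝ) (x y : V) :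
    extWeight G c D (some x) (some y) = if G.Adj x y then c s(x, y) else 0 := by
  classical exact if_congr Iff.rfl rfl rfl

variable [DecidableEq V]

/-- The two trees are rooted at `none` and `some u`; the vertex `v` needs no separate condition
because `γ` joins it to `u`. -/
theorem isTwoForest_iff {u v : V} (γ : G.Walk u v) (F : SimpleGraph (Option V)) :
    (IsTwoForest G D u v F ∧ ∀ e ∈ γ.edges, e.map some ∈ F.edgeSet) ↔
      F ≤ extGraph G D ∧ IsRootedForest {none, some u} F ∧
        ∀ e ∈ (γ.map (someHom G D)).edges, e ∈ F.edgeSet := by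
  have hedges : (∀ e ∈ (γ.map (someHom G D)).edges, e ∈ F.edgeSet) ↔
      ∀ e ∈ γ.edges, e.map some ∈ F.edgeSet := by
    rw [SimpleGraph.Walk.edges_map]
    simp only [List.mem_map, forall_exists_index, and_imp, forall_apply_eq_imp_iff₂]
    rfl
  rw [hedges]
  constructor
  · rintro ⟨⟨h1, h2, -, h4, h5⟩, h6⟩
    refine ⟨h1, ⟨h2, fun x => ?_, fun r hr r' hr' h => ?_⟩, h6⟩
    · rcases h5 x with h | h
      · exact ⟨_, by simp, h⟩
      · exact ⟨_, by simp, h⟩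
    · simp only [Finset.mem_insert, Finset.mem_singleton] at hr hr'
      rcases hr with rfl | rfl <;> rcases hr' with rfl | rfl
      · rfl
      · exact absurd h.symm h4
      · exact absurd h h4
      · rfl
  · rintro ⟨h1, ⟨h2, h3, h4⟩, h6⟩
    refine ⟨⟨h1, h2, ?_, fun h => ?_, fun x => ?_⟩, h6⟩
    · exact ((γ.map (someHom G D)).transfer F (hedges.2 h6)).reachable
    · exact absurd (h4 _ (by simp) _ (by simp) h) (by simp)
    · obtain ⟨r, hr, h⟩ := h3 x
      simp only [Finset.mem_insert, Finset.mem_singleton] at hr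
      rcases hr with rfl | rfl
      · exact Or.inr h
      · exact Or.inl h

variable [Fintype V]

theorem det_option {R : Type*} [CommRing R] (M : Matrix (Option V) (Option V) R)
    (h : ∀ j, M none j = if j = none then 1 else 0) : M.det = (M.submatrix some some).det := by
  rw [← Matrix.det_submatrix_equiv_self (Equiv.optionEquivSumPUnit.{0} V).symm M]
  have : M.submatrix (Equiv.optionEquivSumPUnit.{0} V).symm (Equiv.optionEquivSumPUnit.{0} V).symm =
      Matrix.fromBlocks (M.submatrix some some) (Matrix.of fun i (_ : PUnit.{1}) => M (some i) none)
        0 1 := by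
    ext (i | i) (j | j) <;> simp [h]
  rw [this, Matrix.det_fromBlocks_zero₂₁, Matrix.det_one, mul_one]

variable [DecidableRel G.Adj] (c : Sym2 V → ℝ)

theorem dirLaplacian_extWeight (x j : V) :
    dirLaplacian (extWeight G c D) (some x) (some j) = laplacian G c D x j := by
  have h1 : extWeight G c D (some x) none = if x ∈ D then 1 else 0 := by
    classical exact if_congr Iff.rfl rfl rfl
  have h2 := extWeight_some G D c x
  simp only [dirLaplacian, Matrix.of_apply, Fintype.sum_option, h1, h2, laplacian, deg]
  by_cases h : x = j
  · subst h
    have : ∑ w ∈ G.neighborFinset x, c s(x, w) = ∑ w, if G.Adj x w then c s(x, w) else 0 := by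
      rw [← Finset.sum_filter]
      exact Finset.sum_congr (by ext; simp) fun _ _ => rfl
    rw [this, add_comm]
    simp only [if_true, reduceCtorEq, if_false, sub_zero, mul_one]
    congr 1
    refine Finset.sum_congr rfl fun y _ => ?_
    by_cases hy : y = x
    · subst hy; simp
    · simp [hy]
  · rw [if_neg h]
    by_cases h' : G.Adj x j <;> simp [h, h']

theorem det_killRows_extWeight (T : Finset V) (S : Finset (Option V)) (h0 : none ∈ S)
    (hS : ∀ x, some x ∈ S ↔ x ∈ T) :
    (killRows (dirLaplacian (extWeight G c D)) S).det = (killRows (laplacian G c D) T).det := by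
  rw [det_option _ fun j => by simp [killRows, h0, Matrix.one_apply, eq_comm]]
  congr 1
  ext x j
  simp [killRows, hS, dirLaplacian_extWeight, Matrix.one_apply]

/-- The weight of a path in terms of a principal minor of the Laplacian. -/
theorem pathWeight_eq {u v : V} (γ : G.Path u v) :
    pathWeight G c D γ = walkProd (fun x y => c s(x, y)) γ.1 *
      (killRows (laplacian G c D) γ.1.support.toFinset).det := by
  classical
  set γ' := γ.1.map (someHom G D) with hγ'
  have hsup : ∀ x, x ∈ γ'.support ↔ ∃ y ∈ γ.1.support, some y = x := fun x => by
    rw [hγ', SimpleGraph.Walk.support_map, List.mem_map]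
    rfl
  have hpath : γ'.IsPath := γ.2.map (Option.some_injective V)
  have h1 : pathWeight G c D γ = ∑ F : SimpleGraph (Option V) with
      F ≤ extGraph G D ∧ IsRootedForest {none, some u} F ∧ ∀ e ∈ γ'.edges, e ∈ F.edgeSet,
        ∏ e ∈ F.edgeFinset, extCond c e := by
    unfold pathWeight forestWeight
    refine Finset.sum_congr ?_ fun F _ => ?_
    · ext F
      simp only [Finset.mem_filter_univ]
      exact isTwoForest_iff G D γ.1 F
    · convert rfl
  have h2 := sum_rootedForest (extGraph G D) (extCond c) {none, some u}
    fun F => ∀ e ∈ γ'.edges, e ∈ F.edgeSet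
  have h3 : pathWeight G c D γ = rootedSum (extWeight G c D) {none, some u}
      fun p => ∀ e ∈ γ'.edges, e ∈ (parentGraph p).edgeSet := by
    rw [h1]
    convert h2 using 3
    unfold extWeight
    congr!
  -- `γ` descends from the root `some u`. Its edges are stripped off, and the matrix-tree theorem
  -- evaluates the forests rooted at `none` and at all the vertices of `γ`.
  rw [h3, rootedSum_congr _ _ (C' := fun p => ∀ d ∈ γ'.darts, p d.snd = d.fst) fun p hp =>
    walk_edges_parentGraph_iff γ' hpath (hp.1 _ (by simp)),
    rootedSum_walk _ γ' hpath _ (by simp), ← det_killRows_dirLaplacian,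
    det_killRows_extWeight G D c γ.1.support.toFinset, hγ', walkProd_map]
  · congr 1
    refine walkProd_congr G (fun x y h => ?_) γ.1
    simp [extWeight_some, h.symm, Sym2.eq_swap]
  · simp
  · intro x
    simp only [Finset.mem_union, Finset.mem_insert, reduceCtorEq, Option.some.injEq,
      Finset.mem_singleton, false_or, List.mem_toFinset, hsup, exists_eq_right]
    exact or_iff_right_of_imp fun h => h ▸ γ.1.start_mem_support
  · intro x hx hx'
    simp only [Finset.mem_insert, Finset.mem_singleton] at hx'
    rcases hx' with rfl | rfl
    · obtain ⟨y, -, hy⟩ := (hsup none).1 hx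
      simp at hy
    · rfl

end ForestDeterminant


/-! ### Darts of a simple path. -/

section PathDarts

variable {V : Type*} {G : SimpleGraph V} {u v : V} {γ : G.Walk u v}

theorem edge_mem_edges_iff {d : G.Dart} :
    d.edge ∈ γ.edges ↔ d ∈ γ.darts ∨ d.symm ∈ γ.darts := by
  constructor
  · intro h
    obtain ⟨e, he, h⟩ := List.mem_map.1 h
    rcases (SimpleGraph.dart_edge_eq_iff _ _).1 h with rfl | rfl
    · exact Or.inl he
    · exact Or.inr he
  · rintro (h | h)
    · exact List.mem_map_of_mem h
    · rw [← SimpleGraph.Dart.edge_symm]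
      exact List.mem_map_of_mem h

theorem fst_ne_of_mem_darts (hγ : γ.IsPath) {d : G.Dart} (hd : d ∈ γ.darts) : d.fst ≠ v := by
  intro h
  have h1 : d.fst ∈ γ.support.dropLast := by
    rw [← SimpleGraph.Walk.map_fst_darts]; exact List.mem_map_of_mem hd
  have h2 := hγ.support_nodup
  rw [← List.dropLast_append_getLast γ.support_ne_nil, List.nodup_append] at h2
  exact h2.2.2 _ h1 v (by simp) h

theorem snd_ne_of_mem_darts (hγ : γ.IsPath) {d : G.Dart} (hd : d ∈ γ.darts) : d.snd ≠ u := by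
  intro h
  have h1 : d.snd ∈ γ.support.tail := by
    rw [← SimpleGraph.Walk.map_snd_darts]; exact List.mem_map_of_mem hd
  have h2 := hγ.support_nodup
  rw [← SimpleGraph.Walk.cons_tail_support, List.nodup_cons] at h2
  exact h2.1 (h ▸ h1)

theorem eq_of_fst_eq (hγ : γ.IsPath) {d e : G.Dart} (hd : d ∈ γ.darts) (he : e ∈ γ.darts)
    (h : d.fst = e.fst) : d = e := by
  refine List.inj_on_of_nodup_map (f := fun d : G.Dart => d.fst) ?_ hd he h
  rw [SimpleGraph.Walk.map_fst_darts]
  exact hγ.support_nodup.sublist (List.dropLast_sublist _)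

theorem eq_of_snd_eq (hγ : γ.IsPath) {d e : G.Dart} (hd : d ∈ γ.darts) (he : e ∈ γ.darts)
    (h : d.snd = e.snd) : d = e := by
  refine List.inj_on_of_nodup_map (f := fun d : G.Dart => d.snd) ?_ hd he h
  rw [SimpleGraph.Walk.map_snd_darts]
  exact hγ.support_nodup.sublist (List.tail_sublist _)

theorem symm_notMem_darts (hγ : γ.IsPath) {d : G.Dart} (hd : d ∈ γ.darts) :
    d.symm ∉ γ.darts := by
  intro h
  have := List.inj_on_of_nodup_map (f := SimpleGraph.Dart.edge) hγ.isTrail.edges_nodup hd h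
    (by simp)
  exact d.symm_ne this.symm

theorem exists_dart_fst_of_ne (huv : u ≠ v) : ∃ d ∈ γ.darts, d.fst = u := by
  cases γ with
  | nil => exact absurd rfl huv
  | cons h p => exact ⟨⟨(_, _), h⟩, by simp, rfl⟩

theorem exists_dart_snd_of_ne (huv : u ≠ v) : ∃ d ∈ γ.darts, d.snd = v := by
  obtain ⟨d, hd, h⟩ := exists_dart_fst_of_ne (γ := γ.reverse) huv.symm
  rw [SimpleGraph.Walk.darts_reverse, List.mem_reverse, List.mem_map] at hd
  obtain ⟨e, he, rfl⟩ := hd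
  exact ⟨e, he, h⟩

end PathDarts

/-! ### The two sides of a path in an embedded graph. -/

namespace RotationSystem

variable {V : Type*} {G : SimpleGraph V} (M : RotationSystem G)

theorem facePerm_apply (d : G.Dart) : M.facePerm d = M.rot⁻¹ d.symm := rfl

theorem facePerm_symm_rot (d : G.Dart) : M.facePerm (M.rot d).symm = d := by
  simp [facePerm_apply]

theorem fst_facePerm (d : G.Dart) : (M.facePerm d).fst = d.snd := by
  have := M.fst_rot (M.facePerm d)
  rw [facePerm_apply, Equiv.Perm.inv_def, Equiv.apply_symm_apply] at this
  exact this.symm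

theorem fst_rot_pow (k : ℕ) (d : G.Dart) : ((M.rot ^ k) d).fst = d.fst := by
  induction k with
  | zero => rfl
  | succ k ih => rw [pow_succ', Equiv.Perm.mul_apply, M.fst_rot, ih]

theorem face_facePerm (d : G.Dart) : M.face (M.facePerm d) = M.face d :=
  Quotient.sound (Equiv.Perm.SameCycle.refl _ _).apply_left

theorem face_facePerm_pow (k : ℕ) (d : G.Dart) : M.face ((M.facePerm ^ k) d) = M.face d := by
  induction k with
  | zero => rfl
  | succ k ih => rw [pow_succ', Equiv.Perm.mul_apply, face_facePerm, ih]

theorem face_symm (d : G.Dart) : M.face d.symm = M.face (M.rot⁻¹ d) := by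
  rw [← face_facePerm, facePerm_apply, SimpleGraph.Dart.symm_symm]

section Sides

variable {M} {a₁ a₂ : G.Dart} {u v : V} {γ : G.Walk u v}

theorem SameSide.refl (d : G.Dart) : M.SameSide a₁ a₂ γ d d := Relation.EqvGen.refl d

theorem SameSide.symm {d e : G.Dart} (h : M.SameSide a₁ a₂ γ d e) : M.SameSide a₁ a₂ γ e d :=
  Relation.EqvGen.symm _ _ h

theorem SameSide.trans {d e g : G.Dart} (h : M.SameSide a₁ a₂ γ d e)
    (h' : M.SameSide a₁ a₂ γ e g) : M.SameSide a₁ a₂ γ d g :=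
  Relation.EqvGen.trans _ _ _ h h'

theorem sameSide_facePerm {d : G.Dart} (h1 : M.facePerm d ≠ a₁) (h2 : M.facePerm d ≠ a₂) :
    M.SameSide a₁ a₂ γ d (M.facePerm d) := Relation.EqvGen.rel _ _ (Or.inl ⟨rfl, h1, h2⟩)

theorem sameSide_symm {d : G.Dart} (h : d.edge ∉ γ.edges) : M.SameSide a₁ a₂ γ d d.symm :=
  Relation.EqvGen.rel _ _ (Or.inr ⟨rfl, h⟩)

theorem sameSide_symm_rot {d : G.Dart} (h1 : d ≠ a₁) (h2 : d ≠ a₂) :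
    M.SameSide a₁ a₂ γ d (M.rot d).symm := by
  have := sameSide_facePerm (M := M) (γ := γ) (d := (M.rot d).symm) (a₁ := a₁) (a₂ := a₂)
  rw [facePerm_symm_rot] at this
  exact (this h1 h2).symm

/-- Turning counterclockwise about a vertex from `g` to the first dart in `T`. -/
theorem exists_sameSide_symm [Finite G.Dart] (T : G.Dart → Prop) (g : G.Dart)
    (hT : ∃ t, T t ∧ t.fst = g.fst) (hg1 : g ≠ a₁) (hg2 : g ≠ a₂)
    (h : ∀ e : G.Dart, e.fst = g.fst → ¬ T e → (e ≠ a₁ ∧ e ≠ a₂) ∧ (e = g ∨ e.edge ∉ γ.edges)) :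
    ∃ t, T t ∧ t.fst = g.fst ∧ M.SameSide a₁ a₂ γ g t.symm := by
  classical
  have hex : ∃ k, T ((M.rot ^ (k + 1)) g) := by
    obtain ⟨t, ht, htg⟩ := hT
    obtain ⟨i, hi, -, hit⟩ := (M.sameCycle g t htg.symm).exists_pow_eq''
    obtain ⟨k, rfl⟩ := Nat.exists_eq_succ_of_ne_zero hi.ne'
    exact ⟨k, hit ▸ ht⟩
  have key : ∀ j ≤ Nat.find hex, M.SameSide a₁ a₂ γ g ((M.rot ^ (j + 1)) g).symm := by
    intro j
    induction j with
    | zero => exact fun _ => by simpa using sameSide_symm_rot hg1 hg2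
    | succ j ih =>
      intro hj
      have h1 := h _ (M.fst_rot_pow (j + 1) g) (Nat.find_min hex (Nat.lt_of_succ_le hj))
      have h2 : M.SameSide a₁ a₂ γ g ((M.rot ^ (j + 1)) g) := by
        rcases h1.2 with h2 | h2
        · rw [h2]; exact SameSide.refl g
        · exact (ih (Nat.le_of_succ_le hj)).trans (sameSide_symm h2).symm
      rw [pow_succ', Equiv.Perm.mul_apply]
      exact h2.trans (sameSide_symm_rot h1.1.1 h1.1.2)
  exact ⟨_, Nat.find_spec hex, M.fst_rot_pow _ g, key _ le_rfl⟩

/-- Turning counterclockwise about a vertex from `g` to `e`. -/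
theorem sameSide_symm_of_fst_eq [Finite G.Dart] {g e : G.Dart} (hge : e.fst = g.fst)
    (hg1 : g ≠ a₁) (hg2 : g ≠ a₂)
    (h : ∀ h : G.Dart, h.fst = g.fst → h ≠ e → (h ≠ a₁ ∧ h ≠ a₂) ∧ (h = g ∨ h.edge ∉ γ.edges)) :
    M.SameSide a₁ a₂ γ g e.symm := by
  obtain ⟨t, rfl, -, ht⟩ := exists_sameSide_symm (M := M) (fun t => t = e) g ⟨e, rfl, hge⟩ hg1 hg2 h
  exact ht

section Path

variable [Finite G.Dart] (hγ : γ.IsPath) (huv : u ≠ v) (ha₁ : a₁.fst = u) (ha₂ : a₂.fst = v)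
include hγ ha₁ ha₂

/-- At the common vertex, the counterclockwise sector from `e` to the reverse of `d` is on the left
of the path and the complementary sector on its right. Neither contains another edge of the path,
nor a marked corner, because the vertex is not an end of the path. -/
theorem sameSide_consecutive {d e : G.Dart} (hd : d ∈ γ.darts) (he : e ∈ γ.darts)
    (hde : d.snd = e.fst) :
    M.SameSide a₁ a₂ γ d e ∧ M.SameSide a₁ a₂ γ d.symm e.symm := by
  have h1 : ∀ g : G.Dart, g.fst = e.fst → g ≠ a₁ ∧ g ≠ a₂ := by
    refine fun g hg => ⟨?_, ?_⟩
    · rintro rfl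
      exact snd_ne_of_mem_darts hγ hd (by rw [hde, ← hg, ha₁])
    · rintro rfl
      exact fst_ne_of_mem_darts hγ he (by rw [← hg, ha₂])
  have h2 : ∀ g : G.Dart, g.fst = e.fst → g = e ∨ g = d.symm ∨ g.edge ∉ γ.edges := by
    intro g hg
    by_cases h : g.edge ∈ γ.edges
    · rcases edge_mem_edges_iff.1 h with h | h
      · exact Or.inl (eq_of_fst_eq hγ h he hg)
      · have : g.symm = d := eq_of_snd_eq hγ h hd (by rw [hde, ← hg]; rfl)
        exact Or.inr (Or.inl (by rw [← this, SimpleGraph.Dart.symm_symm]))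
    · exact Or.inr (Or.inr h)
  constructor
  · have := sameSide_symm_of_fst_eq (M := M) (a₁ := a₁) (a₂ := a₂) (γ := γ) (g := e) (e := d.symm)
      hde (h1 e rfl).1 (h1 e rfl).2 fun g hg hgd => ⟨h1 g hg, by
        rcases h2 g hg with h | h | h
        · exact Or.inl h
        · exact absurd h hgd
        · exact Or.inr h⟩
    rw [SimpleGraph.Dart.symm_symm] at this
    exact this.symm
  · exact sameSide_symm_of_fst_eq hde.symm (h1 d.symm hde).1 (h1 d.symm hde).2
      fun g hg hgd => ⟨h1 g (hg.trans hde), by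
        rcases h2 g (hg.trans hde) with h | h | h
        · exact absurd h hgd
        · exact Or.inl h
        · exact Or.inr h⟩

theorem sameSide_of_mem_darts {d e : G.Dart} (hd : d ∈ γ.darts) (he : e ∈ γ.darts) :
    M.SameSide a₁ a₂ γ d e ∧ M.SameSide a₁ a₂ γ d.symm e.symm := by
  set R : G.Dart → G.Dart → Prop := fun d e =>
    M.SameSide a₁ a₂ γ d e ∧ M.SameSide a₁ a₂ γ d.symm e.symm with hR
  have h1 : List.IsChain R γ.darts := List.IsChain.imp_of_mem_imp
    (fun d e hd he hde => sameSide_consecutive hγ ha₁ ha₂ hd he hde) γ.isChain_dartAdj_darts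
  have : Trans R R R := ⟨fun h h' => ⟨h.1.trans h'.1, h.2.trans h'.2⟩⟩
  have : Std.Symm R := ⟨fun _ _ h => ⟨h.1.symm, h.2.symm⟩⟩
  exact List.Pairwise.forall_of_forall (fun d _ => ⟨SameSide.refl _, SameSide.refl _⟩)
    h1.pairwise hd he

include huv

/-- Turning counterclockwise from the first dart of the path to `a₁` stays on the left of the path,
and the marked corner only comes after `a₁`. At the other end the turn is from the reversed last
dart to `a₂`, on the right. -/
theorem exists_sameSide_start : ∃ d ∈ γ.darts, M.SameSide a₁ a₂ γ a₁ d := by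
  obtain ⟨d, hd, hdu⟩ := exists_dart_fst_of_ne (γ := γ) huv
  by_cases h : a₁ = d
  · exact ⟨d, hd, h ▸ SameSide.refl _⟩
  have h2 : ∀ g : G.Dart, g.fst = d.fst → (g ≠ a₂) ∧ (g = d ∨ g.edge ∉ γ.edges) := by
    refine fun g hg => ⟨fun h => huv ?_, ?_⟩
    · rw [← hdu, ← hg, h, ha₂]
    by_cases h : g.edge ∈ γ.edges
    · rcases edge_mem_edges_iff.1 h with h | h
      · exact Or.inl (eq_of_fst_eq hγ h hd hg)
      · exact absurd (hg.trans hdu) (snd_ne_of_mem_darts hγ h)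
    · exact Or.inr h
  have h3 : M.SameSide a₁ a₂ γ d a₁.symm := sameSide_symm_of_fst_eq (ha₁.trans hdu.symm)
    (Ne.symm h) (h2 d rfl).1 fun g hg hga => ⟨⟨hga, (h2 g hg).1⟩, (h2 g hg).2⟩
  have h4 : a₁.edge ∉ γ.edges := ((h2 a₁ (ha₁.trans hdu.symm)).2).resolve_left h
  exact ⟨d, hd, (h3.trans (sameSide_symm h4).symm).symm⟩

theorem exists_sameSide_end : ∃ d ∈ γ.darts, M.SameSide a₁ a₂ γ a₂ d.symm := by
  obtain ⟨d, hd, hdv⟩ := exists_dart_snd_of_ne (γ := γ) huv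
  by_cases h : a₂ = d.symm
  · exact ⟨d, hd, h ▸ SameSide.refl _⟩
  have h2 : ∀ g : G.Dart, g.fst = v → (g ≠ a₁) ∧ (g = d.symm ∨ g.edge ∉ γ.edges) := by
    refine fun g hg => ⟨fun h => huv ?_, ?_⟩
    · rw [← hg, h, ha₁]
    by_cases h : g.edge ∈ γ.edges
    · rcases edge_mem_edges_iff.1 h with h | h
      · exact absurd hg (fst_ne_of_mem_darts hγ h)
      · have : g.symm = d := eq_of_snd_eq hγ h hd (by rw [hdv, ← hg]; rfl)
        exact Or.inl (by rw [← this, SimpleGraph.Dart.symm_symm])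
    · exact Or.inr h
  have h3 : M.SameSide a₁ a₂ γ d.symm a₂.symm := sameSide_symm_of_fst_eq (ha₂.trans hdv.symm)
    (h2 d.symm hdv).1 (Ne.symm h)
    fun g hg hga => ⟨⟨(h2 g (hg.trans hdv)).1, hga⟩, (h2 g (hg.trans hdv)).2⟩
  have h4 : a₂.edge ∉ γ.edges := ((h2 a₂ ha₂).2).resolve_left h
  exact ⟨d, hd, (h3.trans (sameSide_symm h4).symm).symm⟩

/-- In a connected graph, every dart is in the component of a side of an edge of the path. -/
theorem exists_sameSide (hG : G.Connected) (g : G.Dart) :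
    ∃ d ∈ γ.darts, M.SameSide a₁ a₂ γ g d ∨ M.SameSide a₁ a₂ γ g d.symm := by
  set C : G.Dart → Prop := fun g =>
    ∃ d ∈ γ.darts, M.SameSide a₁ a₂ γ g d ∨ M.SameSide a₁ a₂ γ g d.symm with hC
  have hCtr : ∀ g h, M.SameSide a₁ a₂ γ g h → C h → C g := by
    rintro g h hgh ⟨d, hd, h1 | h1⟩
    · exact ⟨d, hd, Or.inl (hgh.trans h1)⟩
    · exact ⟨d, hd, Or.inr (hgh.trans h1)⟩
  have hedge : ∀ g : G.Dart, g.edge ∈ γ.edges → C g := by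
    intro g hg
    rcases edge_mem_edges_iff.1 hg with h | h
    · exact ⟨g, h, Or.inl (SameSide.refl _)⟩
    · exact ⟨g.symm, h, Or.inr (by rw [SimpleGraph.Dart.symm_symm]; exact SameSide.refl _)⟩
  have hC1 : C a₁ := by
    obtain ⟨d, hd, h⟩ := exists_sameSide_start (M := M) hγ huv ha₁ ha₂
    exact ⟨d, hd, Or.inl h⟩
  have hC2 : C a₂ := by
    obtain ⟨d, hd, h⟩ := exists_sameSide_end (M := M) hγ huv ha₁ ha₂
    exact ⟨d, hd, Or.inr h⟩
  have hCs : ∀ g : G.Dart, C g → C g.symm := by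
    intro g hg
    by_cases h : g.edge ∈ γ.edges
    · exact hedge _ (by simpa using h)
    · exact hCtr _ _ (sameSide_symm h).symm hg
  have hbase : ∀ g : G.Dart, g.fst ∈ γ.support → C g := by
    intro g hg
    -- Turn about the vertex until an edge of the path or a marked corner blocks the way; both are
    -- already known to touch a side of the path.
    set T : G.Dart → Prop := fun t => t.edge ∈ γ.edges ∨ t = a₁ ∨ t = a₂ with hT
    by_cases hgT : T g
    · rcases hgT with h | rfl | rfl
      · exact hedge g h
      · exact hC1
      · exact hC2
    have hTex : ∃ t, T t ∧ t.fst = g.fst := by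
      by_cases h : g.fst = v
      · exact ⟨a₂, Or.inr (Or.inr rfl), ha₂.trans h.symm⟩
      · rw [← List.dropLast_append_getLast γ.support_ne_nil, List.mem_append] at hg
        rcases hg with hg | hg
        · rw [← SimpleGraph.Walk.map_fst_darts, List.mem_map] at hg
          obtain ⟨d, hd, hdg⟩ := hg
          exact ⟨d, Or.inl (edge_mem_edges_iff.2 (Or.inl hd)), hdg⟩
        · exact absurd (by simpa using hg) h
    have hnT : ∀ e : G.Dart, ¬ T e → (e ≠ a₁ ∧ e ≠ a₂) ∧ (e = g ∨ e.edge ∉ γ.edges) := by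
      intro e he
      simp only [hT, not_or] at he
      exact ⟨he.2, Or.inr he.1⟩
    obtain ⟨t, ht, -, h⟩ := exists_sameSide_symm (M := M) (γ := γ) T g hTex (hnT g hgT).1.1
      (hnT g hgT).1.2 fun e _ he => hnT e he
    refine hCtr _ _ h (hCs t ?_)
    rcases ht with h | rfl | rfl
    · exact hedge t h
    · exact hC1
    · exact hC2
  -- At a vertex off the path nothing blocks the rotation, so all its darts communicate, and the
  -- property is carried along a walk that reaches the path.
  have hall : ∀ {x y : V} (q : G.Walk x y), y ∈ γ.support → ∀ g : G.Dart, g.fst = x → C g := by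
    intro x y q
    induction q with
    | nil => exact fun hy g hg => hbase g (hg ▸ hy)
    | @cons x y z hxy q ih =>
      intro hz g hg
      by_cases hx : x ∈ γ.support
      · exact hbase g (hg ▸ hx)
      have hnot : ∀ e : G.Dart, e.fst = x → (e ≠ a₁ ∧ e ≠ a₂) ∧ e.edge ∉ γ.edges := by
        refine fun e he => ⟨⟨?_, ?_⟩, fun h => hx ?_⟩
        · rintro rfl
          exact hx (by rw [← he, ha₁]; simp)
        · rintro rfl
          exact hx (by rw [← he, ha₂]; simp)
        · rw [← he]
          exact γ.fst_mem_support_of_mem_edges h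
      have h1 : C (⟨(x, y), hxy⟩ : G.Dart) := hCs _ (ih hz ⟨(y, x), hxy.symm⟩ rfl)
      obtain ⟨k, hk⟩ := (M.sameCycle ⟨(x, y), hxy⟩ g hg.symm).exists_nat_pow_eq
      rw [← hk]
      clear hk
      induction k with
      | zero => exact h1
      | succ k ihk =>
        have h2 := hnot _ (M.fst_rot_pow k ⟨(x, y), hxy⟩)
        have h3 := (hnot _ (M.fst_rot_pow (k + 1) ⟨(x, y), hxy⟩)).2
        rw [pow_succ', Equiv.Perm.mul_apply] at h3 ⊢
        exact hCtr _ _ ((sameSide_symm h3).trans (sameSide_symm_rot h2.1.1 h2.1.2).symm) ihk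
  obtain ⟨q⟩ := hG.preconnected g.fst u
  exact hall q γ.start_mem_support g rfl

end Path

end Sides

end RotationSystem


/-! ### Crossings of the path and the zipper. -/

namespace RotationSystem

variable {V : Type*} {G : SimpleGraph V} {M : RotationSystem G} {a₁ a₂ : G.Dart} {u v : V}
  {γ : G.Walk u v}

theorem exists_facePerm_pow_eq [Finite G.Dart] {d e : G.Dart} (h : M.face d = M.face e) :
    ∃ k : ℕ, (M.facePerm ^ k) d = e := by
  have h' : M.facePerm.SameCycle d e := Quotient.exact h
  exact h'.exists_nat_pow_eq

theorem sameSide_of_face_eq [Finite G.Dart] {d e : G.Dart} (h : M.face d = M.face e)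
    (h1 : M.face d ≠ M.face a₁) (h2 : M.face d ≠ M.face a₂) : M.SameSide a₁ a₂ γ d e := by
  obtain ⟨k, rfl⟩ := exists_facePerm_pow_eq h
  clear h
  induction k with
  | zero => exact SameSide.refl d
  | succ k ih =>
    have h3 := M.face_facePerm_pow (k + 1) d
    rw [pow_succ', Equiv.Perm.mul_apply] at h3 ⊢
    exact ih.trans (sameSide_facePerm (fun h => h1 (by rw [← h3, h])) fun h => h2 (by rw [← h3, h]))

theorem OnArc.sameSide {d : G.Dart} (h : M.OnArc a₁ a₂ d) : M.SameSide a₁ a₂ γ a₁ d := by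
  obtain ⟨k, rfl, hk⟩ := h
  induction k with
  | zero => exact SameSide.refl _
  | succ k ih =>
    have h1 := hk (k + 1) le_rfl
    rw [pow_succ', Equiv.Perm.mul_apply] at h1 ⊢
    by_cases h2 : M.facePerm ((M.facePerm ^ k) a₁) = a₁
    · rw [h2]; exact SameSide.refl _
    · exact (ih fun j hj => hk j (hj.trans k.le_succ)).trans (sameSide_facePerm h2 h1)

theorem OnArc.face_eq {d : G.Dart} (h : M.OnArc a₁ a₂ d) : M.face d = M.face a₁ := by
  obtain ⟨k, rfl, -⟩ := h
  exact M.face_facePerm_pow k a₁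

variable {ζ : List G.Dart}

/-- Crossing the same edge backwards would return to a face already visited. -/
theorem symm_notMem_of_dual_path (F : M.Face) (h1 : ∀ d ∈ ζ.head?, M.face d = F)
    (h2 : ζ.IsChain fun d e => M.face d.symm = M.face e)
    (h3 : (F :: ζ.map fun d => M.face d.symm).Nodup) : ∀ d ∈ ζ, d.symm ∉ ζ := by
  induction ζ generalizing F with
  | nil => simp
  | cons a l ih =>
    have h1 : M.face a = F := h1 a (by simp)
    subst h1
    have hl := ih (M.face a.symm) (fun e he => by
      cases l with
      | nil => simp at he
      | cons b l =>
        obtain rfl : b = e := by simpa using he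
        exact (List.isChain_cons_cons.1 h2).1.symm)
      (List.IsChain.tail h2) (List.nodup_cons.1 h3).2
    have ha : a.symm ∉ l := fun h => by
      rw [List.nodup_cons, List.map_cons] at h3
      refine h3.1 (List.mem_cons_of_mem _ (List.mem_map.2 ⟨a.symm, h, ?_⟩))
      rw [SimpleGraph.Dart.symm_symm]
    intro d hd hd'
    rcases List.mem_cons.1 hd with rfl | hd
    · rcases List.mem_cons.1 hd' with h | h
      · exact d.symm_ne h
      · exact ha h
    · rcases List.mem_cons.1 hd' with h | h
      · rw [← h, SimpleGraph.Dart.symm_symm] at ha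
        exact ha hd
      · exact hl d hd h

/-- A dual path without repetition meets its final face only at the end. For a zipper, the faces
that it leaves thus contain no marked corner, and all darts of such a face are on the same side. -/
theorem face_ne_of_dual_path (F : M.Face) (h1 : ∀ d ∈ ζ.head?, M.face d = F)
    (h2 : ζ.IsChain fun d e => M.face d.symm = M.face e)
    (h3 : (F :: ζ.map fun d => M.face d.symm).Nodup) {t : G.Dart} (ht : t ∈ ζ.getLast?) :
    ∀ d ∈ ζ, M.face d ≠ M.face t.symm := by
  have ht' := List.mem_of_getLast? ht
  induction ζ generalizing F with
  | nil => simp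
  | cons a l ih =>
    have h1 : M.face a = F := h1 a (by simp)
    subst h1
    intro d hd
    rcases List.mem_cons.1 hd with rfl | hd
    · intro h
      exact (List.nodup_cons.1 h3).1 (List.mem_map.2 ⟨t, ht', h.symm⟩)
    · cases l with
      | nil => simp at hd
      | cons b l =>
        rw [List.getLast?_cons_cons] at ht
        refine ih (M.face a.symm) (fun e he => ?_) (List.IsChain.tail h2) (List.nodup_cons.1 h3).2
          ht (List.mem_of_getLast? ht) d hd
        obtain rfl : b = e := by simpa using he
        exact (List.isChain_cons_cons.1 h2).1.symm

theorem IsZipper.symm_notMem {f : M.Face} (hζ : M.IsZipper a₁ a₂ f ζ) {d : G.Dart} (hd : d ∈ ζ) :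
    d.symm ∉ ζ := by
  obtain ⟨e, he, hef⟩ := hζ.head
  refine symm_notMem_of_dual_path f (fun d hd => ?_) hζ.chain hζ.nodup d hd
  rwa [Option.mem_unique hd he]

theorem IsZipper.face_ne {f : M.Face} (hζ : M.IsZipper a₁ a₂ f ζ) {d : G.Dart} (hd : d ∈ ζ) :
    M.face d ≠ M.face a₁ := by
  obtain ⟨e, he, hef⟩ := hζ.head
  obtain ⟨t, ht, hta⟩ := hζ.last
  rw [← hta.face_eq]
  refine face_ne_of_dual_path f (fun d hd => ?_) hζ.chain hζ.nodup ht d hd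
  rwa [Option.mem_unique hd he]

theorem IsZipper.list_nodup {f : M.Face} (hζ : M.IsZipper a₁ a₂ f ζ) : ζ.Nodup :=
  (List.nodup_cons.1 hζ.nodup).2.of_map

theorem sum_telescope (s : G.Dart → ℤ) (h : ζ.IsChain fun d e => s d.symm = s e) {h₀ t : G.Dart}
    (hh : h₀ ∈ ζ.head?) (ht : t ∈ ζ.getLast?) :
    (ζ.map fun d => s d - s d.symm).sum = s h₀ - s t.symm := by
  induction ζ generalizing h₀ with
  | nil => simp at hh
  | cons a l ih =>
    obtain rfl : a = h₀ := by simpa using hh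
    cases l with
    | nil =>
      obtain rfl : a = t := by simpa using ht
      simp
    | cons b l =>
      rw [List.getLast?_cons_cons] at ht
      rw [List.map_cons, List.sum_cons, ih (List.IsChain.tail h) (h₀ := b) (by simp) ht,
        (List.isChain_cons_cons.1 h).1]
      ring

/-- The algebraic number of crossings of the path and the zipper. -/
noncomputable def crossing [DecidableEq G.Dart] (ζ : List G.Dart) (γ : G.Walk u v) : ℤ :=
  ∑ d ∈ ζ.toFinset, ((if d ∈ γ.darts then 1 else 0) - if d.symm ∈ γ.darts then 1 else 0)

variable [Finite G.Dart] {f : M.Face}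

theorem leavesLeft_or_leavesRight (hγ : γ.IsPath) (huv : u ≠ v) (ha₁ : a₁.fst = u)
    (ha₂ : a₂.fst = v) (hG : G.Connected) :
    M.LeavesLeft a₁ a₂ f γ ∨ M.LeavesRight a₁ a₂ f γ := by
  induction f using Quotient.inductionOn with | _ g
  obtain ⟨d, hd, h | h⟩ := exists_sameSide (M := M) hγ huv ha₁ ha₂ hG g
  · exact Or.inl ⟨d, hd, g, rfl, h.symm⟩
  · exact Or.inr ⟨d, hd, g, rfl, h.symm⟩

/-- Let `s` be the indicator of the left component. It drops from 1 to 0 across the path from left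
to right and agrees on the two sides of any other edge. Along the zipper the signed count telescopes
to `s` at `f` minus `s` at the end, and the end is on the arc that starts at `a₁`, hence on the
left. -/
theorem crossing_eq [DecidableEq G.Dart] (hγ : γ.IsPath) (huv : u ≠ v) (ha₁ : a₁.fst = u)
    (ha₂ : a₂.fst = v) (ha : M.face a₁ = M.face a₂) (hf : f ≠ M.face a₁)
    (hζ : M.IsZipper a₁ a₂ f ζ)
    (hx : Xor (M.LeavesLeft a₁ a₂ f γ) (M.LeavesRight a₁ a₂ f γ)) :
    (M.LeavesLeft a₁ a₂ f γ → crossing ζ γ = 0) ∧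
      (M.LeavesRight a₁ a₂ f γ → crossing ζ γ = -1) := by
  classical
  obtain ⟨d₁, hd₁, hd₁a⟩ := exists_sameSide_start (M := M) hγ huv ha₁ ha₂
  have hd₁u : ∀ d ∈ γ.darts, M.SameSide a₁ a₂ γ d₁ d ∧ M.SameSide a₁ a₂ γ d₁.symm d.symm :=
    fun d hd => sameSide_of_mem_darts hγ ha₁ ha₂ hd₁ hd
  have hface : ∀ d e, M.face d = f → M.face e = f → M.SameSide a₁ a₂ γ d e := fun d e hd he =>
    sameSide_of_face_eq (hd.trans he.symm) (hd ▸ hf) (hd ▸ ha ▸ hf)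
  -- If the two sides of the path communicated, `f` would be on both of them; this is where
  -- exclusivity enters.
  have hLR : ¬ M.SameSide a₁ a₂ γ d₁ d₁.symm := by
    intro h
    rcases hx with ⟨⟨d, hd, e, he, hde⟩, hR⟩ | ⟨⟨d, hd, e, he, hde⟩, hL⟩
    · exact hR ⟨d₁, hd₁, e, he, h.symm.trans ((hd₁u d hd).1.trans hde)⟩
    · exact hL ⟨d₁, hd₁, e, he, h.trans ((hd₁u d hd).2.trans hde)⟩
  set s : G.Dart → ℤ := fun d => if M.SameSide a₁ a₂ γ d₁ d then 1 else 0 with hs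
  have hs_eq : ∀ d e, M.SameSide a₁ a₂ γ d e → s d = s e := fun d e h =>
    if_congr ⟨fun h' => h'.trans h, fun h' => h'.trans h.symm⟩ rfl rfl
  have hs1 : ∀ d ∈ γ.darts, s d = 1 ∧ s d.symm = 0 := fun d hd =>
    ⟨if_pos (hd₁u d hd).1, if_neg fun h => hLR (h.trans (hd₁u d hd).2.symm)⟩
  have hs2 : ∀ d, s d - s d.symm =
      (if d ∈ γ.darts then 1 else 0) - if d.symm ∈ γ.darts then 1 else 0 := by
    intro d
    by_cases h1 : d ∈ γ.darts
    · rw [(hs1 d h1).1, (hs1 d h1).2, if_pos h1, if_neg (symm_notMem_darts hγ h1)]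
    · by_cases h2 : d.symm ∈ γ.darts
      · have := hs1 _ h2
        rw [SimpleGraph.Dart.symm_symm] at this
        rw [this.1, this.2, if_neg h1, if_pos h2]
      · rw [if_neg h1, if_neg h2, hs_eq d d.symm (sameSide_symm fun h =>
          (edge_mem_edges_iff.1 h).elim h1 h2)]
        ring
  obtain ⟨h₀, hh₀, hh₀f⟩ := hζ.head
  obtain ⟨t, ht, hta⟩ := hζ.last
  have hchain : ζ.IsChain fun d e => s d.symm = s e :=
    List.IsChain.imp_of_mem_imp (fun d e _ he h => hs_eq _ _ (sameSide_of_face_eq h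
      (h ▸ hζ.face_ne he) (h ▸ ha ▸ hζ.face_ne he))) hζ.chain
  have hsum : crossing ζ γ = s h₀ - 1 := by
    have h1 : s t.symm = 1 := if_pos (hd₁a.symm.trans hta.sameSide)
    rw [← h1, ← sum_telescope s hchain hh₀ ht, crossing, List.sum_toFinset _ hζ.list_nodup]
    congr 1
    exact List.map_congr_left fun d _ => (hs2 d).symm
  constructor
  · rintro ⟨d, hd, e, he, hde⟩
    rw [hsum, ← hs_eq _ _ (hde.trans (hface e h₀ he hh₀f)), (hs1 d hd).1, sub_self]
  · rintro ⟨d, hd, e, he, hde⟩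
    rw [hsum, ← hs_eq _ _ (hde.trans (hface e h₀ he hh₀f)), (hs1 d hd).2, zero_sub]

end RotationSystem


/-! ### Homology of the surface and the Jordan property in genus zero. -/

section Homology

variable {V : Type*} [Fintype V] [DecidableEq V] {G : SimpleGraph V} [DecidableRel G.Adj]

/-- The one-chains: antisymmetric functions of the darts. -/
def oneChains (G : SimpleGraph V) : Submodule ℚ (G.Dart → ℚ) where
  carrier := {x | ∀ d, x d.symm = -x d}
  add_mem' hx hy d := by simp only [Pi.add_apply, hx d, hy d]; ring
  zero_mem' d := by simp
  smul_mem' a x hx d := by simp only [Pi.smul_apply, hx d, smul_eq_mul]; ring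

/-- The boundary of a function of the darts. -/
def boundary (G : SimpleGraph V) [DecidableRel G.Adj] : (G.Dart → ℚ) →ₗ[ℚ] (V → ℚ) where
  toFun x v := ∑ d : G.Dart, if d.fst = v then x d else 0
  map_add' x y := by
    ext v
    simp only [Pi.add_apply, ← Finset.sum_add_distrib]
    exact Finset.sum_congr rfl fun d _ => by split_ifs <;> simp
  map_smul' a x := by
    ext v
    simp only [Pi.smul_apply, smul_eq_mul, RingHom.id_apply, Finset.mul_sum]
    exact Finset.sum_congr rfl fun d _ => by split_ifs <;> simp

/-- The one-chain of a dart. -/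
def dartChain (d : G.Dart) : G.Dart → ℚ :=
  fun e => (if e = d then 1 else 0) - if e.symm = d then 1 else 0

omit [Fintype V] [DecidableRel G.Adj] in
theorem dartChain_mem (d : G.Dart) : dartChain d ∈ oneChains G := by
  intro e
  simp [dartChain]

theorem boundary_dartChain (d : G.Dart) :
    boundary G (dartChain d) = Pi.single d.fst 1 - Pi.single d.snd 1 := by
  ext v
  have h : ∀ e : G.Dart, (if e.fst = v then dartChain d e else 0) =
      (if e = d then (if d.fst = v then 1 else 0) else 0) -
        if e = d.symm then (if d.snd = v then 1 else 0) else 0 := by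
    intro e
    have h1 : e.symm = d ↔ e = d.symm :=
      ⟨fun h => by rw [← h, SimpleGraph.Dart.symm_symm],
        fun h => by rw [h, SimpleGraph.Dart.symm_symm]⟩
    simp only [dartChain, h1]
    by_cases h2 : e = d
    · subst h2
      simp [e.symm_ne.symm]
    · by_cases h3 : e = d.symm
      · subst h3
        simp only [h2, if_false, if_true, SimpleGraph.Dart.symm_toProd, Prod.fst_swap]
        split_ifs <;> simp
      · simp [h2, h3]
  simp only [boundary, LinearMap.coe_mk, AddHom.coe_mk, h, Finset.sum_sub_distrib,
    Finset.sum_ite_eq', Finset.mem_univ, if_true, Pi.sub_apply, Pi.single_apply, eq_comm (a := v)]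

omit [DecidableEq V] in
theorem finrank_oneChains_le : Module.finrank ℚ (oneChains G) ≤ Nat.card G.edgeSet := by
  choose o ho using fun e : G.edgeSet => (show ∃ d : G.Dart, d.edge = e.1 by
    obtain ⟨e, he⟩ := e
    induction e using Sym2.ind with | _ x y
    exact ⟨⟨(x, y), he⟩, rfl⟩)
  let φ : oneChains G →ₗ[ℚ] (G.edgeSet → ℚ) :=
    { toFun := fun x e => x.1 (o e)
      map_add' := fun x y => rfl
      map_smul' := fun a x => rfl }
  have hφ : Function.Injective φ := by
    rw [← LinearMap.ker_eq_bot, LinearMap.ker_eq_bot']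
    rintro ⟨x, hx⟩ h
    ext d
    have h1 : x (o ⟨d.edge, d.edge_mem⟩) = 0 := congr_fun h ⟨d.edge, d.edge_mem⟩
    rcases (SimpleGraph.dart_edge_eq_iff _ _).1 (ho ⟨d.edge, d.edge_mem⟩) with h2 | h2
    · rw [h2] at h1; exact h1
    · rw [h2, hx d, neg_eq_zero] at h1; exact h1
  have := LinearMap.finrank_le_finrank_of_injective hφ
  rwa [Module.finrank_pi, ← Nat.card_eq_fintype_card] at this

/-- By connectedness all differences of vertex indicators are boundaries, and one further indicator
completes them to a spanning set. -/
theorem card_le_finrank_boundary (hG : G.Connected) :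
    Fintype.card V ≤ Module.finrank ℚ ((boundary G).domRestrict (oneChains G)).range + 1 := by
  obtain ⟨v₀⟩ := hG.nonempty
  set B := ((boundary G).domRestrict (oneChains G)).range with hB
  have h1 : ∀ {x y : V} (q : G.Walk x y), (Pi.single x 1 - Pi.single y 1 : V → ℚ) ∈ B := by
    intro x y q
    induction q with
    | nil => rw [sub_self]; exact B.zero_mem
    | @cons x y z h q ih =>
      have h2 : (Pi.single x 1 - Pi.single y 1 : V → ℚ) ∈ B :=
        ⟨⟨dartChain ⟨(x, y), h⟩, dartChain_mem _⟩, boundary_dartChain ⟨(x, y), h⟩⟩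
      have := B.add_mem h2 ih
      rwa [sub_add_sub_cancel] at this
  have h2 : B ⊔ Submodule.span ℚ {(Pi.single v₀ 1 : V → ℚ)} = ⊤ := by
    rw [eq_top_iff, ← (Pi.basisFun ℚ V).span_eq, Submodule.span_le]
    rintro _ ⟨x, rfl⟩
    obtain ⟨q⟩ := hG.preconnected x v₀
    rw [Pi.basisFun_apply, SetLike.mem_coe, 
      ← sub_add_cancel (Pi.single x 1 : V → ℚ) (Pi.single v₀ 1)]
    exact Submodule.add_mem_sup (h1 q) (Submodule.mem_span_singleton_self _)
  have h3 := Submodule.finrank_add_le_finrank_add_finrank B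
    (Submodule.span ℚ {(Pi.single v₀ 1 : V → ℚ)})
  rwa [h2, finrank_top, Module.finrank_pi, finrank_span_singleton (by simp)] at h3

namespace RotationSystem

variable (M : RotationSystem G)

/-- The boundary of a combination of faces. -/
def faceBoundary : (M.Face → ℚ) →ₗ[ℚ] oneChains G where
  toFun h := ⟨fun d => h (M.face d) - h (M.face d.symm), fun d => by simp⟩
  map_add' x y := by ext d; simp; ring
  map_smul' a x := by ext d; simp; ring

instance : Finite M.Face := Quotient.finite _

-- Only constants have zero boundary: such a function has equal values on both sides of every edge,
-- hence around every vertex, hence along every walk.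
omit [DecidableEq V] in
theorem card_face_le (hG : G.Connected) [Nonempty G.Dart] :
    Nat.card M.Face ≤ Module.finrank ℚ M.faceBoundary.range + 1 := by
  have := Fintype.ofFinite M.Face
  have h1 := LinearMap.finrank_range_add_finrank_ker M.faceBoundary
  rw [Module.finrank_pi, ← Nat.card_eq_fintype_card] at h1
  suffices h : Module.finrank ℚ M.faceBoundary.ker ≤ 1 by omega
  obtain ⟨d₀⟩ := ‹Nonempty G.Dart›
  let φ : M.faceBoundary.ker →ₗ[ℚ] ℚ := (LinearMap.proj (M.face d₀)).domRestrict _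
  have hφ : Function.Injective φ := by
    rw [← LinearMap.ker_eq_bot, LinearMap.ker_eq_bot']
    rintro ⟨h, hh⟩ h0
    have h0 : h (M.face d₀) = 0 := h0
    have hs : ∀ d, h (M.face d.symm) = h (M.face d) := fun d => by
      have := congr_fun (congr_arg Subtype.val (LinearMap.mem_ker.1 hh)) d
      exact (sub_eq_zero.1 this).symm
    have hr : ∀ (k : ℕ) d, h (M.face ((M.rot ^ k) d)) = h (M.face d) := by
      intro k
      induction k with
      | zero => exact fun d => rfl
      | succ k ih =>
        intro d
        rw [pow_succ', Equiv.Perm.mul_apply, ← hs, ← face_facePerm, facePerm_symm_rot, ih]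
    have hfst : ∀ d e : G.Dart, d.fst = e.fst → h (M.face d) = h (M.face e) := by
      intro d e hde
      obtain ⟨k, rfl⟩ := (M.sameCycle d e hde).exists_nat_pow_eq
      exact (hr k d).symm
    have hall : ∀ {x y : V} (q : G.Walk x y) (d e : G.Dart), d.fst = x → e.fst = y →
        h (M.face d) = h (M.face e) := by
      intro x y q
      induction q with
      | nil => exact fun d e hd he => hfst d e (hd.trans he.symm)
      | @cons x y z hxy q ih =>
        intro d e hd he
        rw [hfst d ⟨(x, y), hxy⟩ hd, ← hs, ih _ e rfl he]
    ext F
    induction F using Quotient.inductionOn with | _ d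
    obtain ⟨q⟩ := hG.preconnected d.fst d₀.fst
    exact (hall q d d₀ rfl rfl).trans h0
  simpa using LinearMap.finrank_le_finrank_of_injective hφ

/-- The face to the right of a dart is the face to the left of the preceding dart at the same tail,
so the sum around a vertex cancels after one rotation. -/
theorem boundary_faceBoundary (h : M.Face → ℚ) : boundary G (M.faceBoundary h).1 = 0 := by
  ext v
  simp only [boundary, LinearMap.coe_mk, AddHom.coe_mk, faceBoundary, Pi.zero_apply]
  have h1 : ∀ d : G.Dart, (if d.fst = v then h (M.face d) - h (M.face d.symm) else 0) =
      (if d.fst = v then h (M.face d) else 0) -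
        if (M.rot⁻¹ d).fst = v then h (M.face (M.rot⁻¹ d)) else 0 := by
    intro d
    have : (M.rot⁻¹ d).fst = d.fst := by
      have := M.fst_rot (M.rot⁻¹ d)
      rw [Equiv.Perm.inv_def, Equiv.apply_symm_apply] at this
      exact this.symm
    rw [this, face_symm]
    split_ifs <;> simp
  rw [Finset.sum_congr rfl fun d _ => h1 d, Finset.sum_sub_distrib,
    Equiv.sum_comp (M.rot⁻¹) fun d => if d.fst = v then h (M.face d) else 0, sub_self]

/-- On a sphere, cycles are boundaries. -/
theorem IsPlanar.exists_faceBoundary_eq (hM : M.IsPlanar) (hG : G.Connected) [Nonempty G.Dart]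
    {x : G.Dart → ℚ} (hx : x ∈ oneChains G) (hx0 : boundary G x = 0) :
    ∃ h : M.Face → ℚ, ∀ d, h (M.face d) - h (M.face d.symm) = x d := by
  have h1 := card_le_finrank_boundary hG
  have h2 := M.card_face_le hG
  have h3 := LinearMap.finrank_range_add_finrank_ker ((boundary G).domRestrict (oneChains G))
  have h4 := finrank_oneChains_le (G := G)
  have h5 : M.faceBoundary.range ≤ ((boundary G).domRestrict (oneChains G)).ker := by
    rintro _ ⟨h, rfl⟩
    exact M.boundary_faceBoundary h
  have hM' : Nat.card V + Nat.card M.Face = Nat.card G.edgeSet + 2 := hM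
  rw [Nat.card_eq_fintype_card (α := V)] at hM'
  -- Euler's formula closes the count: cycles have dimension at most |E| - |V| + 1 = |F| - 1, which
  -- the boundaries of faces already reach.
  have h6 := Submodule.eq_of_le_of_finrank_le h5 (by omega)
  have h7 : (⟨x, hx⟩ : oneChains G) ∈ ((boundary G).domRestrict (oneChains G)).ker := hx0
  rw [← h6] at h7
  obtain ⟨h, hh⟩ := h7
  exact ⟨h, fun d => congr_fun (congr_arg Subtype.val hh) d⟩

theorem boundary_walk {u v : V} (γ : G.Walk u v) :
    boundary G (γ.darts.map dartChain).sum = Pi.single u 1 - Pi.single v 1 := by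
  induction γ with
  | nil => simp
  | cons h p ih =>
    rw [SimpleGraph.Walk.darts_cons, List.map_cons, List.sum_cons, map_add, ih,
      boundary_dartChain, sub_add_sub_cancel]

theorem boundary_facePerm (a : G.Dart) (m : ℕ) :
    boundary G (∑ k ∈ Finset.range m, dartChain ((M.facePerm ^ k) a)) =
      Pi.single a.fst 1 - Pi.single ((M.facePerm ^ m) a).fst 1 := by
  induction m with
  | zero => simp
  | succ m ih =>
    rw [Finset.sum_range_succ, map_add, ih, boundary_dartChain, pow_succ', Equiv.Perm.mul_apply,
      fst_facePerm, sub_add_sub_cancel]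

variable {M} {a₁ a₂ : G.Dart} {u v : V} {γ : G.Walk u v}

omit [Fintype V] [DecidableRel G.Adj] in
theorem walk_chain_apply (hγ : γ.IsPath) {d : G.Dart} (hd : d ∈ γ.darts) :
    (γ.darts.map dartChain).sum d = 1 := by
  have h : ∀ l : List G.Dart, (l.map dartChain).sum d =
      (l.count d : ℚ) - (l.count d.symm : ℚ) := by
    intro l
    induction l with
    | nil => simp
    | cons a l ih =>
      rw [List.map_cons, List.sum_cons, Pi.add_apply, ih, dartChain, List.count_cons,
        List.count_cons]
      simp only [beq_iff_eq, eq_comm (a := a)]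
      push_cast
      ring
  have hnd : γ.darts.Nodup := List.Nodup.of_map _ hγ.isTrail.edges_nodup
  rw [h, List.count_eq_one_of_mem hnd hd, List.count_eq_zero_of_not_mem (symm_notMem_darts hγ hd)]
  simp

omit [Fintype V] [DecidableRel G.Adj] in
theorem walk_chain_apply_of_notMem {d : G.Dart} (hd : d.edge ∉ γ.edges) :
    (γ.darts.map dartChain).sum d = 0 := by
  have h : ∀ l : List G.Dart, d ∉ l → d.symm ∉ l → (l.map dartChain).sum d = 0 := by
    intro l
    induction l with
    | nil => simp
    | cons a l ih =>
      intro h1 h2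
      rw [List.mem_cons, not_or] at h1 h2
      rw [List.map_cons, List.sum_cons, Pi.add_apply, ih h1.2 h2.2, dartChain, if_neg h1.1,
        if_neg h2.1]
      simp
  rw [edge_mem_edges_iff, not_or] at hd
  exact h _ hd.1 hd.2

/-- On a sphere, the two sides of the path are in different components. -/
theorem IsPlanar.not_sameSide (hM : M.IsPlanar) (hG : G.Connected) (hγ : γ.IsPath)
    (ha₁ : a₁.fst = u) (ha₂ : a₂.fst = v) (ha : M.face a₁ = M.face a₂) {d e : G.Dart}
    (hd : d ∈ γ.darts) (he : e ∈ γ.darts) : ¬ M.SameSide a₁ a₂ γ d e.symm := by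
  obtain ⟨m, hm⟩ := exists_facePerm_pow_eq ha
  have : Nonempty G.Dart := ⟨d⟩
  set y : G.Dart → ℚ := ∑ k ∈ Finset.range m, dartChain ((M.facePerm ^ k) a₁) with hy
  set x : G.Dart → ℚ := (γ.darts.map dartChain).sum with hx
  have hy_mem : y ∈ oneChains G := Submodule.sum_mem _ fun k _ => dartChain_mem _
  have hx_mem : x ∈ oneChains G := by
    refine list_sum_mem fun z hz => ?_
    obtain ⟨d, -, rfl⟩ := List.mem_map.1 hz
    exact dartChain_mem d
  have hxy : boundary G (x - y) = 0 := by
    rw [map_sub, hx, hy, boundary_walk, M.boundary_facePerm, hm, ha₁, ha₂, sub_self]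
  obtain ⟨h, hh⟩ := hM.exists_faceBoundary_eq M hG (Submodule.sub_mem _ hx_mem hy_mem) hxy
  -- `x - y` is the closed curve with its outer part pushed onto the boundary walk from `a₁` to
  -- `a₂`. The function `h` that it bounds also jumps along that walk; adding the multiplicity `A`
  -- of the walk removes these jumps, and `s` jumps across `γ` only.
  set A : G.Dart → ℚ := fun d => ∑ k ∈ Finset.range m, if (M.facePerm ^ k) a₁ = d then 1 else 0
    with hA
  have hyA : ∀ d, y d = A d - A d.symm := by
    intro d
    simp only [hy, hA, Finset.sum_apply, dartChain, Finset.sum_sub_distrib, eq_comm (a := d),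
      eq_comm (a := d.symm)]
  set s : G.Dart → ℚ := fun d => h (M.face d) + A d with hs
  have hsx : ∀ d, s d - s d.symm = x d := by
    intro d
    have h1 := hh d
    rw [Pi.sub_apply, hyA] at h1
    simp only [hs]
    linarith
  have hstep : ∀ d e, M.Step a₁ a₂ γ d e → s d = s e := by
    rintro d e (⟨rfl, h1, h2⟩ | ⟨rfl, h1⟩)
    · simp only [hs, face_facePerm]
      congr 1
      -- Shifting the index along the boundary walk changes the count only through its ends `a₁` and
      -- `a₂`, which the step avoids.
      have h3 := Finset.sum_range_succ
        (fun k => if (M.facePerm ^ k) a₁ = M.facePerm d then (1 : ℚ) else 0) m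
      rw [Finset.sum_range_succ', hm, if_neg (Ne.symm h2), pow_zero, Equiv.Perm.one_apply,
        if_neg (Ne.symm h1), add_zero, add_zero] at h3
      simp only [pow_succ', Equiv.Perm.mul_apply, EmbeddingLike.apply_eq_iff_eq] at h3
      exact h3
    · have h2 := hsx d
      rw [hx, walk_chain_apply_of_notMem h1] at h2
      linarith
  have hside : ∀ d e, M.SameSide a₁ a₂ γ d e → s d = s e := by
    intro d e h
    induction h with
    | rel _ _ h => exact hstep _ _ h
    | refl _ => rfl
    | symm _ _ _ ih => exact ih.symm
    | trans _ _ _ _ _ ih ih' => exact ih.trans ih'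
  intro hde
  have h1 := hside _ _ hde
  have h2 := hside _ _ (sameSide_of_mem_darts (M := M) hγ ha₁ ha₂ hd he).1
  have h3 := hsx e
  rw [hx, walk_chain_apply hγ he] at h3
  linarith

theorem IsPlanar.xor (hM : M.IsPlanar) (hG : G.Connected) (hγ : γ.IsPath) (huv : u ≠ v)
    (ha₁ : a₁.fst = u) (ha₂ : a₂.fst = v) (ha : M.face a₁ = M.face a₂) {f : M.Face}
    (hf : f ≠ M.face a₁) :
    Xor (M.LeavesLeft a₁ a₂ f γ) (M.LeavesRight a₁ a₂ f γ) := by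
  refine (xor_iff_or_and_not_and _ _).2 ⟨leavesLeft_or_leavesRight hγ huv ha₁ ha₂ hG, ?_⟩
  rintro ⟨⟨d, hd, g, hg, hdg⟩, e, he, g', hg', heg⟩
  have h := sameSide_of_face_eq (M := M) (a₁ := a₁) (a₂ := a₂) (γ := γ) (hg.trans hg'.symm)
    (hg ▸ hf) (hg ▸ ha ▸ hf)
  exact hM.not_sameSide hG hγ ha₁ ha₂ ha hd he (hdg.trans (h.trans heg.symm))

end RotationSystem

end Homology


/-! ### The Dirichlet form and positivity of principal minors. -/

section Positivity

variable {V : Type*} [Fintype V] [DecidableEq V] (G : SimpleGraph V) [DecidableRel G.Adj]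
  (c : Sym2 V → ℝ) (k : V → ℝ)

/-- The Laplacian with conductance `k u` between `u` and the root. -/
def rootLaplacian : Matrix V V ℝ := Matrix.of fun u v =>
  if u = v then (∑ w ∈ G.neighborFinset u, c s(u, w)) + k u
  else if G.Adj u v then -c s(u, v) else 0

/-- Arbitrary root conductances cover the set `D`, the free case `k = 0` and the walk with an
additional edge to the root. -/
theorem laplacian_eq_rootLaplacian (D : Finset V) :
    laplacian G c D = rootLaplacian G c fun u => if u ∈ D then 1 else 0 := rfl

theorem rootLaplacian_symm (u v : V) : rootLaplacian G c k u v = rootLaplacian G c k v u := by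
  by_cases h : u = v
  · rw [h]
  · simp [rootLaplacian, h, Ne.symm h, G.adj_comm v u, Sym2.eq_swap (a := v) (b := u)]

/-- The conductance matrix. -/
def condMatrix : Matrix V V ℝ := Matrix.of fun u v => if G.Adj u v then c s(u, v) else 0

omit [Fintype V] [DecidableEq V] in
theorem condMatrix_symm (u v : V) : condMatrix G c u v = condMatrix G c v u := by
  simp [condMatrix, G.adj_comm v u, Sym2.eq_swap (a := v) (b := u)]

omit [Fintype V] [DecidableEq V] in
variable {G c} in
theorem condMatrix_nonneg (hc : ∀ e ∈ G.edgeSet, 0 < c e) (u v : V) : 0 ≤ condMatrix G c u v := by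
  unfold condMatrix
  rw [Matrix.of_apply]
  split_ifs with h
  · exact (hc s(u, v) h).le
  · exact le_rfl

omit [DecidableEq V] in
theorem sum_neighborFinset_eq (u : V) :
    ∑ w ∈ G.neighborFinset u, c s(u, w) = ∑ w, condMatrix G c u w := by
  simp only [condMatrix, Matrix.of_apply]
  rw [← Finset.sum_filter]
  exact Finset.sum_congr (by ext; simp) fun _ _ => rfl

theorem rootLaplacian_apply (u v : V) : rootLaplacian G c k u v =
    (if u = v then (∑ w, condMatrix G c u w) + k u else 0) - condMatrix G c u v := by
  by_cases h : u = v
  · subst h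
    simp [rootLaplacian, sum_neighborFinset_eq, condMatrix]
  · by_cases h' : G.Adj u v <;> simp [rootLaplacian, condMatrix, h, h']

theorem rootLaplacian_mulVec (y : V → ℝ) (u : V) :
    (rootLaplacian G c k).mulVec y u = k u * y u + ∑ v, condMatrix G c u v * (y u - y v) := by
  simp only [Matrix.mulVec, dotProduct, rootLaplacian_apply, sub_mul, ite_mul, zero_mul,
    Finset.sum_sub_distrib, Finset.sum_ite_eq, Finset.mem_univ, if_true, mul_sub, ← Finset.sum_mul]
  ring

theorem dotProduct_rootLaplacian_mulVec (y : V → ℝ) :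
    y ⬝ᵥ (rootLaplacian G c k).mulVec y =
      ∑ u, k u * y u ^ 2 + (1 / 2) * ∑ u, ∑ v, condMatrix G c u v * (y u - y v) ^ 2 := by
  have h1 : y ⬝ᵥ (rootLaplacian G c k).mulVec y =
      ∑ u, k u * y u ^ 2 + ∑ u, ∑ v, condMatrix G c u v * (y u * (y u - y v)) := by
    simp only [dotProduct, rootLaplacian_mulVec, mul_add, Finset.sum_add_distrib, Finset.mul_sum]
    congr 1
    · exact Finset.sum_congr rfl fun u _ => by ring
    · exact Finset.sum_congr rfl fun u _ => Finset.sum_congr rfl fun v _ => by ring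
  have h2 : ∑ u, ∑ v, condMatrix G c u v * (y u * (y u - y v)) =
      ∑ u, ∑ v, condMatrix G c u v * (y v * (y v - y u)) := by
    rw [Finset.sum_comm]
    exact Finset.sum_congr rfl fun u _ => Finset.sum_congr rfl fun v _ => by
      rw [condMatrix_symm]
  have h3 : ∑ u, ∑ v, condMatrix G c u v * (y u - y v) ^ 2 =
      ∑ u, ∑ v, condMatrix G c u v * (y u * (y u - y v)) +
        ∑ u, ∑ v, condMatrix G c u v * (y v * (y v - y u)) := by
    simp only [← Finset.sum_add_distrib]
    exact Finset.sum_congr rfl fun u _ => Finset.sum_congr rfl fun v _ => by ring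
  rw [h1, h3, ← h2]
  ring

variable {G c k}

theorem dotProduct_rootLaplacian_nonneg (hc : ∀ e ∈ G.edgeSet, 0 < c e) (hk : ∀ u, 0 ≤ k u)
    (y : V → ℝ) : 0 ≤ y ⬝ᵥ (rootLaplacian G c k).mulVec y := by
  rw [dotProduct_rootLaplacian_mulVec]
  exact add_nonneg (Finset.sum_nonneg fun u _ => mul_nonneg (hk u) (sq_nonneg _))
    (mul_nonneg (by norm_num) (Finset.sum_nonneg fun u _ => Finset.sum_nonneg fun v _ =>
      mul_nonneg (condMatrix_nonneg hc u v) (sq_nonneg _)))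

theorem eq_of_dotProduct_rootLaplacian_eq_zero (hG : G.Connected) (hc : ∀ e ∈ G.edgeSet, 0 < c e)
    (hk : ∀ u, 0 ≤ k u) {y : V → ℝ} (hy : y ⬝ᵥ (rootLaplacian G c k).mulVec y = 0) :
    (∀ u v, y u = y v) ∧ ∀ u, k u * y u ^ 2 = 0 := by
  rw [dotProduct_rootLaplacian_mulVec] at hy
  have h1 : ∀ u, 0 ≤ k u * y u ^ 2 := fun u => mul_nonneg (hk u) (sq_nonneg _)
  have h2 : ∀ u v, 0 ≤ condMatrix G c u v * (y u - y v) ^ 2 := fun u v =>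
    mul_nonneg (condMatrix_nonneg hc u v) (sq_nonneg _)
  have h3 := Finset.sum_nonneg fun u (_ : u ∈ Finset.univ) => h1 u
  have h4 := Finset.sum_nonneg fun u (_ : u ∈ Finset.univ) =>
    Finset.sum_nonneg fun v (_ : v ∈ Finset.univ) => h2 u v
  have h5 : ∑ u, k u * y u ^ 2 = 0 := by linarith
  have h6 : ∑ u, ∑ v, condMatrix G c u v * (y u - y v) ^ 2 = 0 := by linarith
  rw [Finset.sum_eq_zero_iff_of_nonneg fun u _ => h1 u] at h5
  rw [Finset.sum_eq_zero_iff_of_nonneg fun u _ => Finset.sum_nonneg fun v _ => h2 u v] at h6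
  refine ⟨fun u v => ?_, fun u => h5 u (Finset.mem_univ u)⟩
  obtain ⟨q⟩ := hG.preconnected u v
  induction q with
  | nil => rfl
  | @cons u x v h q ih =>
    rw [← ih]
    have h7 := h6 u (Finset.mem_univ u)
    rw [Finset.sum_eq_zero_iff_of_nonneg fun v _ => h2 u v] at h7
    have h8 := h7 x (Finset.mem_univ x)
    rw [condMatrix, Matrix.of_apply, if_pos h, mul_eq_zero] at h8
    exact sub_eq_zero.1 (pow_eq_zero_iff (two_ne_zero) |>.1 (h8.resolve_left (hc s(u, x) h).ne'))

/-- The principal minors of the Laplacian are positive. -/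
theorem det_killRows_rootLaplacian_pos (hG : G.Connected) (hc : ∀ e ∈ G.edgeSet, 0 < c e)
    (hk : ∀ u, 0 ≤ k u) (S : Finset V) (hS : S.Nonempty ∨ ∃ u, 0 < k u) :
    0 < (killRows (rootLaplacian G c k) S).det := by
  rw [det_killRows]
  refine Matrix.PosDef.det_pos (Matrix.posDef_iff_dotProduct_mulVec.2 ⟨?_, fun x hx => ?_⟩)
  · ext ⟨i, hi⟩ ⟨j, hj⟩
    simp [Matrix.toSquareBlockProp, rootLaplacian_symm G c k i j]
  set y : V → ℝ := fun u => if h : u ∉ S then x ⟨u, h⟩ else 0 with hy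
  have hsum : ∀ g : V → ℝ, ∑ v, y v * g v = ∑ v : {v // v ∉ S}, x v * g v := by
    intro g
    rw [← Finset.sum_subtype (Finset.univ.filter (· ∉ S)) (by simp) (fun v => y v * g v) |>.trans
      (Finset.sum_congr rfl fun v _ => by simp [hy, v.2]), Finset.sum_filter]
    exact Finset.sum_congr rfl fun v _ => by by_cases h : v ∈ S <;> simp [hy, h]
  have heq : star x ⬝ᵥ ((rootLaplacian G c k).toSquareBlockProp
      fun x => x ∉ S).mulVec x = y ⬝ᵥ (rootLaplacian G c k).mulVec y := by
    simp only [dotProduct, Matrix.mulVec]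
    rw [hsum]
    refine Finset.sum_congr rfl fun u _ => ?_
    simp only [star_trivial]
    congr 1
    simp_rw [mul_comm _ (y _)]
    rw [hsum]
    refine Finset.sum_congr rfl fun v _ => ?_
    simp [Matrix.toSquareBlockProp, mul_comm]
  rw [heq]
  refine lt_of_le_of_ne (dotProduct_rootLaplacian_nonneg hc hk y) fun h => hx ?_
  obtain ⟨h2, h3⟩ := eq_of_dotProduct_rootLaplacian_eq_zero hG hc hk h.symm
  -- The extension of `x` by zero has zero energy and is therefore constant; a killed vertex, or one
  -- joined to the root, makes the constant zero.
  have h4 : ∃ u, y u = 0 := by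
    rcases hS with ⟨u, hu⟩ | ⟨u, hu⟩
    · exact ⟨u, by simp [hy, hu]⟩
    · exact ⟨u, by simpa [hu.ne'] using h3 u⟩
  obtain ⟨u, hu⟩ := h4
  ext ⟨v, hv⟩
  have := (h2 v u).trans hu
  simpa [hy, hv] using this

theorem det_rootLaplacian_pos (hG : G.Connected) (hc : ∀ e ∈ G.edgeSet, 0 < c e)
    (hk : ∀ u, 0 ≤ k u) (hS : ∃ u, 0 < k u) : 0 < (rootLaplacian G c k).det := by
  rw [← killRows_empty (rootLaplacian G c k)]
  exact det_killRows_rootLaplacian_pos hG hc hk ∅ (Or.inr hS)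

theorem det_killRows_laplacian_pos (hG : G.Connected) (hc : ∀ e ∈ G.edgeSet, 0 < c e)
    (D : Finset V) {S : Finset V} (hS : S.Nonempty) : 0 < (killRows (laplacian G c D) S).det := by
  rw [laplacian_eq_rootLaplacian]
  exact det_killRows_rootLaplacian_pos hG hc (fun u => by split_ifs <;> norm_num) S (Or.inl hS)

omit [Fintype V] [DecidableEq V] [DecidableRel G.Adj] in
theorem walkProd_cond_pos (hc : ∀ e ∈ G.edgeSet, 0 < c e) {u v : V} (γ : G.Walk u v) :
    0 < walkProd (fun x y => c s(x, y)) γ := by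
  induction γ with
  | nil => simp
  | cons h p ih => rw [walkProd_cons]; exact mul_pos (hc s(_, _) h) ih

theorem pathWeight_pos (hG : G.Connected) (hc : ∀ e ∈ G.edgeSet, 0 < c e) (D : Finset V) {u v : V}
    (γ : G.Path u v) : 0 < pathWeight G c D γ := by
  rw [pathWeight_eq]
  exact mul_pos (walkProd_cond_pos hc γ.1)
    (det_killRows_laplacian_pos hG hc D ⟨u, by simp⟩)

theorem sum_pathWeight_pos (hG : G.Connected) (hc : ∀ e ∈ G.edgeSet, 0 < c e) (D : Finset V)
    (u v : V) : 0 < ∑ γ : G.Path u v, pathWeight G c D γ := by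
  obtain ⟨q⟩ := hG.preconnected u v
  exact Finset.sum_pos (fun γ _ => pathWeight_pos hG hc D γ) ⟨q.toPath, Finset.mem_univ _⟩

/-- Stated for the cofactor and not for the inverse, so that it holds also without a root. -/
theorem adjugate_laplacian (D : Finset V) (u v : V) :
    (laplacian G c D).adjugate u v = ∑ γ : G.Path u v, pathWeight G c D γ := by
  rw [adjugate_eq_sum_path G _ fun x y hxy h => by simp [laplacian, hxy, h]]
  refine Finset.sum_congr rfl fun γ _ => ?_
  rw [pathWeight_eq]
  congr 1
  exact walkProd_congr G (fun x y h => by simp [laplacian, h.ne, h]) γ.1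

end Positivity


/-! ### Weights of walks with a prescribed loop erasure. -/

section LoopErasure

variable {V : Type*} [Fintype V] [DecidableEq V] {G : SimpleGraph V} [DecidableRel G.Adj]

theorem sum_finsetWalkLengthLT_succ {M : Type*} [AddCommMonoid M] (n : ℕ) (u v : V)
    (F : G.Walk u v → M) :
    ∑ ω ∈ G.finsetWalkLengthLT (n + 1) u v, F ω = ∑ ω ∈ G.finsetWalkLengthLT 1 u v, F ω +
      ∑ x : {x // G.Adj u x}, ∑ ω ∈ G.finsetWalkLengthLT n x.1 v,
        F (SimpleGraph.Walk.cons x.2 ω) := by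
  rw [← Finset.sum_filter_add_sum_filter_not _ fun ω : G.Walk u v => ω.length = 0]
  congr 1
  · refine Finset.sum_congr ?_ fun _ _ => rfl
    ext ω
    simp only [Finset.mem_filter, SimpleGraph.mem_finsetWalkLengthLT_iff]
    omega
  · rw [Finset.sum_sigma']
    symm
    refine Finset.sum_bij (fun s _ => SimpleGraph.Walk.cons s.1.2 s.2) ?_ ?_ ?_ fun _ _ => rfl
    · rintro ⟨⟨x, hx⟩, ω⟩ h
      simp only [Finset.mem_sigma, Finset.mem_univ, SimpleGraph.mem_finsetWalkLengthLT_iff,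
        true_and] at h
      simp only [Finset.mem_filter, SimpleGraph.mem_finsetWalkLengthLT_iff,
        SimpleGraph.Walk.length_cons]
      omega
    · rintro ⟨⟨x, hx⟩, ω⟩ - ⟨⟨y, hy⟩, ω'⟩ - h
      simp only [SimpleGraph.Walk.cons.injEq] at h
      obtain ⟨rfl, h⟩ := h
      obtain rfl := eq_of_heq h
      rfl
    · intro ω h
      simp only [Finset.mem_filter, SimpleGraph.mem_finsetWalkLengthLT_iff] at h
      cases ω with
      | nil => simp at h
      | cons hx p =>
        refine ⟨⟨⟨_, hx⟩, p⟩, ?_, rfl⟩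
        simp only [Finset.mem_sigma, Finset.mem_univ, SimpleGraph.mem_finsetWalkLengthLT_iff,
          true_and]
        have := h.1
        rw [SimpleGraph.Walk.length_cons] at this
        omega

theorem sum_finsetWalkLengthLT_one (w : V → V → ℝ) (u v : V) :
    ∑ ω ∈ G.finsetWalkLengthLT 1 u v, walkProd w ω = if u = v then 1 else 0 := by
  split_ifs with h
  · subst h
    rw [Finset.sum_eq_single SimpleGraph.Walk.nil]
    · simp
    · intro ω hω hne
      rw [SimpleGraph.mem_finsetWalkLengthLT_iff] at hω
      exact absurd (SimpleGraph.Walk.eq_nil_iff_nil.2 (SimpleGraph.Walk.length_eq_zero_iff.1 (by omega))) hne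
    · intro h
      exact absurd (SimpleGraph.mem_finsetWalkLengthLT_iff.2 (by simp)) h
  · refine Finset.sum_eq_zero fun ω hω => ?_
    rw [SimpleGraph.mem_finsetWalkLengthLT_iff] at hω
    exact absurd (SimpleGraph.Walk.eq_of_length_eq_zero (p := ω) (by omega)) h

theorem tendsto_finsetWalkLengthLT (u v : V) :
    Tendsto (fun n => G.finsetWalkLengthLT n u v) atTop atTop := by
  refine tendsto_atTop_finset_of_monotone (fun m n h ω hω => ?_) fun ω => ⟨ω.length + 1, ?_⟩
  · rw [SimpleGraph.mem_finsetWalkLengthLT_iff] at hω ⊢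
    exact hω.trans_le h
  · rw [SimpleGraph.mem_finsetWalkLengthLT_iff]
    exact Nat.lt_succ_self _

omit [Fintype V] [DecidableRel G.Adj] in
theorem bypass_cons_of_mem {u x v : V} (h : G.Adj u x) {p : G.Walk x v} (hp : p.IsPath)
    (hu : u ∈ p.support) : (SimpleGraph.Walk.cons h p).bypass = p.dropUntil u hu := by
  simp only [SimpleGraph.Walk.bypass]
  rw [dif_pos (by rwa [hp.bypass_eq_self])]
  congr 1
  exact hp.bypass_eq_self

omit [Fintype V] [DecidableRel G.Adj] in
theorem bypass_cons_of_notMem {u x v : V} (h : G.Adj u x) {p : G.Walk x v} (hp : p.IsPath)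
    (hu : u ∉ p.support) : (SimpleGraph.Walk.cons h p).bypass = SimpleGraph.Walk.cons h p :=
  (hp.cons hu).bypass_eq_self

omit [Fintype V] [DecidableRel G.Adj] in
theorem bypass_cons_bypass {u x v : V} (h : G.Adj u x) (p : G.Walk x v) :
    (SimpleGraph.Walk.cons h p.bypass).bypass = (SimpleGraph.Walk.cons h p).bypass := by
  simp only [SimpleGraph.Walk.bypass, p.bypass_isPath.bypass_eq_self]

/-- The total weight of the walks with a given loop erasure, as a determinant. -/
noncomputable def erasedWeight (w : V → V → ℝ) {u v : V} (γ : G.Walk u v) : ℝ :=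
  walkProd w γ * (killRows (1 - Matrix.of w) γ.support.toFinset).det

variable {w : V → V → ℝ}

omit [Fintype V] [DecidableEq V] [DecidableRel G.Adj] in
theorem walkProd_nonneg (hw : ∀ x y, 0 ≤ w x y) {u v : V} (γ : G.Walk u v) : 0 ≤ walkProd w γ := by
  induction γ with
  | nil => simp
  | cons h p ih => rw [walkProd_cons]; exact mul_nonneg (hw _ _) ih

omit [DecidableRel G.Adj] in
theorem erasedWeight_nonneg (hw : ∀ x y, 0 ≤ w x y)
    (hd : ∀ S, 0 ≤ (killRows (1 - Matrix.of w) S).det) {u v : V} (γ : G.Walk u v) :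
    0 ≤ erasedWeight w γ := mul_nonneg (walkProd_nonneg hw γ) (hd _)

omit [Fintype V] [DecidableRel G.Adj] in
theorem one_sub_of_apply (hG : ∀ x y, ¬ G.Adj x y → w x y = 0) (x y : V) (hxy : x ≠ y)
    (h : ¬ G.Adj x y) : (1 - Matrix.of w : Matrix V V ℝ) x y = 0 := by
  simp [hxy, hG x y h]

omit [Fintype V] [DecidableRel G.Adj] in
theorem walkProd_neg_one_sub {u v : V} (γ : G.Walk u v) :
    walkProd (fun x y => -(1 - Matrix.of w : Matrix V V ℝ) x y) γ = walkProd w γ :=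
  walkProd_congr G (fun x y h => by simp [h.ne]) γ

/-- The contribution of the walks that return to their starting point. -/
theorem sum_erasedWeight_of_mem_le (hw : ∀ x y, 0 ≤ w x y)
    (hG : ∀ x y, ¬ G.Adj x y → w x y = 0)
    (hd : ∀ S, 0 ≤ (killRows (1 - Matrix.of w) S).det) {u v : V} (γ : G.Path u v) (x : V) :
    ∑ δ : G.Path x v, (if ∃ hu : u ∈ δ.1.support, δ.1.dropUntil u hu = γ.1 then
      erasedWeight w δ.1 else 0) ≤ walkProd w γ.1 *
        (killRows (1 - Matrix.of w) (γ.1.support.toFinset.erase u)).adjugate x u := by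
  rw [adjugate_killRows G _ (one_sub_of_apply hG) _ x u (by simp), Finset.mul_sum,
    ← Finset.sum_filter]
  simp only [walkProd_neg_one_sub]
  have hdisj : ∀ (δ : G.Path x v) (hu : u ∈ δ.1.support), δ.1.dropUntil u hu = γ.1 →
      Disjoint (γ.1.support.toFinset.erase u) (δ.1.takeUntil u hu).support.toFinset := by
    intro δ hu hδ
    rw [Finset.disjoint_left]
    intro y hy hy'
    rw [Finset.mem_erase, List.mem_toFinset] at hy
    rw [List.mem_toFinset] at hy'
    have hp := δ.2
    rw [← δ.1.take_spec hu, SimpleGraph.Walk.isPath_def, SimpleGraph.Walk.support_append,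
      List.nodup_append, hδ] at hp
    have h1 := hy.2
    rw [← SimpleGraph.Walk.cons_tail_support, List.mem_cons] at h1
    exact hp.2.2 y hy' y (h1.resolve_left hy.1) rfl
  have hval : ∀ (δ : G.Path x v) (hu : u ∈ δ.1.support), δ.1.dropUntil u hu = γ.1 →
      erasedWeight w δ.1 = walkProd w γ.1 * (walkProd w (δ.1.takeUntil u hu) *
        (killRows (1 - Matrix.of w) (γ.1.support.toFinset.erase u ∪
          (δ.1.takeUntil u hu).support.toFinset)).det) := by
    intro δ hu hδ
    have h1 : walkProd w δ.1 = walkProd w (δ.1.takeUntil u hu) * walkProd w γ.1 := by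
      rw [← hδ, ← walkProd_append, SimpleGraph.Walk.take_spec]
    have h2 : δ.1.support.toFinset = γ.1.support.toFinset.erase u ∪
        (δ.1.takeUntil u hu).support.toFinset := by
      ext y
      rw [← hδ]
      conv_lhs => rw [← δ.1.take_spec hu]
      simp only [List.mem_toFinset, SimpleGraph.Walk.mem_support_append_iff, Finset.mem_union,
        Finset.mem_erase]
      by_cases hy : y = u
      · subst hy; simp
      · simp [hy, or_comm]
    rw [erasedWeight, h1, h2]
    ring
  rw [Finset.sum_subtype (p := fun δ : G.Path x v => ∃ hu : u ∈ δ.1.support,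
    δ.1.dropUntil u hu = γ.1) _ (by simp) (fun δ => erasedWeight w δ.1)]
  -- `δ` is determined by its part before `u`, the rest being `γ`. Injectivity of this map is enough
  -- for the inequality; which paths to `u` arise does not matter.
  let e : {δ : G.Path x v // ∃ hu : u ∈ δ.1.support, δ.1.dropUntil u hu = γ.1} ↪ G.Path x u :=
    ⟨fun δ => ⟨δ.1.1.takeUntil u δ.2.choose, δ.1.2.takeUntil _⟩, fun δ δ' h => by
      have h1 : δ.1.1.takeUntil u δ.2.choose = δ'.1.1.takeUntil u δ'.2.choose :=
        congr_arg Subtype.val h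
      refine Subtype.ext (Subtype.ext ?_)
      rw [← δ.1.1.take_spec δ.2.choose, ← δ'.1.1.take_spec δ'.2.choose, h1, δ.2.choose_spec,
        δ'.2.choose_spec]⟩
  refine le_trans (le_of_eq ?_) (Finset.sum_le_univ_sum_of_nonneg (s := Finset.univ.map e)
    fun α => ?_)
  · rw [Finset.sum_map]
    refine Finset.sum_congr rfl fun δ _ => ?_
    rw [if_pos (show Disjoint _ (e δ).1.support.toFinset from
      hdisj δ.1 δ.2.choose δ.2.choose_spec)]
    exact hval δ.1 δ.2.choose δ.2.choose_spec
  · refine mul_nonneg (walkProd_nonneg hw _) ?_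
    split_ifs
    · exact mul_nonneg (walkProd_nonneg hw _) (hd _)
    · exact le_rfl

/-- This is the diagonal entry at `u` of the identity `A * A.adjugate = A.det • 1`. -/
theorem sum_mul_adjugate_killRows (S : Finset V) {u : V} (hu : u ∉ S) :
    ∑ x, w u x * (killRows (1 - Matrix.of w) S).adjugate x u =
      (killRows (1 - Matrix.of w) (insert u S)).det - (killRows (1 - Matrix.of w) S).det := by
  set A : Matrix V V ℝ := killRows (1 - Matrix.of w) S with hA
  have h1 : (A * A.adjugate) u u = A.det := by rw [Matrix.mul_adjugate]; simp
  have h2 : A.adjugate u u = (killRows (1 - Matrix.of w) (insert u S)).det := by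
    rw [adjugate_self_eq_det, hA, killRows_insert]
  have h3 : ∀ x, A u x = (if u = x then 1 else 0) - w u x := fun x => by
    simp [hA, killRows, hu, Matrix.one_apply]
  rw [← h1, ← h2, Matrix.mul_apply]
  simp only [h3, sub_mul, Finset.sum_sub_distrib, ite_mul, one_mul, zero_mul, Finset.sum_ite_eq,
    Finset.mem_univ, if_true]
  ring

omit [DecidableEq V] in
theorem sum_adj_eq_sum (hG : ∀ x y, ¬ G.Adj x y → w x y = 0) (u : V) (g : V → ℝ) :
    ∑ x : {x // G.Adj u x}, w u x.1 * g x.1 = ∑ x, w u x * g x := by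
  rw [← Finset.sum_subtype (Finset.univ.filter (G.Adj u)) (by simp) (fun x => w u x * g x),
    Finset.sum_filter]
  exact Finset.sum_congr rfl fun x _ => by split_ifs with h <;> simp [hG u x, h]

/-- The determinantal weights dominate the first-step recursion. After the step out of `u`, the
erased remainder either avoids `u` and is extended, or meets `u` and is cut there. With `S` the path
without `u`, the first case (and the trivial walk) gives `walkProd w γ` times the minor killed on
`S`; the second gives at most what is missing to `erasedWeight w γ`. -/
theorem sum_erasedWeight_cons_le (hw : ∀ x y, 0 ≤ w x y)
    (hG : ∀ x y, ¬ G.Adj x y → w x y = 0)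
    (hd : ∀ S, 0 ≤ (killRows (1 - Matrix.of w) S).det) {u v : V} (γ : G.Path u v) :
    (if γ.1.length = 0 then (1 - Matrix.of w : Matrix V V ℝ).det else 0) +
      ∑ x : {x // G.Adj u x}, w u x.1 * ∑ δ : G.Path x.1 v,
        (if (SimpleGraph.Walk.cons x.2 δ.1).bypass = γ.1 then erasedWeight w δ.1 else 0) ≤
      erasedWeight w γ.1 := by
  set S := γ.1.support.toFinset.erase u with hS
  have hins : insert u S = γ.1.support.toFinset := Finset.insert_erase (by simp)
  have hmem : ∑ x : {x // G.Adj u x}, w u x.1 * ∑ δ : G.Path x.1 v,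
      (if ∃ hu : u ∈ δ.1.support, δ.1.dropUntil u hu = γ.1 then erasedWeight w δ.1 else 0) ≤
      erasedWeight w γ.1 - walkProd w γ.1 * (killRows (1 - Matrix.of w) S).det := by
    calc _ ≤ ∑ x : {x // G.Adj u x}, w u x.1 * (walkProd w γ.1 *
          (killRows (1 - Matrix.of w) S).adjugate x.1 u) :=
        Finset.sum_le_sum fun x _ => mul_le_mul_of_nonneg_left
          (sum_erasedWeight_of_mem_le hw hG hd γ x.1) (hw _ _)
      _ = walkProd w γ.1 * ∑ x, w u x * (killRows (1 - Matrix.of w) S).adjugate x u := by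
        rw [sum_adj_eq_sum hG u fun x => walkProd w γ.1 *
          (killRows (1 - Matrix.of w) S).adjugate x u, Finset.mul_sum]
        exact Finset.sum_congr rfl fun x _ => by ring
      _ = _ := by
        rw [sum_mul_adjugate_killRows S (by simp [hS]), hins, erasedWeight]
        ring
  have hnot : (if γ.1.length = 0 then (1 - Matrix.of w : Matrix V V ℝ).det else 0) +
      ∑ x : {x // G.Adj u x}, w u x.1 * ∑ δ : G.Path x.1 v,
        (if SimpleGraph.Walk.cons x.2 δ.1 = γ.1 then erasedWeight w δ.1 else 0) =
      walkProd w γ.1 * (killRows (1 - Matrix.of w) S).det := by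
    clear hmem
    obtain ⟨γ, hγ⟩ := γ
    cases γ with
    | nil => simp [hS, killRows_empty]
    | @cons _ y _ h p =>
      rw [SimpleGraph.Walk.cons_isPath_iff] at hγ
      have hSp : S = p.support.toFinset := by
        rw [hS, SimpleGraph.Walk.support_cons, List.toFinset_cons, Finset.erase_insert]
        simpa using hγ.2
      rw [if_neg (by simp), zero_add, Fintype.sum_eq_single ⟨y, h⟩, Fintype.sum_eq_single ⟨p, hγ.1⟩,
        if_pos rfl, walkProd_cons, erasedWeight, hSp, mul_assoc]
      · intro δ hδ
        rw [if_neg]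
        intro h'
        simp only [SimpleGraph.Walk.cons.injEq, heq_eq_eq, true_and] at h'
        exact hδ (Subtype.ext h')
      · rintro ⟨x, hx⟩ hxy
        rw [Finset.sum_eq_zero, mul_zero]
        intro δ _
        rw [if_neg]
        intro h'
        simp only [SimpleGraph.Walk.cons.injEq] at h'
        exact hxy (Subtype.ext h'.1)
  have hsplit : ∀ x : {x // G.Adj u x}, ∀ δ : G.Path x.1 v,
      (if (SimpleGraph.Walk.cons x.2 δ.1).bypass = γ.1 then erasedWeight w δ.1 else 0) ≤
      (if SimpleGraph.Walk.cons x.2 δ.1 = γ.1 then erasedWeight w δ.1 else 0) +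
        if ∃ hu : u ∈ δ.1.support, δ.1.dropUntil u hu = γ.1 then erasedWeight w δ.1 else 0 := by
    intro x δ
    have h0 := erasedWeight_nonneg hw hd δ.1
    by_cases hu : u ∈ δ.1.support
    · simp only [bypass_cons_of_mem x.2 δ.2 hu, hu, exists_true_left]
      refine le_add_of_nonneg_left ?_
      split_ifs
      · exact h0
      · exact le_rfl
    · rw [bypass_cons_of_notMem x.2 δ.2 hu]
      refine le_add_of_nonneg_right ?_
      split_ifs
      · exact h0
      · exact le_rfl
  calc _ ≤ (if γ.1.length = 0 then (1 - Matrix.of w : Matrix V V ℝ).det else 0) +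
      ∑ x : {x // G.Adj u x}, w u x.1 * ∑ δ : G.Path x.1 v,
        ((if SimpleGraph.Walk.cons x.2 δ.1 = γ.1 then erasedWeight w δ.1 else 0) +
        if ∃ hu : u ∈ δ.1.support, δ.1.dropUntil u hu = γ.1 then erasedWeight w δ.1 else 0) :=
        add_le_add le_rfl (Finset.sum_le_sum fun x _ => mul_le_mul_of_nonneg_left
          (Finset.sum_le_sum fun δ _ => hsplit x δ) (hw _ _))
    _ ≤ _ := by
        simp only [Finset.sum_add_distrib, mul_add]
        linarith

/-- Induction on the length: the erasure of a walk depends on its tail only through the erasure of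
the tail. -/
theorem sum_bypass_le (hw : ∀ x y, 0 ≤ w x y) (hG : ∀ x y, ¬ G.Adj x y → w x y = 0)
    (hd : ∀ S, 0 ≤ (killRows (1 - Matrix.of w) S).det)
    (hd0 : 0 < (1 - Matrix.of w : Matrix V V ℝ).det) (n : ℕ) {u v : V} (γ : G.Path u v) :
    ∑ ω ∈ G.finsetWalkLengthLT n u v, (if ω.bypass = γ.1 then walkProd w ω else 0) ≤
      erasedWeight w γ.1 / (1 - Matrix.of w : Matrix V V ℝ).det := by
  set d := (1 - Matrix.of w : Matrix V V ℝ).det with hdd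
  induction n generalizing u with
  | zero =>
    simp only [SimpleGraph.finsetWalkLengthLT, Finset.range_zero, Finset.disjiUnion_empty,
      Finset.sum_empty]
    exact div_nonneg (erasedWeight_nonneg hw hd _) hd0.le
  | succ n ih =>
    rw [sum_finsetWalkLengthLT_succ]
    have h1 : ∑ ω ∈ G.finsetWalkLengthLT 1 u v, (if ω.bypass = γ.1 then walkProd w ω else 0) ≤
        (if γ.1.length = 0 then d else 0) / d := by
      split_ifs with h
      · rw [div_self hd0.ne']
        calc _ ≤ ∑ ω ∈ G.finsetWalkLengthLT 1 u v, walkProd w ω :=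
              Finset.sum_le_sum fun ω _ => by
                split_ifs
                · exact le_rfl
                · exact walkProd_nonneg hw ω
          _ ≤ 1 := by
            rw [sum_finsetWalkLengthLT_one]
            split_ifs <;> norm_num
      · rw [zero_div]
        refine (Finset.sum_eq_zero fun ω hω => if_neg fun h' => h ?_).le
        rw [SimpleGraph.mem_finsetWalkLengthLT_iff] at hω
        have := ω.length_bypass_le_length
        rw [h'] at this
        omega
    have h2 : ∀ x : {x // G.Adj u x}, ∑ ω ∈ G.finsetWalkLengthLT n x.1 v,
        (if (SimpleGraph.Walk.cons x.2 ω).bypass = γ.1 then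
          walkProd w (SimpleGraph.Walk.cons x.2 ω) else 0) ≤
        (w u x.1 * ∑ δ : G.Path x.1 v,
          if (SimpleGraph.Walk.cons x.2 δ.1).bypass = γ.1 then erasedWeight w δ.1 else 0) / d := by
      intro x
      have h3 : ∀ ω : G.Walk x.1 v, (if (SimpleGraph.Walk.cons x.2 ω).bypass = γ.1 then
          walkProd w (SimpleGraph.Walk.cons x.2 ω) else 0) = w u x.1 * ∑ δ : G.Path x.1 v,
            if (SimpleGraph.Walk.cons x.2 δ.1).bypass = γ.1 then
              (if ω.bypass = δ.1 then walkProd w ω else 0) else 0 := by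
        intro ω
        rw [Fintype.sum_eq_single ω.toPath, SimpleGraph.Walk.toPath]
        · simp [bypass_cons_bypass]
        · intro δ hδ
          have : ω.bypass ≠ δ.1 := fun h => hδ (Subtype.ext h.symm)
          simp [this]
      simp only [h3]
      rw [← Finset.mul_sum, Finset.sum_comm, mul_div_assoc]
      refine mul_le_mul_of_nonneg_left ?_ (hw _ _)
      rw [Finset.sum_div]
      refine Finset.sum_le_sum fun δ _ => ?_
      split_ifs
      · exact ih δ
      · simp
    calc _ ≤ (if γ.1.length = 0 then d else 0) / d + ∑ x : {x // G.Adj u x},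
          (w u x.1 * ∑ δ : G.Path x.1 v,
            if (SimpleGraph.Walk.cons x.2 δ.1).bypass = γ.1 then erasedWeight w δ.1 else 0) / d :=
          add_le_add h1 (Finset.sum_le_sum fun x _ => h2 x)
      _ ≤ _ := by
        rw [← Finset.sum_div, ← add_div]
        exact div_le_div_of_nonneg_right (sum_erasedWeight_cons_le hw hG hd γ) hd0.le

theorem sum_path_bypass {u v : V} (ω : G.Walk u v) (F : ℝ) :
    ∑ γ : G.Path u v, (if ω.bypass = γ.1 then F else 0) = F := by
  rw [Fintype.sum_eq_single ω.toPath, if_pos (show ω.bypass = ω.toPath.1 from rfl)]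
  exact fun γ hγ => if_neg fun h => hγ (Subtype.ext h.symm)

theorem summable_walkProd (hw : ∀ x y, 0 ≤ w x y) (hG : ∀ x y, ¬ G.Adj x y → w x y = 0)
    (hd : ∀ S, 0 ≤ (killRows (1 - Matrix.of w) S).det)
    (hd0 : 0 < (1 - Matrix.of w : Matrix V V ℝ).det) (u v : V) :
    Summable fun ω : G.Walk u v => walkProd w ω := by
  refine summable_of_sum_le (c := ∑ γ : G.Path u v,
    erasedWeight w γ.1 / (1 - Matrix.of w : Matrix V V ℝ).det) (fun ω => walkProd_nonneg hw ω)
    fun s => ?_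
  obtain ⟨n, hn⟩ := (tendsto_finsetWalkLengthLT u v).eventually_ge_atTop s |>.exists
  calc ∑ ω ∈ s, walkProd w ω ≤ ∑ ω ∈ G.finsetWalkLengthLT n u v, walkProd w ω :=
        Finset.sum_le_sum_of_subset_of_nonneg hn fun ω _ _ => walkProd_nonneg hw ω
    _ = ∑ γ : G.Path u v, ∑ ω ∈ G.finsetWalkLengthLT n u v,
          (if ω.bypass = γ.1 then walkProd w ω else 0) := by
        rw [Finset.sum_comm]
        exact Finset.sum_congr rfl fun ω _ => (sum_path_bypass ω _).symm
    _ ≤ _ := Finset.sum_le_sum fun γ _ => sum_bypass_le hw hG hd hd0 n γ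

/-- The total weight `N` of the walks to `v`, as a function of the starting point, solves `A N =
e_v` by first-step analysis. Multiplying by the adjugate and expanding it over paths gives the sum
of the upper bounds. -/
theorem tsum_walkProd (hw : ∀ x y, 0 ≤ w x y) (hG : ∀ x y, ¬ G.Adj x y → w x y = 0)
    (hd : ∀ S, 0 ≤ (killRows (1 - Matrix.of w) S).det)
    (hd0 : 0 < (1 - Matrix.of w : Matrix V V ℝ).det) (u v : V) :
    ∑' ω : G.Walk u v, walkProd w ω =
      ∑ γ : G.Path u v, erasedWeight w γ.1 / (1 - Matrix.of w : Matrix V V ℝ).det := by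
  set A : Matrix V V ℝ := 1 - Matrix.of w with hA
  set N : V → ℝ := fun x => ∑' ω : G.Walk x v, walkProd w ω with hN
  have hlim : ∀ x, Tendsto (fun n => ∑ ω ∈ G.finsetWalkLengthLT n x v, walkProd w ω) atTop
      (𝓝 (N x)) := fun x =>
    (summable_walkProd hw hG hd hd0 x v).hasSum.comp (tendsto_finsetWalkLengthLT x v)
  have hrec : ∀ x, N x = (if x = v then 1 else 0) + ∑ y, w x y * N y := by
    intro x
    refine tendsto_nhds_unique ((hlim x).comp (tendsto_add_atTop_nat 1)) ?_
    have h1 : Tendsto (fun n => (if x = v then (1 : ℝ) else 0) + ∑ y : {y // G.Adj x y},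
        w x y.1 * ∑ ω ∈ G.finsetWalkLengthLT n y.1 v, walkProd w ω) atTop
        (𝓝 ((if x = v then 1 else 0) + ∑ y : {y // G.Adj x y}, w x y.1 * N y.1)) :=
      tendsto_const_nhds.add (tendsto_finsetSum _ fun y _ => (hlim y.1).const_mul _)
    rw [sum_adj_eq_sum hG] at h1
    refine h1.congr fun n => ?_
    simp only [Function.comp]
    rw [sum_finsetWalkLengthLT_succ, sum_finsetWalkLengthLT_one]
    simp only [walkProd_cons, Finset.mul_sum]
  have hAN : A.mulVec N = Pi.single v 1 := by
    ext x
    rw [hA, Matrix.sub_mulVec, Matrix.one_mulVec, Pi.sub_apply, Pi.single_apply]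
    have h2 : (Matrix.of w).mulVec N x = ∑ y, w x y * N y := rfl
    rw [h2, hrec x, add_sub_cancel_right]
  have hN' : A.det * N u = A.adjugate u v := by
    have h3 : A.adjugate.mulVec (A.mulVec N) = A.det • N := by
      rw [Matrix.mulVec_mulVec, Matrix.adjugate_mul, Matrix.smul_mulVec, Matrix.one_mulVec]
    rw [hAN, Matrix.mulVec_single_one] at h3
    exact (congr_fun h3 u).symm
  rw [← Finset.sum_div, eq_div_iff hd0.ne', mul_comm]
  refine hN'.trans ?_
  rw [adjugate_eq_sum_path G A (one_sub_of_apply hG)]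
  simp only [hA, walkProd_neg_one_sub]
  rfl

/-- The total weight of the walks whose loop erasure is `γ`. -/
theorem tsum_bypass_eq (hw : ∀ x y, 0 ≤ w x y) (hG : ∀ x y, ¬ G.Adj x y → w x y = 0)
    (hd : ∀ S, 0 ≤ (killRows (1 - Matrix.of w) S).det)
    (hd0 : 0 < (1 - Matrix.of w : Matrix V V ℝ).det) {u v : V} (γ : G.Path u v) :
    ∑' ω : G.Walk u v, (if ω.bypass = γ.1 then walkProd w ω else 0) =
      erasedWeight w γ.1 / (1 - Matrix.of w : Matrix V V ℝ).det := by
  have hs := summable_walkProd hw hG hd hd0 u v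
  have hsγ : ∀ γ : G.Path u v, Summable fun ω : G.Walk u v =>
      if ω.bypass = γ.1 then walkProd w ω else 0 := fun γ =>
    hs.of_nonneg_of_le (fun ω => by
      split_ifs
      · exact walkProd_nonneg hw ω
      · exact le_rfl) fun ω => by
      split_ifs
      · exact le_rfl
      · exact walkProd_nonneg hw ω
  have hle : ∀ γ : G.Path u v, ∑' ω : G.Walk u v, (if ω.bypass = γ.1 then walkProd w ω else 0) ≤
      erasedWeight w γ.1 / (1 - Matrix.of w : Matrix V V ℝ).det := fun γ =>
    le_of_tendsto' ((hsγ γ).hasSum.comp (tendsto_finsetWalkLengthLT u v)) fun n =>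
      sum_bypass_le hw hG hd hd0 n γ
  have hsum : ∑ γ : G.Path u v, ∑' ω : G.Walk u v, (if ω.bypass = γ.1 then walkProd w ω else 0) =
      ∑ γ : G.Path u v, erasedWeight w γ.1 / (1 - Matrix.of w : Matrix V V ℝ).det := by
    rw [← Summable.tsum_finsetSum fun γ _ => hsγ γ, ← tsum_walkProd hw hG hd hd0 u v]
    exact tsum_congr fun ω => sum_path_bypass ω _
  exact (Finset.sum_eq_sum_iff_of_le fun γ _ => hle γ).1 hsum γ (Finset.mem_univ γ)

theorem tsum_bypass_mem (hw : ∀ x y, 0 ≤ w x y) (hG : ∀ x y, ¬ G.Adj x y → w x y = 0)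
    (hd : ∀ S, 0 ≤ (killRows (1 - Matrix.of w) S).det)
    (hd0 : 0 < (1 - Matrix.of w : Matrix V V ℝ).det) {u v : V} (B : G.Path u v → Prop)
    [DecidablePred B] :
    ∑' ω : G.Walk u v, (if B ω.toPath then walkProd w ω else 0) =
      ∑ γ : G.Path u v, if B γ then
        erasedWeight w γ.1 / (1 - Matrix.of w : Matrix V V ℝ).det else 0 := by
  have hs := summable_walkProd hw hG hd hd0 u v
  have h1 : ∀ ω : G.Walk u v, (if B ω.toPath then walkProd w ω else 0) =
      ∑ γ : G.Path u v, if B γ then (if ω.bypass = γ.1 then walkProd w ω else 0) else 0 := by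
    intro ω
    rw [Fintype.sum_eq_single ω.toPath, if_pos (show ω.bypass = ω.toPath.1 from rfl)]
    intro γ hγ
    rw [if_neg (show ¬ ω.bypass = γ.1 from fun h => hγ (Subtype.ext h.symm)), ite_self]
  simp only [h1]
  rw [Summable.tsum_finsetSum]
  · refine Finset.sum_congr rfl fun γ _ => ?_
    split_ifs
    · exact tsum_bypass_eq hw hG hd hd0 γ
    · exact tsum_zero
  · intro γ _
    refine hs.of_nonneg_of_le (fun ω => ?_) fun ω => ?_
    · split_ifs
      · exact walkProd_nonneg hw ω
      · exact le_rfl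
      · exact le_rfl
    · split_ifs
      · exact le_rfl
      · exact walkProd_nonneg hw ω
      · exact walkProd_nonneg hw ω

end LoopErasure


/-! ### Loop-erased random walk and the spanning forest measure. -/

section Lerw

variable {V : Type*} [Fintype V] [DecidableEq V] {G : SimpleGraph V} [DecidableRel G.Adj]
  {c : Sym2 V → ℝ} {D : Finset V}

theorem deg_eq (u : V) :
    deg G c D u = (∑ w, condMatrix G c u w) + if u ∈ D then 1 else 0 := by
  rw [deg, sum_neighborFinset_eq]

theorem deg_pos [Nontrivial V] (hG : G.Connected) (hc : ∀ e ∈ G.edgeSet, 0 < c e) (u : V) :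
    0 < deg G c D u := by
  obtain ⟨v, hv⟩ := hG.preconnected.exists_adj_of_nontrivial u
  rw [deg]
  refine add_pos_of_pos_of_nonneg (Finset.sum_pos (fun w hw => hc s(u, w) ?_) ⟨v, by simpa using hv⟩)
    (by split_ifs <;> norm_num)
  simpa using hw

/-- The conductances to the root for which the walk has transition matrix `stepProb`. -/
noncomputable def stepRoot (G : SimpleGraph V) [DecidableRel G.Adj] (c : Sym2 V → ℝ) (D : Finset V)
    (v : V) (ε : ℝ) (x : V) : ℝ :=
  (if x = v then deg G c D v * (ε / (1 - ε)) else 0) + if x ∈ D then 1 else 0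

/-- The reciprocals of the total conductances. -/
noncomputable def stepScale (G : SimpleGraph V) [DecidableRel G.Adj] (c : Sym2 V → ℝ)
    (D : Finset V) (v : V) (ε : ℝ) (x : V) : ℝ :=
  (if x = v then 1 - ε else 1) / deg G c D x

theorem stepProb_eq (v : V) (ε : ℝ) (x y : V) :
    stepProb G c D v ε x y = stepScale G c D v ε x * condMatrix G c x y := by
  unfold stepProb stepScale condMatrix
  rw [Matrix.of_apply]
  split_ifs <;> ring

variable {v : V} {ε : ℝ}

section Parameters

variable [Nontrivial V] (hG : G.Connected) (hc : ∀ e ∈ G.edgeSet, 0 < c e) (hε1 : ε < 1)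
include hG hc hε1

theorem stepScale_pos (x : V) : 0 < stepScale G c D v ε x := by
  refine div_pos ?_ (deg_pos hG hc x)
  split_ifs
  · linarith
  · norm_num

/-- At a vertex of degree `d`, an additional edge of conductance `x` is taken with probability `ε`
when `x / (d + x) = ε`, that is `x = d * (ε / (1 - ε))`; the total conductance is then `d / (1 -
ε)`. Hence `1 - w` is the corresponding Laplacian with each row divided by the total conductance. -/
theorem one_sub_stepProb :
    (1 - Matrix.of (stepProb G c D v ε) : Matrix V V ℝ) =
      Matrix.of fun x y => stepScale G c D v ε x *
        rootLaplacian G c (stepRoot G c D v ε) x y := by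
  ext x y
  have hx := (deg_pos (D := D) hG hc x).ne'
  have h1 : stepScale G c D v ε x *
      ((∑ w, condMatrix G c x w) + stepRoot G c D v ε x) = 1 := by
    have h2 : 1 - ε ≠ 0 := by linarith
    have h3 := deg_eq (G := G) (c := c) (D := D) x
    unfold stepScale stepRoot
    by_cases hxv : x = v
    · subst hxv
      simp only [if_true]
      rw [add_left_comm, ← h3]
      field_simp
      ring
    · simp only [hxv, if_false, zero_add]
      rw [← h3]
      field_simp
  simp only [Matrix.sub_apply, Matrix.of_apply, stepProb_eq, rootLaplacian_apply, mul_sub,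
    Matrix.one_apply]
  split_ifs
  · rw [h1]
  · rw [mul_zero]


theorem stepProb_nonneg (x y : V) : 0 ≤ stepProb G c D v ε x y := by
  rw [stepProb_eq]
  exact mul_nonneg (stepScale_pos hG hc hε1 x).le (condMatrix_nonneg hc x y)

variable (hε0 : 0 ≤ ε)
include hε0

theorem stepRoot_nonneg (x : V) : 0 ≤ stepRoot G c D v ε x := by
  have h1 : 0 ≤ deg G c D v * (ε / (1 - ε)) :=
    mul_nonneg (deg_pos hG hc v).le (div_nonneg hε0 (by linarith))
  unfold stepRoot
  split_ifs <;> linarith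

variable (hv : 0 < ε ∨ v ∈ D)
include hv

theorem stepRoot_pos : 0 < stepRoot G c D v ε v := by
  have h0 := deg_pos (D := D) hG hc v
  unfold stepRoot
  rw [if_pos rfl]
  rcases hv with h | h
  · refine add_pos_of_pos_of_nonneg (mul_pos h0 (div_pos h (by linarith))) ?_
    split_ifs <;> norm_num
  · rw [if_pos h]
    exact add_pos_of_nonneg_of_pos (mul_nonneg h0.le (div_nonneg hε0 (by linarith))) one_pos

theorem det_killRows_stepProb_pos (S : Finset V) :
    0 < (killRows (1 - Matrix.of (stepProb G c D v ε)) S).det := by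
  rw [one_sub_stepProb hG hc hε1, det_killRows_mul_left]
  exact mul_pos (Finset.prod_pos fun x _ => stepScale_pos hG hc hε1 x)
    (det_killRows_rootLaplacian_pos hG hc (stepRoot_nonneg hG hc hε1 hε0) S
      (Or.inr ⟨v, stepRoot_pos hG hc hε1 hε0 hv⟩))

/-- The probability of stepping from `v` to the root is positive. -/
theorem one_sub_sum_stepProb_pos : 0 < 1 - ∑ y, stepProb G c D v ε v y := by
  have h1 := congr_fun (congr_arg (fun A => Matrix.mulVec A fun _ => (1 : ℝ))
    (one_sub_stepProb (G := G) (c := c) (D := D) (v := v) hG hc hε1)) v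
  have h2 : Matrix.mulVec (1 - Matrix.of (stepProb G c D v ε) : Matrix V V ℝ) (fun _ => (1 : ℝ)) v =
      1 - ∑ y, stepProb G c D v ε v y := by
    rw [Matrix.sub_mulVec, Matrix.one_mulVec]
    simp [Matrix.mulVec, dotProduct]
  have h3 : Matrix.mulVec (Matrix.of fun x y => stepScale G c D v ε x *
      rootLaplacian G c (stepRoot G c D v ε) x y) (fun _ => (1 : ℝ)) v =
      stepScale G c D v ε v * (rootLaplacian G c (stepRoot G c D v ε)).mulVec (fun _ => 1) v := by
    simp [Matrix.mulVec, dotProduct, Finset.mul_sum]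
  rw [← h2]
  refine lt_of_lt_of_eq ?_ (h1.trans h3).symm
  rw [rootLaplacian_mulVec]
  simp only [sub_self, mul_zero, Finset.sum_const_zero, add_zero, mul_one]
  exact mul_pos (stepScale_pos hG hc hε1 v) (stepRoot_pos hG hc hε1 hε0 hv)

end Parameters

theorem stepProb_of_not_adj (x y : V) (h : ¬ G.Adj x y) : stepProb G c D v ε x y = 0 := by
  simp [stepProb, h]

omit [Fintype V] [DecidableEq V] [DecidableRel G.Adj] in
theorem walkProd_scale {r : V → ℝ} {w : V → V → ℝ} {u : V} (γ : G.Walk u v) :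
    walkProd (fun x y => r x * w x y) γ = walkProd (fun x _ => r x) γ * walkProd w γ := by
  induction γ with
  | nil => simp
  | cons h p ih => simp only [walkProd_cons, ih]; ring

omit [Fintype V] [DecidableRel G.Adj] in
theorem walkProd_fst_mul {r : V → ℝ} {u : V} (γ : G.Walk u v) (hγ : γ.IsPath) :
    walkProd (fun x _ => r x) γ * r v = ∏ x ∈ γ.support.toFinset, r x := by
  induction γ with
  | nil => simp
  | cons h p ih =>
    rw [SimpleGraph.Walk.cons_isPath_iff] at hγ
    rw [walkProd_cons, SimpleGraph.Walk.support_cons, List.toFinset_cons,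
      Finset.prod_insert (by simpa using hγ.2), ← ih hγ.1, mul_assoc]

omit [Fintype V] in
theorem killRows_congr {R : Type*} [CommRing R] {A B : Matrix V V R} {S : Finset V}
    (h : ∀ x ∉ S, ∀ y, A x y = B x y) : killRows A S = killRows B S := by
  ext x y
  by_cases hx : x ∈ S <;> simp [killRows, hx, h]

/-- The end `v` is on the path, so the additional conductance sits in a killed row. Steps along the
path supply the scale factors of its vertices other than `v`, and the minor supplies those off the
path; the factor at `v` completes a product independent of the path. -/
theorem erasedWeight_stepProb [Nontrivial V] (hG : G.Connected) (hc : ∀ e ∈ G.edgeSet, 0 < c e)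
    (hε1 : ε < 1) {u : V} (γ : G.Path u v) :
    erasedWeight (stepProb G c D v ε) γ.1 * stepScale G c D v ε v =
      (∏ x, stepScale G c D v ε x) * pathWeight G c D γ := by
  have h2 : walkProd (stepProb G c D v ε) γ.1 =
      walkProd (fun x _ => stepScale G c D v ε x) γ.1 * walkProd (fun x y => c s(x, y)) γ.1 := by
    rw [← walkProd_scale]
    exact walkProd_congr G (fun x y h => by simp [stepProb_eq, condMatrix, h]) γ.1
  have h3 : killRows (rootLaplacian G c (stepRoot G c D v ε)) γ.1.support.toFinset =
      killRows (laplacian G c D) γ.1.support.toFinset := by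
    refine killRows_congr fun x hx y => ?_
    have hxv : x ≠ v := by
      rintro rfl
      simp at hx
    simp only [laplacian_eq_rootLaplacian, rootLaplacian_apply, stepRoot, hxv, if_false, zero_add]
  rw [erasedWeight, h2, one_sub_stepProb hG hc hε1, det_killRows_mul_left, h3, pathWeight_eq,
    ← Finset.prod_mul_prod_compl γ.1.support.toFinset, ← walkProd_fst_mul γ.1 γ.2]
  ring

/-- Reversal of walks. -/
def reverseEquiv (G : SimpleGraph V) (u v : V) : G.Walk u v ≃ G.Walk v u :=
  ⟨SimpleGraph.Walk.reverse, SimpleGraph.Walk.reverse, SimpleGraph.Walk.reverse_reverse,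
    SimpleGraph.Walk.reverse_reverse⟩

/-- Reversal of paths. -/
def pathReverseEquiv (G : SimpleGraph V) (u v : V) : G.Path u v ≃ G.Path v u :=
  ⟨SimpleGraph.Path.reverse, SimpleGraph.Path.reverse,
    fun γ => Subtype.ext (SimpleGraph.Walk.reverse_reverse γ.1),
    fun γ => Subtype.ext (SimpleGraph.Walk.reverse_reverse γ.1)⟩

omit [DecidableRel G.Adj] in
theorem erasedWeight_reverse (w : V → V → ℝ) {u : V} (γ : G.Walk u v) :
    erasedWeight (fun x y => w y x) γ.reverse = erasedWeight w γ := by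
  have h : (1 - Matrix.of fun x y => w y x : Matrix V V ℝ) = (1 - Matrix.of w).transpose := by
    rw [Matrix.transpose_sub, Matrix.transpose_one]; rfl
  rw [erasedWeight, walkProd_reverse, h, det_killRows_transpose, SimpleGraph.Walk.support_reverse,
    List.toFinset_reverse, erasedWeight]

theorem summable_walkProd_of_pos {w : V → V → ℝ} (hw : ∀ x y, 0 ≤ w x y)
    (hG : ∀ x y, ¬ G.Adj x y → w x y = 0)
    (hd : ∀ S, 0 < (killRows (1 - Matrix.of w) S).det) (u v : V) :
    Summable fun ω : G.Walk u v => walkProd w ω := by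
  refine summable_walkProd hw hG (fun S => (hd S).le) ?_ u v
  have := hd ∅
  rwa [killRows_empty] at this

/-- The total weight of the walks whose chronological loop erasure is in `B`. -/
theorem tsum_loopErasure_mem {w : V → V → ℝ} (hw : ∀ x y, 0 ≤ w x y)
    (hG : ∀ x y, ¬ G.Adj x y → w x y = 0)
    (hd : ∀ S, 0 < (killRows (1 - Matrix.of w) S).det) {u v : V} (B : G.Path u v → Prop)
    [DecidablePred B] :
    ∑' ω : G.Walk u v, (if B (loopErasure ω) then walkProd w ω else 0) =
      ∑ γ : G.Path u v, if B γ then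
        erasedWeight w γ.1 / (1 - Matrix.of w : Matrix V V ℝ).det else 0 := by
  have hA : (1 - Matrix.of fun x y => w y x : Matrix V V ℝ) = (1 - Matrix.of w).transpose := by
    rw [Matrix.transpose_sub, Matrix.transpose_one]; rfl
  have hd' : ∀ S, 0 < (killRows (1 - Matrix.of fun x y => w y x) S).det := fun S => by
    rw [hA, det_killRows_transpose]
    exact hd S
  have hd0 : 0 < (1 - Matrix.of fun x y => w y x : Matrix V V ℝ).det := by
    have := hd' ∅
    rwa [killRows_empty] at this
  -- Chronological erasure is `bypass` applied to the reversed walk, hence the reversed weights and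
  -- the transposed matrix.
  have h := tsum_bypass_mem (u := v) (v := u) (fun x y => hw y x)
    (fun x y h => hG y x fun h' => h h'.symm)
    (fun S => (hd' S).le) hd0 fun γ => B γ.reverse
  rw [← Equiv.tsum_eq (reverseEquiv G u v), ← Equiv.sum_comp (pathReverseEquiv G u v)] at h
  refine Eq.trans (tsum_congr fun ω => ?_) (h.trans (Finset.sum_congr rfl fun γ _ => ?_))
  · refine if_congr Iff.rfl ?_ rfl
    exact (walkProd_reverse (fun x y => w y x) ω).symm
  · refine if_congr (Iff.of_eq (congr_arg B ((pathReverseEquiv G u v).left_inv γ))) ?_ rfl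
    rw [hA, Matrix.det_transpose]
    exact congr_arg (· / _) (erasedWeight_reverse w γ.1)

theorem walkWeight_eq {u : V} (ω : G.Walk u v) :
    walkWeight G c D ε ω = walkProd (stepProb G c D v ε) ω * (1 - ∑ y, stepProb G c D v ε v y) :=
  rfl

theorem pathProb_eq (D : Finset V) {u v : V} (B : G.Path u v → Prop) [DecidablePred B] :
    pathProb G c D B = (∑ γ : G.Path u v, if B γ then pathWeight G c D γ else 0) /
      ∑ γ : G.Path u v, pathWeight G c D γ := by
  rw [pathProb, finsum_eq_sum_of_fintype, finsum_eq_sum_of_fintype]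
  congr 1
  exact Finset.sum_congr rfl fun γ _ => by congr

theorem summable_walkWeight [Nontrivial V] (hG : G.Connected)
    (hc : ∀ e ∈ G.edgeSet, 0 < c e) (hε1 : ε < 1) (hε0 : 0 ≤ ε) (hv : 0 < ε ∨ v ∈ D) (u : V) :
    Summable (fun ω : G.Walk u v => walkWeight G c D ε ω) := by
  simp only [walkWeight_eq]
  exact (summable_walkProd_of_pos (stepProb_nonneg hG hc hε1) stepProb_of_not_adj
    (det_killRows_stepProb_pos hG hc hε1 hε0 hv) u v).mul_right _

theorem tsum_walkWeight_mem [Nontrivial V] (hG : G.Connected)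
    (hc : ∀ e ∈ G.edgeSet, 0 < c e) (hε1 : ε < 1) (hε0 : 0 ≤ ε) (hv : 0 < ε ∨ v ∈ D) {u : V}
    (B : G.Path u v → Prop) [DecidablePred B] :
    ∑' ω : G.Walk u v, (if B (loopErasure ω) then walkWeight G c D ε ω else 0) =
      (∏ x, stepScale G c D v ε x) / stepScale G c D v ε v /
        (1 - Matrix.of (stepProb G c D v ε) : Matrix V V ℝ).det *
        (1 - ∑ y, stepProb G c D v ε v y) *
        ∑ γ : G.Path u v, if B γ then pathWeight G c D γ else 0 := by
  have h1 : ∀ ω : G.Walk u v, (if B (loopErasure ω) then walkWeight G c D ε ω else 0) =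
      (if B (loopErasure ω) then walkProd (stepProb G c D v ε) ω else 0) *
        (1 - ∑ y, stepProb G c D v ε v y) := fun ω => by
    rw [walkWeight_eq, ite_mul, zero_mul]
  rw [tsum_congr h1, tsum_mul_right, tsum_loopErasure_mem (stepProb_nonneg hG hc hε1)
    stepProb_of_not_adj (det_killRows_stepProb_pos hG hc hε1 hε0 hv), mul_right_comm,
    Finset.mul_sum]
  congr 1
  refine Finset.sum_congr rfl fun γ _ => ?_
  rw [mul_ite, mul_zero]
  refine if_congr Iff.rfl ?_ rfl
  rw [div_mul_eq_mul_div, div_mul_eq_mul_div, ← erasedWeight_stepProb hG hc hε1 γ, mul_div_assoc,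
    div_self (stepScale_pos hG hc hε1 v).ne', mul_one]

/-- The loop-erased random walk has the distribution of the spanning forest path. -/
theorem lerwProb_eq_pathProb [Nontrivial V] (hG : G.Connected)
    (hc : ∀ e ∈ G.edgeSet, 0 < c e) (hε1 : ε < 1) (hε0 : 0 ≤ ε) (hv : 0 < ε ∨ v ∈ D) {u : V}
    (B : G.Path u v → Prop) : lerwProb G c D ε B = pathProb G c D B := by
  classical
  have hd0 := det_killRows_stepProb_pos (G := G) (c := c) (D := D) hG hc hε1 hε0 hv ∅
  rw [killRows_empty] at hd0
  have hscale := fun x => stepScale_pos (D := D) (v := v) hG hc hε1 x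
  have hq := one_sub_sum_stepProb_pos (D := D) hG hc hε1 hε0 hv
  have hK := (mul_pos (div_pos (div_pos (Finset.prod_pos fun x (_ : x ∈ Finset.univ) => hscale x)
    (hscale v)) hd0) hq).ne'
  have hnum := tsum_walkWeight_mem (D := D) hG hc hε1 hε0 hv B
  have hden := tsum_walkWeight_mem (D := D) hG hc hε1 hε0 hv fun _ : G.Path u v => True
  simp only [if_true] at hden
  rw [pathProb_eq, lerwProb, hden]
  refine Eq.trans ?_ (mul_div_mul_left _ _ hK)
  rw [← hnum]

end Lerw


/-! ### Derivatives of determinants, cofactors and inverses. -/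

section MatrixCalculus

variable {n 𝕜 : Type*} [Fintype n] [DecidableEq n] [NontriviallyNormedField 𝕜]

/-- The derivative of the determinant at `A` in the direction `B`. -/
def detDeriv (A B : Matrix n n 𝕜) : 𝕜 :=
  ∑ σ : Equiv.Perm n, (σ.sign : 𝕜) *
    ∑ i, (∏ j ∈ Finset.univ.erase i, A (σ j) j) * B (σ i) i

/-- The derivative of an entry of the adjugate at `A` in the direction `B`. -/
def adjugateDeriv (A B : Matrix n n 𝕜) (u v : n) : 𝕜 :=
  detDeriv (A.updateRow v (Pi.single u 1)) (B.updateRow v 0)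

variable {A : 𝕜 → Matrix n n 𝕜} {B : Matrix n n 𝕜} {a : 𝕜}

theorem hasDerivAt_det (hA : ∀ u v, HasDerivAt (fun z => A z u v) (B u v) a) :
    HasDerivAt (fun z => (A z).det) (detDeriv (A a) B) a := by
  simp only [Matrix.det_apply']
  refine HasDerivAt.fun_sum fun σ _ => HasDerivAt.const_mul _ ?_
  simpa only [smul_eq_mul] using HasDerivAt.fun_finsetProd fun i (_ : i ∈ Finset.univ) => hA (σ i) i

theorem hasDerivAt_adjugate (hA : ∀ u v, HasDerivAt (fun z => A z u v) (B u v) a) (u v : n) :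
    HasDerivAt (fun z => (A z).adjugate u v) (adjugateDeriv (A a) B u v) a := by
  simp only [Matrix.adjugate_apply]
  refine hasDerivAt_det (A := fun z => (A z).updateRow v (Pi.single u 1)) fun x y => ?_
  by_cases h : x = v
  · subst h
    simpa only [Matrix.updateRow_self, Pi.zero_apply] using hasDerivAt_const a ((Pi.single u 1 : n → 𝕜) y)
  · simpa only [Matrix.updateRow_ne h] using hA x y

omit [Fintype n] in
theorem hasDerivAt_killRows (hA : ∀ u v, HasDerivAt (fun z => A z u v) (B u v) a) (S : Finset n)
    (u v : n) : HasDerivAt (fun z => killRows (A z) S u v) (if u ∈ S then 0 else B u v) a := by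
  by_cases h : u ∈ S
  · simpa only [killRows, Matrix.of_apply, h, if_true] using hasDerivAt_const a _
  · simpa only [killRows, Matrix.of_apply, h, if_false] using hA u v

/-- Needed to let `t` tend to 0 in the free case, where the limiting matrix is singular. -/
theorem continuous_adjugateDeriv {X : Type*} [TopologicalSpace X] {A : X → Matrix n n 𝕜}
    (hA : Continuous A) (B : Matrix n n 𝕜) (u v : n) :
    Continuous fun x => adjugateDeriv (A x) B u v := by
  have h : Continuous fun x => (A x).updateRow v (Pi.single u 1) :=
    hA.matrix_updateRow v continuous_const
  unfold adjugateDeriv detDeriv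
  refine continuous_finsetSum _ fun σ _ => continuous_const.mul
    (continuous_finsetSum _ fun i _ => Continuous.mul
      (continuous_finsetProd _ fun j _ => h.matrix_elem _ _) continuous_const)

/-- The derivative of the inverse. -/
theorem hasDerivAt_matrix_inv (hA : ∀ u v, HasDerivAt (fun z => A z u v) (B u v) a)
    (hdet : (A a).det ≠ 0) (u v : n) :
    HasDerivAt (fun z => (A z)⁻¹ u v) (-((A a)⁻¹ * B * (A a)⁻¹) u v) a := by
  -- Cramer's rule gives differentiability; the value of the derivative is then found by
  -- differentiating the identity between `A z * (A z)⁻¹` and `1`.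
  have h1 : ∀ u v, ∃ c, HasDerivAt (fun z => (A z)⁻¹ u v) c a := fun u v => by
    refine ⟨_, (((hasDerivAt_det hA).inv hdet).mul (hasDerivAt_adjugate hA u v)).congr_of_eventuallyEq
      (Eventually.of_forall fun z => ?_)⟩
    simp [Matrix.inv_def]
  choose C hC using h1
  have h2 : ∀ᶠ z in 𝓝 a, (A z).det ≠ 0 :=
    (hasDerivAt_det hA).continuousAt.eventually_ne hdet
  have h3 : B * (A a)⁻¹ + A a * Matrix.of C = 0 := by
    ext x y
    have h4 : HasDerivAt (fun z => ∑ k, A z x k * (A z)⁻¹ k y)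
        (∑ k, (B x k * (A a)⁻¹ k y + A a x k * C k y)) a :=
      HasDerivAt.fun_sum fun k _ => (hA x k).mul (hC k y)
    have h5 : HasDerivAt (fun z => ∑ k, A z x k * (A z)⁻¹ k y) 0 a := by
      refine (hasDerivAt_const a ((1 : Matrix n n 𝕜) x y)).congr_of_eventuallyEq ?_
      filter_upwards [h2] with z hz
      rw [← Matrix.mul_apply, Matrix.mul_nonsing_inv _ (isUnit_iff_ne_zero.2 hz)]
    refine Eq.trans ?_ (h4.unique h5)
    simp [Matrix.mul_apply, Finset.sum_add_distrib]
  have h6 : Matrix.of C = -((A a)⁻¹ * B * (A a)⁻¹) := by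
    have h7 := congr_arg (fun X => (A a)⁻¹ * X) h3
    simp only [Matrix.mul_add, ← Matrix.mul_assoc, Matrix.mul_zero] at h7
    rw [Matrix.nonsing_inv_mul _ (isUnit_iff_ne_zero.2 hdet), Matrix.one_mul] at h7
    exact eq_neg_of_add_eq_zero_right h7
  rw [← Matrix.neg_apply, ← h6]
  exact hC u v

end MatrixCalculus

/-- A function that is invariant under `z ↦ z⁻¹` has a critical point at `1`. -/
theorem hasDerivAt_zero_of_inv_eq {g : ℂ → ℂ} (hg : DifferentiableAt ℂ g 1)
    (h : ∀ z, g z⁻¹ = g z) : HasDerivAt g 0 1 := by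
  have h1 := hg.hasDerivAt
  have h2 : HasDerivAt (fun z => g z⁻¹) (deriv g 1 * -1) 1 := by
    have h3 : HasDerivAt (fun z : ℂ => z⁻¹) (-1) 1 := by
      simpa using hasDerivAt_inv (one_ne_zero (α := ℂ))
    have h4 : HasDerivAt g (deriv g 1) (1 : ℂ)⁻¹ := by rwa [inv_one]
    exact h4.comp (1 : ℂ) h3
  simp only [h] at h2
  have h3 := h1.unique h2
  have h4 : deriv g 1 = 0 := by linear_combination h3 / 2
  rwa [h4] at h1

/-- The limit in the formula for the left passage probability. -/
theorem tendsto_leftPassage {g₁ g₂ d : ℂ → ℂ} {a b : ℂ} (h₁ : HasDerivAt g₁ b 1)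
    (h₂ : HasDerivAt g₂ (-b) 1) (ha₁ : g₁ 1 = a) (ha₂ : g₂ 1 = a) (ha : a ≠ 0)
    (hd : ContinuousAt d 1) (hd1 : d 1 ≠ 0) :
    Tendsto (fun z => (g₂ z - z⁻¹ ^ 2 * g₁ z) * d z / (1 - z⁻¹ ^ 2) * (1 / (g₁ z * d z)))
      (𝓝[≠] 1) (𝓝 (1 - b / a)) := by
  have h3 : HasDerivAt (fun z : ℂ => z⁻¹ ^ 2) (-2) 1 := by
    have h3 : HasDerivAt (fun z : ℂ => z⁻¹) (-1) 1 := by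
      simpa using hasDerivAt_inv (one_ne_zero (α := ℂ))
    simpa using h3.fun_pow 2
  have h4 : HasDerivAt (fun z => g₂ z - z⁻¹ ^ 2 * g₁ z) (2 * (a - b)) 1 := by
    have h := h₂.sub (h3.mul h₁)
    have e : -b - (-2 * g₁ 1 + (1 : ℂ)⁻¹ ^ 2 * b) = 2 * (a - b) := by
      rw [ha₁]
      simp
      ring
    rwa [e] at h
  have h5 : HasDerivAt (fun z : ℂ => 1 - z⁻¹ ^ 2) 2 1 := by
    simpa using h3.const_sub 1
  have h8 : Tendsto (fun z => (g₁ z)⁻¹) (𝓝[≠] 1) (𝓝 (g₁ 1)⁻¹) :=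
    (h₁.continuousAt.tendsto.mono_left nhdsWithin_le_nhds).inv₀ (by rwa [ha₁])
  -- The numerator and `1 - z⁻¹ ^ 2` both vanish at 1, with derivatives `2 * (a - b)` and `2`; the
  -- factors `d z` cancel.
  have h6 := (h4.tendsto_slope.div h5.tendsto_slope two_ne_zero).mul h8
  have h7 : 2 * (a - b) / 2 * (g₁ 1)⁻¹ = 1 - b / a := by
    rw [ha₁]
    field_simp
  rw [h7] at h6
  refine h6.congr' ?_
  filter_upwards [self_mem_nhdsWithin, nhdsWithin_le_nhds (hd.eventually_ne hd1)] with z hz hdz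
  have hz : z - 1 ≠ 0 := sub_ne_zero.2 hz
  simp only [Pi.div_apply, slope_def_field, inv_one, one_pow, ha₁, ha₂, sub_self, one_mul, sub_zero]
  rw [div_div_div_cancel_right₀ hz, mul_comm (g₁ z), one_div, mul_inv, mul_div_right_comm, mul_assoc,
    ← mul_assoc (d z), mul_inv_cancel₀ hdz, one_mul]


/-! ### The line bundle Laplacian as a function of z. -/

section Zipper

variable {V : Type*} {G : SimpleGraph V}

section Transport

variable [DecidableEq V] {ζ : List G.Dart} {z : ℂ}

theorem transport_dart (d : G.Dart) :
    transport ζ z d.fst d.snd = if d ∈ ζ then z else if d.symm ∈ ζ then z⁻¹ else 1 := by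
  have h1 : (∃ e ∈ ζ, e.fst = d.fst ∧ e.snd = d.snd) ↔ d ∈ ζ :=
    ⟨fun ⟨e, he, h⟩ => (SimpleGraph.Dart.ext_iff e d).2 (Prod.ext h.1 h.2) ▸ he,
      fun h => ⟨d, h, rfl, rfl⟩⟩
  have h2 : (∃ e ∈ ζ, e.fst = d.snd ∧ e.snd = d.fst) ↔ d.symm ∈ ζ :=
    ⟨fun ⟨e, he, h⟩ => (SimpleGraph.Dart.ext_iff e d.symm).2 (Prod.ext h.1 h.2) ▸ he,
      fun h => ⟨d.symm, h, rfl, rfl⟩⟩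
  simp only [transport, h1, h2]

theorem transport_eq_zpow (hζ : ∀ d ∈ ζ, d.symm ∉ ζ) (d : G.Dart) :
    transport ζ z d.fst d.snd =
      z ^ ((if d ∈ ζ then 1 else 0) - (if d.symm ∈ ζ then 1 else 0) : ℤ) := by
  rw [transport_dart]
  by_cases h : d ∈ ζ
  · simp [h, hζ d h]
  · by_cases h' : d.symm ∈ ζ <;> simp [h, h']

theorem walkProd_transport_inv (hζ : ∀ d ∈ ζ, d.symm ∉ ζ) (hz : z ≠ 0)
    {u v : V} (γ : G.Walk u v) :
    walkProd (fun x y => (transport ζ z x y)⁻¹) γ =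
      z ^ (-(γ.darts.map fun d => (if d ∈ ζ then 1 else 0) - (if d.symm ∈ ζ then 1 else 0)).sum :
        ℤ) := by
  induction γ with
  | nil => simp
  | cons h p ih =>
    rw [walkProd_cons, ih, SimpleGraph.Walk.darts_cons, List.map_cons, List.sum_cons, neg_add,
      zpow_add₀ hz]
    congr 1
    rw [zpow_neg]
    exact congr_arg (·⁻¹) (transport_eq_zpow hζ ⟨(_, _), h⟩)

/-- The same incidences, counted along the path instead of along the zipper. -/
theorem sum_darts_eq_crossing {u v : V} {γ : G.Walk u v} (hγ : γ.IsPath) :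
    (γ.darts.map fun d => ((if d ∈ ζ then 1 else 0) - (if d.symm ∈ ζ then 1 else 0) : ℤ)).sum =
      RotationSystem.crossing ζ γ := by
  have hn : γ.darts.Nodup := SimpleGraph.Walk.darts_nodup_of_support_nodup hγ.support_nodup
  rw [RotationSystem.crossing, ← List.sum_toFinset _ hn, Finset.sum_sub_distrib,
    Finset.sum_sub_distrib]
  simp only [← List.mem_toFinset (l := ζ), ← List.mem_toFinset (l := γ.darts), Finset.sum_boole]
  congr 2
  · rw [Finset.filter_mem_eq_inter, Finset.filter_mem_eq_inter, Finset.inter_comm]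
  · refine Finset.card_bij' (fun d _ => d.symm) (fun d _ => d.symm) ?_ ?_ ?_ ?_ <;>
      simp +contextual

end Transport

variable [Fintype V] [DecidableEq V] [DecidableRel G.Adj] (c : Sym2 V → ℝ) (D : Finset V)
  {ζ : List G.Dart}

theorem walkProd_neg_zipLaplacian (hζ : ∀ d ∈ ζ, d.symm ∉ ζ) {z : ℂ} (hz : z ≠ 0) {u v : V}
    (γ : G.Path u v) :
    walkProd (fun x y => -zipLaplacian G c D ζ z x y) γ.1 =
      (walkProd (fun x y => c s(x, y)) γ.1 : ℝ) * z ^ (-RotationSystem.crossing ζ γ.1) := by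
  rw [← sum_darts_eq_crossing γ.2, ← walkProd_transport_inv hζ hz γ.1]
  have h : ∀ {u v : V} (q : G.Walk u v), walkProd (fun x y => -zipLaplacian G c D ζ z x y) q =
      (walkProd (fun x y => c s(x, y)) q : ℝ) *
        walkProd (fun x y => (transport ζ z x y)⁻¹) q := by
    intro u v q
    induction q with
    | nil => simp
    | cons h p ih =>
      rw [walkProd_cons, ih, walkProd_cons, walkProd_cons]
      simp only [zipLaplacian, lineLaplacian, Matrix.of_apply, h.ne, h, if_false, if_true]
      push_cast
      ring
  exact h γ.1

/-- The line bundle Laplacian as a perturbation of the Laplacian. -/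
theorem zipLaplacian_eq (hζ : ∀ d ∈ ζ, d.symm ∉ ζ) (z : ℂ) :
    zipLaplacian G c D ζ z = (laplacian G c D).map Complex.ofReal +
      ∑ d ∈ ζ.toFinset, (c d.edge : ℂ) • ((1 - z⁻¹) • Matrix.single d.fst d.snd 1 +
        (1 - z) • Matrix.single d.snd d.fst 1) := by
  ext u v
  simp only [Matrix.add_apply, Matrix.map_apply, Matrix.sum_apply, Matrix.smul_apply,
    Matrix.single_apply, smul_eq_mul]
  by_cases h : G.Adj u v
  · set e : G.Dart := ⟨(u, v), h⟩ with he
    have h1 : ∀ d : G.Dart, (d.fst = u ∧ d.snd = v) ↔ d = e := fun d => by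
      rw [SimpleGraph.Dart.ext_iff, Prod.ext_iff]
    have h2 : ∀ d : G.Dart, (d.snd = u ∧ d.fst = v) ↔ d = e.symm := fun d => by
      rw [SimpleGraph.Dart.ext_iff, Prod.ext_iff, and_comm]; rfl
    have h3 := transport_dart (ζ := ζ) (z := z) e
    simp only [zipLaplacian, lineLaplacian, laplacian, Matrix.of_apply, h.ne, h, if_false, if_true]
    rw [show transport ζ z u v = _ from h3]
    simp only [h1, h2, mul_ite, mul_one, mul_zero, mul_add, Finset.sum_add_distrib,
      Finset.sum_ite_eq', List.mem_toFinset, SimpleGraph.Dart.edge_symm]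
    have h4 : e.edge = s(u, v) := rfl
    rw [h4]
    by_cases h5 : e ∈ ζ
    · simp only [h5, hζ e h5, if_true, if_false]
      push_cast; ring
    · by_cases h6 : e.symm ∈ ζ
      · simp only [h5, h6, if_true, if_false, inv_inv]
        push_cast; ring
      · simp only [h5, h6, if_false]
        push_cast; ring
  · rw [Finset.sum_eq_zero, add_zero]
    · by_cases huv : u = v <;> simp [zipLaplacian, lineLaplacian, laplacian, huv, h]
    · intro d _
      have h1 : ¬ (d.fst = u ∧ d.snd = v) := fun ⟨h1, h2⟩ => h (h1 ▸ h2 ▸ d.adj)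
      have h2 : ¬ (d.snd = u ∧ d.fst = v) := fun ⟨h1, h2⟩ => h (h1 ▸ h2 ▸ d.adj.symm)
      simp [h1, h2]

theorem zipLaplacian_one (hζ : ∀ d ∈ ζ, d.symm ∉ ζ) :
    zipLaplacian G c D ζ 1 = (laplacian G c D).map Complex.ofReal := by
  simp [zipLaplacian_eq c D hζ]

/-- Inverting `z` inverts all parallel transports. This is the symmetry that makes determinants and
principal minors stationary at `z = 1`. -/
theorem zipLaplacian_inv (hζ : ∀ d ∈ ζ, d.symm ∉ ζ) (z : ℂ) :
    zipLaplacian G c D ζ z⁻¹ = (zipLaplacian G c D ζ z).transpose := by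
  have h : ((laplacian G c D).map Complex.ofReal).transpose =
      (laplacian G c D).map Complex.ofReal := by
    ext u v
    simp only [Matrix.transpose_apply, Matrix.map_apply, laplacian_eq_rootLaplacian]
    rw [rootLaplacian_symm]
  rw [zipLaplacian_eq c D hζ, zipLaplacian_eq c D hζ, Matrix.transpose_add, h,
    Matrix.transpose_sum]
  simp [Matrix.transpose_add, Matrix.transpose_single, add_comm]

variable (ζ) in
/-- The derivative of the line bundle Laplacian at `z = 1`. -/
def zipDeriv : Matrix V V ℂ :=
  ∑ d ∈ ζ.toFinset, (c d.edge : ℂ) • (Matrix.single d.fst d.snd 1 - Matrix.single d.snd d.fst 1)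

theorem hasDerivAt_zipLaplacian (hζ : ∀ d ∈ ζ, d.symm ∉ ζ) (u v : V) :
    HasDerivAt (fun z => zipLaplacian G c D ζ z u v) (zipDeriv c ζ u v) 1 := by
  simp only [zipLaplacian_eq c D hζ, zipDeriv, Matrix.add_apply, Matrix.sum_apply,
    Matrix.smul_apply, Matrix.sub_apply, smul_eq_mul]
  refine (HasDerivAt.fun_sum fun d _ => HasDerivAt.const_mul _ ?_).const_add _
  have h3 : HasDerivAt (fun z : ℂ => 1 - z⁻¹) 1 1 := by
    simpa using (hasDerivAt_inv (one_ne_zero (α := ℂ))).const_sub 1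
  have h4 : HasDerivAt (fun z : ℂ => 1 - z) (-1) 1 := (hasDerivAt_id' 1).const_sub 1
  have h5 := (h3.mul_const (Matrix.single d.fst d.snd 1 u v)).add
    (h4.mul_const (Matrix.single d.snd d.fst 1 u v))
  rwa [one_mul, neg_one_mul, ← sub_eq_add_neg] at h5

omit [DecidableRel G.Adj] in
theorem neg_mul_zipDeriv_mul (g : Matrix V V ℂ) (u v : V) :
    -(g * zipDeriv c ζ * g) u v = ∑ d ∈ ζ.toFinset, (c d.edge : ℂ) *
      (g u d.snd * g d.fst v - g u d.fst * g d.snd v) := by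
  have h : ∀ i j, (g * (Matrix.single i j 1 : Matrix V V ℂ) * g) u v = g u i * g j v := fun i j => by
    rw [Matrix.mul_apply, Finset.sum_eq_single j]
    · simp
    · intro k _ hk
      simp [hk]
    · simp
  rw [zipDeriv, Matrix.mul_sum, Matrix.sum_mul, Matrix.sum_apply, ← Finset.sum_neg_distrib]
  refine Finset.sum_congr rfl fun d _ => ?_
  simp only [Matrix.mul_smul, Matrix.smul_mul, Matrix.mul_sub, Matrix.sub_mul, Matrix.smul_apply,
    Matrix.sub_apply, h, smul_eq_mul]
  ring

end Zipper


/-! ### Derivatives of cofactors and of the Green function at z = 1. -/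

section GreenDerivative

variable {V : Type*} [Fintype V] [DecidableEq V] {G : SimpleGraph V} [DecidableRel G.Adj]
  {c : Sym2 V → ℝ} {D : Finset V} {ζ : List G.Dart} {T : Matrix V V ℂ}

theorem det_killRows_map (A : Matrix V V ℝ) (S : Finset V) :
    (killRows (A.map Complex.ofReal) S).det = ((killRows A S).det : ℂ) := by
  have h : killRows (A.map Complex.ofReal) S = (killRows A S).map Complex.ofRealHom := by
    ext i j
    by_cases hi : i ∈ S
    · by_cases hij : i = j
      · subst hij
        simp [killRows, hi]
      · simp [killRows, hi, hij]
    · simp [killRows, hi]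
  rw [h]
  exact (RingHom.map_det Complex.ofRealHom _).symm

theorem hasDerivAt_zipLaplacian_add (hζ : ∀ d ∈ ζ, d.symm ∉ ζ) (u v : V) :
    HasDerivAt (fun z => (zipLaplacian G c D ζ z + T) u v) (zipDeriv c ζ u v) 1 := by
  simp only [Matrix.add_apply]
  exact (hasDerivAt_zipLaplacian c D hζ u v).add_const _

theorem hasDerivAt_det_killRows (hζ : ∀ d ∈ ζ, d.symm ∉ ζ) (hT : T.transpose = T) (S : Finset V) :
    HasDerivAt (fun z => (killRows (zipLaplacian G c D ζ z + T) S).det) 0 1 := by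
  refine hasDerivAt_zero_of_inv_eq (hasDerivAt_det
    (hasDerivAt_killRows (hasDerivAt_zipLaplacian_add hζ) S)).differentiableAt fun z => ?_
  have h : zipLaplacian G c D ζ z⁻¹ + T = (zipLaplacian G c D ζ z + T).transpose := by
    rw [Matrix.transpose_add, hT, zipLaplacian_inv c D hζ]
  rw [h, det_killRows_transpose]

theorem hasDerivAt_det_zipLaplacian (hζ : ∀ d ∈ ζ, d.symm ∉ ζ) (hT : T.transpose = T) :
    HasDerivAt (fun z => (zipLaplacian G c D ζ z + T).det) 0 1 := by
  simpa only [killRows_empty] using hasDerivAt_det_killRows (c := c) (D := D) hζ hT ∅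

/-- The derivative of the adjugate of the line bundle Laplacian counts the crossings of the
zipper. -/
theorem adjugateDeriv_zipLaplacian (hζ : ∀ d ∈ ζ, d.symm ∉ ζ) (u v : V) :
    adjugateDeriv ((laplacian G c D).map Complex.ofReal) (zipDeriv c ζ) u v =
      ∑ γ : G.Path u v, (pathWeight G c D γ : ℂ) * (-RotationSystem.crossing ζ γ.1 : ℤ) := by
  have h1 : HasDerivAt (fun z => (zipLaplacian G c D ζ z).adjugate u v)
      (adjugateDeriv ((laplacian G c D).map Complex.ofReal) (zipDeriv c ζ) u v) 1 := by
    rw [← zipLaplacian_one c D hζ]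
    exact hasDerivAt_adjugate (hasDerivAt_zipLaplacian c D hζ) u v
  refine h1.unique ?_
  have h2 : ∀ᶠ z : ℂ in 𝓝 1, (zipLaplacian G c D ζ z).adjugate u v =
      ∑ γ : G.Path u v, (walkProd (fun x y => c s(x, y)) γ.1 : ℝ) *
        z ^ (-RotationSystem.crossing ζ γ.1) *
        (killRows (zipLaplacian G c D ζ z) γ.1.support.toFinset).det := by
    filter_upwards [eventually_ne_nhds (one_ne_zero (α := ℂ))] with z hz
    rw [adjugate_eq_sum_path G _ fun x y hxy h => by
      simp [zipLaplacian, lineLaplacian, hxy, h]]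
    exact Finset.sum_congr rfl fun γ _ => by rw [walkProd_neg_zipLaplacian c D hζ hz]
  refine HasDerivAt.congr_of_eventuallyEq (HasDerivAt.fun_sum fun γ _ => ?_) h2
  -- The minor in each term is stationary at 1, so only the power of `z` contributes to the
  -- derivative.
  have h3 := hasDerivAt_det_killRows (c := c) (D := D) (T := 0) hζ Matrix.transpose_zero
    γ.1.support.toFinset
  simp only [add_zero] at h3
  have h4 := ((hasDerivAt_zpow (-RotationSystem.crossing ζ γ.1) (1 : ℂ)
    (Or.inl one_ne_zero)).const_mul
      ((walkProd (fun x y => c s(x, y)) γ.1 : ℝ) : ℂ)).mul h3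
  refine h4.congr_deriv ?_
  rw [zipLaplacian_one c D hζ, det_killRows_map, pathWeight_eq]
  push_cast
  simp only [one_zpow]
  ring

theorem hasDerivAt_inv_zipLaplacian (hζ : ∀ d ∈ ζ, d.symm ∉ ζ) {g : Matrix V V ℂ}
    (hg : ((laplacian G c D).map Complex.ofReal + T) * g = 1) (u v : V) :
    HasDerivAt (fun z => (zipLaplacian G c D ζ z + T)⁻¹ u v)
      (∑ d ∈ ζ.toFinset, (c d.edge : ℂ) * (g u d.snd * g d.fst v - g u d.fst * g d.snd v)) 1 := by
  have h1 : (zipLaplacian G c D ζ 1 + T) * g = 1 := by rwa [zipLaplacian_one c D hζ]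
  have h := hasDerivAt_matrix_inv (A := fun z => zipLaplacian G c D ζ z + T)
    (hasDerivAt_zipLaplacian_add hζ) (Matrix.det_ne_zero_of_right_inverse h1) u v
  rwa [Matrix.inv_eq_right_inv h1, neg_mul_zipDeriv_mul] at h

/-- The relation between the derivatives of the adjugate and of the Green function. -/
theorem adjugateDeriv_eq_det_mul (hζ : ∀ d ∈ ζ, d.symm ∉ ζ) (hT : T.transpose = T)
    {g : Matrix V V ℂ} (hg : ((laplacian G c D).map Complex.ofReal + T) * g = 1) (u v : V) :
    adjugateDeriv ((laplacian G c D).map Complex.ofReal + T) (zipDeriv c ζ) u v =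
      ((laplacian G c D).map Complex.ofReal + T).det *
        ∑ d ∈ ζ.toFinset, (c d.edge : ℂ) * (g u d.snd * g d.fst v - g u d.fst * g d.snd v) := by
  have h1 : HasDerivAt (fun z => (zipLaplacian G c D ζ z + T).adjugate u v)
      (adjugateDeriv ((laplacian G c D).map Complex.ofReal + T) (zipDeriv c ζ) u v) 1 := by
    rw [← zipLaplacian_one c D hζ]
    exact hasDerivAt_adjugate (hasDerivAt_zipLaplacian_add hζ) u v
  -- The cofactor is the determinant times the entry of the inverse, and the determinant is
  -- stationary.
  have h2 := hasDerivAt_det_zipLaplacian (c := c) (D := D) hζ hT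
  have h3 := h2.mul (hasDerivAt_inv_zipLaplacian hζ hg u v)
  have hdet : (zipLaplacian G c D ζ 1 + T).det ≠ 0 := by
    rw [zipLaplacian_one c D hζ]
    exact Matrix.det_ne_zero_of_right_inverse hg
  rw [zero_mul, zero_add, zipLaplacian_one c D hζ] at h3
  refine h1.unique (h3.congr_of_eventuallyEq ?_)
  filter_upwards [h2.continuousAt.eventually_ne hdet] with z hz
  simp only [Pi.mul_apply, Matrix.inv_def, Matrix.smul_apply, smul_eq_mul, Ring.inverse_eq_inv']
  rw [mul_inv_cancel_left₀ hz]

/-- The limit in the passage formula. -/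
theorem tendsto_inv_zipLaplacian (hζ : ∀ d ∈ ζ, d.symm ∉ ζ) (hT : T.transpose = T)
    {g : Matrix V V ℂ} (hg : ((laplacian G c D).map Complex.ofReal + T) * g = 1)
    (hgs : g.transpose = g) {u v : V} (huv : g u v ≠ 0) :
    Tendsto (fun z : ℂ => ((zipLaplacian G c D ζ z + T)⁻¹ v u -
        z⁻¹ ^ 2 * (zipLaplacian G c D ζ z + T)⁻¹ u v) * (zipLaplacian G c D ζ z + T).det /
          (1 - z⁻¹ ^ 2) *
        (1 / ((zipLaplacian G c D ζ z + T)⁻¹ u v * (zipLaplacian G c D ζ z + T).det)))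
      (𝓝[≠] 1) (𝓝 (1 - (∑ d ∈ ζ.toFinset, (c d.edge : ℂ) *
        (g u d.snd * g d.fst v - g u d.fst * g d.snd v)) / g u v)) := by
  have hdet : (zipLaplacian G c D ζ 1 + T).det ≠ 0 := by
    rw [zipLaplacian_one c D hζ]
    exact Matrix.det_ne_zero_of_right_inverse hg
  have h1 : (zipLaplacian G c D ζ 1 + T)⁻¹ = g := by
    rw [zipLaplacian_one c D hζ]
    exact Matrix.inv_eq_right_inv hg
  have hs : ∀ x y, g x y = g y x := fun x y => (congr_fun (congr_fun hgs x) y).symm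
  refine tendsto_leftPassage (hasDerivAt_inv_zipLaplacian hζ hg u v)
    ((hasDerivAt_inv_zipLaplacian hζ hg v u).congr_deriv ?_) (by rw [h1]) (by rw [h1, hs]) huv
    (hasDerivAt_det_zipLaplacian hζ hT).continuousAt hdet
  -- As `g` is symmetric, exchanging `u` and `v` changes the sign of the derivative.
  rw [← Finset.sum_neg_distrib]
  refine Finset.sum_congr rfl fun d _ => ?_
  rw [hs v, hs v, hs _ u, hs _ u]
  ring

end GreenDerivative


/-! ### The regularized Green function. -/

section FreeGreen

variable {V : Type*} [Fintype V] [DecidableEq V] {G : SimpleGraph V} [DecidableRel G.Adj]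
  {c : Sym2 V → ℝ}

theorem laplacian_empty : laplacian G c ∅ = rootLaplacian G c 0 := by
  rw [laplacian_eq_rootLaplacian]
  congr 1

theorem sum_laplacian_empty (v : V) : ∑ u, laplacian G c ∅ u v = 0 := by
  have h := rootLaplacian_mulVec G c 0 (fun _ => 1) v
  simp only [Matrix.mulVec, dotProduct, mul_one, Pi.zero_apply, zero_add, sub_self,
    mul_zero, Finset.sum_const_zero] at h
  rw [laplacian_empty, ← h]
  exact Finset.sum_congr rfl fun u _ => rootLaplacian_symm G c 0 u v

theorem sum_laplacian_eigenvectorBasis (i u : V) :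
    ∑ v, laplacian G c ∅ u v * (laplacian_isHermitian G c ∅).eigenvectorBasis i v =
      (laplacian_isHermitian G c ∅).eigenvalues i *
        (laplacian_isHermitian G c ∅).eigenvectorBasis i u :=
  congr_fun ((laplacian_isHermitian G c ∅).mulVec_eigenvectorBasis i) u

theorem sum_eigenvectorBasis_mul (u v : V) :
    ∑ i, (laplacian_isHermitian G c ∅).eigenvectorBasis i u *
      (laplacian_isHermitian G c ∅).eigenvectorBasis i v = if u = v then 1 else 0 := by
  have h := congr_fun (congr_fun (Matrix.mem_unitaryGroup_iff.1
    (laplacian_isHermitian G c ∅).eigenvectorUnitary.2) u) v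
  rw [Matrix.mul_apply, Matrix.one_apply] at h
  rw [← h]
  exact Finset.sum_congr rfl fun i _ => by simp [Matrix.star_apply, Matrix.IsHermitian.eigenvectorUnitary_apply]

theorem eigenvectorBasis_eq_of_eigenvalue_eq_zero (hG : G.Connected)
    (hc : ∀ e ∈ G.edgeSet, 0 < c e) {i : V}
    (hi : (laplacian_isHermitian G c ∅).eigenvalues i = 0) (u v : V) :
    (laplacian_isHermitian G c ∅).eigenvectorBasis i u =
      (laplacian_isHermitian G c ∅).eigenvectorBasis i v := by
  refine (eq_of_dotProduct_rootLaplacian_eq_zero (k := 0)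
    (y := fun u => (laplacian_isHermitian G c ∅).eigenvectorBasis i u) hG hc (fun _ => le_rfl)
    ?_).1 u v
  rw [← laplacian_empty, dotProduct]
  refine Finset.sum_eq_zero fun x _ => ?_
  rw [Matrix.mulVec, dotProduct, sum_laplacian_eigenvectorBasis, hi, zero_mul, mul_zero]

theorem sum_eigenvectorBasis_eq_zero {i : V}
    (hi : (laplacian_isHermitian G c ∅).eigenvalues i ≠ 0) :
    ∑ u, (laplacian_isHermitian G c ∅).eigenvectorBasis i u = 0 := by
  have h : (laplacian_isHermitian G c ∅).eigenvalues i *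
      ∑ u, (laplacian_isHermitian G c ∅).eigenvectorBasis i u = 0 := by
    simp only [Finset.mul_sum, ← sum_laplacian_eigenvectorBasis]
    rw [Finset.sum_comm]
    simp only [← Finset.sum_mul, sum_laplacian_empty, zero_mul, Finset.sum_const_zero]
  exact (mul_eq_zero.1 h).resolve_left hi

theorem regGreen_apply (u v : V) : regGreen G c u v =
    ∑ i with (laplacian_isHermitian G c ∅).eigenvalues i ≠ 0,
      ((laplacian_isHermitian G c ∅).eigenvalues i)⁻¹ *
        ((laplacian_isHermitian G c ∅).eigenvectorBasis i u *
          (laplacian_isHermitian G c ∅).eigenvectorBasis i v) := rfl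

theorem regGreen_symm (u v : V) : regGreen G c u v = regGreen G c v u := by
  simp only [regGreen_apply]
  exact Finset.sum_congr rfl fun i _ => by ring

theorem sum_regGreen (v : V) : ∑ u, regGreen G c u v = 0 := by
  simp only [regGreen_apply]
  rw [Finset.sum_comm]
  refine Finset.sum_eq_zero fun i hi => ?_
  rw [← Finset.mul_sum, ← Finset.sum_mul,
    sum_eigenvectorBasis_eq_zero (Finset.mem_filter.1 hi).2, zero_mul, mul_zero]

/-- The regularized Green function inverts the Laplacian on the complement of the constants. -/
theorem laplacian_mul_regGreen (hG : G.Connected) (hc : ∀ e ∈ G.edgeSet, 0 < c e) :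
    laplacian G c ∅ * regGreen G c = 1 - Matrix.of fun _ _ => (Fintype.card V : ℝ)⁻¹ := by
  set b := (laplacian_isHermitian G c ∅).eigenvectorBasis with hb
  have h1 : ∀ u v, (laplacian G c ∅ * regGreen G c) u v = (if u = v then 1 else 0) -
      ∑ i with ¬ (laplacian_isHermitian G c ∅).eigenvalues i ≠ 0, b i u * b i v := by
    intro u v
    rw [← sum_eigenvectorBasis_mul (G := G) (c := c), ← Finset.sum_filter_add_sum_filter_not _
      fun i => (laplacian_isHermitian G c ∅).eigenvalues i ≠ 0, add_sub_cancel_right,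
      Matrix.mul_apply]
    simp only [regGreen_apply, Finset.mul_sum]
    rw [Finset.sum_comm]
    refine Finset.sum_congr rfl fun i hi => ?_
    have hi := (Finset.mem_filter.1 hi).2
    have h2 := sum_laplacian_eigenvectorBasis (G := G) (c := c) i u
    calc _ = (∑ x, laplacian G c ∅ u x * b i x) *
          ((laplacian_isHermitian G c ∅).eigenvalues i)⁻¹ * b i v := by
          simp only [Finset.sum_mul]
          exact Finset.sum_congr rfl fun x _ => by ring
      _ = _ := by
          rw [h2, mul_right_comm _ _ (_)⁻¹, mul_inv_cancel₀ hi, one_mul]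
  -- Eigenvectors for the eigenvalue 0 are constant, so the kernel of their projection does not
  -- depend on `u`. Its value then follows from the vanishing column sums of the Laplacian, without
  -- the multiplicity of the eigenvalue.
  have h2 : ∀ u u' v, ∑ i with ¬ (laplacian_isHermitian G c ∅).eigenvalues i ≠ 0, b i u * b i v =
      ∑ i with ¬ (laplacian_isHermitian G c ∅).eigenvalues i ≠ 0, b i u' * b i v := by
    intro u u' v
    refine Finset.sum_congr rfl fun i hi => ?_
    rw [eigenvectorBasis_eq_of_eigenvalue_eq_zero hG hc
      (not_not.1 (Finset.mem_filter.1 hi).2) u u']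
  ext u v
  rw [h1, Matrix.sub_apply, Matrix.one_apply, Matrix.of_apply]
  congr 1
  have h3 : ∑ u, (laplacian G c ∅ * regGreen G c) u v = 0 := by
    simp only [Matrix.mul_apply]
    rw [Finset.sum_comm]
    simp only [← Finset.sum_mul, sum_laplacian_empty, zero_mul, Finset.sum_const_zero]
  simp only [h1, Finset.sum_sub_distrib, Finset.sum_ite_eq', Finset.mem_univ, if_true,
    h2 _ u v, Finset.sum_const, Finset.card_univ, nsmul_eq_mul] at h3
  exact eq_inv_of_mul_eq_one_right (sub_eq_zero.1 h3).symm

/-- The Laplacian annihilates constants and the regularized Green function has zero column sums, so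
the constants and their orthogonal complement are inverted separately. -/
theorem laplacian_add_mul_regGreen (hG : G.Connected) (hc : ∀ e ∈ G.edgeSet, 0 < c e) {t : ℂ}
    (ht : t ≠ 0) :
    ((laplacian G c ∅).map Complex.ofReal + t • Matrix.of fun _ _ => (Fintype.card V : ℂ)⁻¹) *
      ((regGreen G c).map Complex.ofReal +
        Matrix.of fun _ _ => t⁻¹ * (Fintype.card V : ℂ)⁻¹) = 1 := by
  have hV : (Fintype.card V : ℂ) ≠ 0 := by
    obtain ⟨v⟩ := hG.nonempty
    exact_mod_cast (Fintype.card_pos_iff.2 ⟨v⟩).ne'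
  ext u v
  have h1 := congr_fun (congr_fun (laplacian_mul_regGreen hG hc) u) v
  have h2 := sum_laplacian_empty (G := G) (c := c) u
  have h3 := sum_regGreen (G := G) (c := c) v
  rw [Matrix.mul_apply, Matrix.sub_apply, Matrix.one_apply, Matrix.of_apply] at h1
  simp only [laplacian_empty, rootLaplacian_symm G c 0 _ u] at h2
  rw [← laplacian_empty] at h2
  replace h1 := congr_arg Complex.ofReal h1
  replace h2 := congr_arg Complex.ofReal h2
  replace h3 := congr_arg Complex.ofReal h3
  push_cast at h1 h2 h3
  simp only [Matrix.mul_apply, Matrix.add_apply, Matrix.map_apply, Matrix.smul_apply,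
    Matrix.of_apply, smul_eq_mul, add_mul, mul_add, Finset.sum_add_distrib, ← Finset.sum_mul,
    ← Finset.mul_sum, h1, h2, h3, Matrix.one_apply, Finset.sum_const, Finset.card_univ,
    nsmul_eq_mul]
  split_ifs <;> simp only [Complex.ofReal_one, Complex.ofReal_zero] <;> field_simp <;> ring

end FreeGreen


/-! ### Passage probabilities, with a root and with free boundary. -/

section Passage

variable {V : Type*} [Fintype V] [DecidableEq V] {G : SimpleGraph V} [DecidableRel G.Adj]
  {c : Sym2 V → ℝ} {D : Finset V} {ζ : List G.Dart}

/-- `N`, the indicator of the complement of `B`, will be minus the crossing number. -/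
theorem pathProb_eq_one_sub (hG : G.Connected) (hc : ∀ e ∈ G.edgeSet, 0 < c e) {u v : V}
    {B : G.Path u v → Prop} {N : G.Path u v → ℤ} (h₁ : ∀ γ, B γ → N γ = 0)
    (h₂ : ∀ γ, ¬ B γ → N γ = 1) :
    pathProb G c D B = 1 - (∑ γ : G.Path u v, pathWeight G c D γ * N γ) /
      ∑ γ : G.Path u v, pathWeight G c D γ := by
  classical
  have h := (sum_pathWeight_pos hG hc D u v).ne'
  rw [pathProb_eq, eq_sub_iff_add_eq, ← add_div, ← Finset.sum_add_distrib, div_eq_one_iff_eq h]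
  refine Finset.sum_congr rfl fun γ _ => ?_
  by_cases hB : B γ
  · simp [hB, h₁ γ hB]
  · simp [hB, h₂ γ hB]

section Root

variable (hG : G.Connected) (hc : ∀ e ∈ G.edgeSet, 0 < c e) (hD : D.Nonempty)
include hG hc hD

theorem det_laplacian_pos : 0 < (laplacian G c D).det := by
  rw [laplacian_eq_rootLaplacian]
  obtain ⟨x, hx⟩ := hD
  exact det_rootLaplacian_pos hG hc (fun u => by split_ifs <;> norm_num) ⟨x, by simp [hx]⟩

theorem laplacian_mul_green : laplacian G c D * green G c D = 1 :=
  Matrix.mul_nonsing_inv _ (isUnit_iff_ne_zero.2 (det_laplacian_pos hG hc hD).ne')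

theorem det_mul_green (u v : V) : (laplacian G c D).det * green G c D u v =
    ∑ γ : G.Path u v, pathWeight G c D γ := by
  have h := (det_laplacian_pos hG hc hD).ne'
  rw [← adjugate_laplacian, green, Matrix.inv_def, Matrix.smul_apply, smul_eq_mul,
    Ring.inverse_eq_inv', mul_inv_cancel_left₀ h]

theorem green_pos (u v : V) : 0 < green G c D u v :=
  pos_of_mul_pos_right (det_mul_green hG hc hD u v ▸ sum_pathWeight_pos hG hc D u v)
    (det_laplacian_pos hG hc hD).le

theorem map_laplacian_mul_green :
    ((laplacian G c D).map Complex.ofReal + 0) * (green G c D).map Complex.ofReal = 1 := by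
  rw [add_zero]
  have h := congr_arg (fun A => A.map Complex.ofRealHom) (laplacian_mul_green hG hc hD)
  simpa only [Matrix.map_mul, Matrix.map_one _ (map_zero _) (map_one _)] using! h

omit hG hc hD in
theorem green_transpose : (green G c D).transpose = green G c D := by
  rw [green, Matrix.transpose_nonsing_inv]
  congr 1
  ext u v
  rw [Matrix.transpose_apply, laplacian_eq_rootLaplacian, rootLaplacian_symm]

omit [Fintype V] [DecidableRel G.Adj] hG hc hD in
theorem ofReal_greenDeriv (g : Matrix V V ℝ) (u v : V) :
    (greenDeriv c g ζ u v : ℂ) = ∑ d ∈ ζ.toFinset, (c d.edge : ℂ) *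
      (g.map Complex.ofReal u d.snd * g.map Complex.ofReal d.fst v -
        g.map Complex.ofReal u d.fst * g.map Complex.ofReal d.snd v) := by
  simp [greenDeriv]

variable (hζ : ∀ d ∈ ζ, d.symm ∉ ζ)
include hζ

/-- The derivative of a cofactor computed twice: over paths, and as the determinant times the
derivative of the inverse. -/
theorem det_mul_greenDeriv (u v : V) :
    (laplacian G c D).det * greenDeriv c (green G c D) ζ u v =
      ∑ γ : G.Path u v, pathWeight G c D γ * (-RotationSystem.crossing ζ γ.1 : ℤ) := by
  have h1 := adjugateDeriv_eq_det_mul hζ Matrix.transpose_zero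
    (map_laplacian_mul_green hG hc hD) u v
  rw [add_zero, adjugateDeriv_zipLaplacian hζ, ← ofReal_greenDeriv] at h1
  have h2 := det_killRows_map (laplacian G c D) ∅
  rw [killRows_empty, killRows_empty] at h2
  rw [h2] at h1
  exact_mod_cast h1.symm

theorem hasDerivAt_zipGreen (u v : V) : HasDerivAt (fun z => zipGreen G c D ζ z u v)
    (greenDeriv c (green G c D) ζ u v : ℂ) 1 := by
  have h := hasDerivAt_inv_zipLaplacian hζ (map_laplacian_mul_green hG hc hD) u v
  simp only [add_zero] at h
  rw [ofReal_greenDeriv]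
  exact h

theorem tendsto_zipGreen (u v : V) :
    Tendsto (fun z : ℂ => (zipGreen G c D ζ z v u - z⁻¹ ^ 2 * zipGreen G c D ζ z u v) *
        (zipLaplacian G c D ζ z).det / (1 - z⁻¹ ^ 2) *
          (1 / (zipGreen G c D ζ z u v * (zipLaplacian G c D ζ z).det)))
      (𝓝[≠] 1)
      (𝓝 ((1 - greenDeriv c (green G c D) ζ u v / green G c D u v : ℝ) : ℂ)) := by
  have h := tendsto_inv_zipLaplacian hζ Matrix.transpose_zero
    (map_laplacian_mul_green hG hc hD)
    (by rw [← Matrix.transpose_map, green_transpose]) (u := u) (v := v)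
    (by simpa using (green_pos hG hc hD u v).ne')
  simp only [add_zero] at h
  rw [← ofReal_greenDeriv] at h
  push_cast
  exact h

theorem pathProb_eq_root {u v : V} {B : G.Path u v → Prop}
    (h₁ : ∀ γ, B γ → RotationSystem.crossing ζ γ.1 = 0)
    (h₂ : ∀ γ, ¬ B γ → RotationSystem.crossing ζ γ.1 = -1) :
    pathProb G c D B = 1 - greenDeriv c (green G c D) ζ u v / green G c D u v := by
  rw [pathProb_eq_one_sub hG hc (N := fun γ => -RotationSystem.crossing ζ γ.1)
    (fun γ h => by rw [h₁ γ h, neg_zero]) (fun γ h => by rw [h₂ γ h, neg_neg]),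
    ← det_mul_greenDeriv hG hc hD hζ, ← det_mul_green hG hc hD,
    mul_div_mul_left _ _ (det_laplacian_pos hG hc hD).ne']

end Root

section Free

theorem tendsto_ratio (a p q : ℂ) {N : ℂ} (hN : N ≠ 0) :
    Tendsto (fun t : ℂ => (p + t⁻¹ * N⁻¹ * q) / (a + t⁻¹ * N⁻¹)) (𝓝[≠] 0) (𝓝 q) := by
  have h1 : Tendsto (fun t : ℂ => (t * N * p + q) / (t * N * a + 1)) (𝓝 0)
      (𝓝 ((0 * N * p + q) / (0 * N * a + 1))) :=
    Tendsto.div (Continuous.tendsto (by fun_prop) 0) (Continuous.tendsto (by fun_prop) 0) (by simp)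
  simp only [zero_mul, zero_add, div_one] at h1
  refine (h1.mono_left nhdsWithin_le_nhds).congr' ?_
  filter_upwards [self_mem_nhdsWithin] with t ht
  have ht : t ≠ 0 := ht
  rw [← mul_div_mul_left (p + t⁻¹ * N⁻¹ * q) _ (mul_ne_zero ht hN)]
  congr 1 <;> field_simp

/-- For `a ≠ 0` the expression does vanish at `t = -1 / (a * N)`; this is why the inner limit is
taken only for `t` close to 0. -/
theorem eventually_add_inv_ne_zero (a : ℂ) {N : ℂ} (hN : N ≠ 0) :
    ∀ᶠ t : ℂ in 𝓝[≠] 0, a + t⁻¹ * N⁻¹ ≠ 0 := by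
  have h1 : ∀ᶠ t : ℂ in 𝓝 0, t * N * a + 1 ≠ 0 :=
    ContinuousAt.eventually_ne (by fun_prop) (by simp)
  filter_upwards [self_mem_nhdsWithin, nhdsWithin_le_nhds h1] with t ht h h'
  have ht : t ≠ 0 := ht
  refine h ?_
  have : t * N * a + 1 = t * N * (a + t⁻¹ * N⁻¹) := by field_simp
  rw [this, h', mul_zero]

variable (hG : G.Connected) (hc : ∀ e ∈ G.edgeSet, 0 < c e) (hζ : ∀ d ∈ ζ, d.symm ∉ ζ)

omit [Fintype V] [DecidableRel G.Adj] in
theorem sum_add_const {g : Matrix V V ℝ} {τ : ℂ} {k : Matrix V V ℂ}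
    (hk : k = g.map Complex.ofReal + Matrix.of fun _ _ => τ) (u v : V) :
    ∑ d ∈ ζ.toFinset, (c d.edge : ℂ) * (k u d.snd * k d.fst v - k u d.fst * k d.snd v) =
      (greenDeriv c g ζ u v : ℂ) + τ * (greenDerivTilde c g ζ u v : ℂ) := by
  subst hk
  simp only [greenDeriv, greenDerivTilde, Matrix.add_apply, Matrix.map_apply, Matrix.of_apply]
  push_cast
  rw [Finset.mul_sum, ← Finset.sum_add_distrib]
  exact Finset.sum_congr rfl fun d _ => by ring

omit [Fintype V] [DecidableEq V] in
theorem transpose_smul_const (t s : ℂ) :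
    (t • Matrix.of fun _ _ : V => s).transpose = t • Matrix.of fun _ _ : V => s := rfl

omit [DecidableEq V] [DecidableRel G.Adj] in
include hG in
theorem card_ne_zero_of_connected : (Fintype.card V : ℂ) ≠ 0 := by
  obtain ⟨v⟩ := hG.nonempty
  exact_mod_cast (Fintype.card_pos_iff.2 ⟨v⟩).ne'

include hG hc hζ

theorem det_zipLaplacianFree_ne_zero {t : ℂ} (ht : t ≠ 0) :
    (zipLaplacianFree G c ζ t 1).det ≠ 0 := by
  rw [zipLaplacianFree, zipLaplacian_one c ∅ hζ]
  exact Matrix.det_ne_zero_of_right_inverse (laplacian_add_mul_regGreen hG hc ht)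

theorem hasDerivAt_zipGreenFree {t : ℂ} (ht : t ≠ 0) (u v : V) :
    HasDerivAt (fun z : ℂ => zipGreenFree G c ζ t z u v)
      ((greenDeriv c (regGreen G c) ζ u v : ℂ) + t⁻¹ * (Fintype.card V : ℂ)⁻¹ *
        (greenDerivTilde c (regGreen G c) ζ u v : ℂ)) 1 := by
  have h := hasDerivAt_inv_zipLaplacian hζ (laplacian_add_mul_regGreen hG hc ht) u v
  rw [sum_add_const rfl] at h
  exact h

theorem tendsto_zipGreenFree {t : ℂ} (ht : t ≠ 0) {u v : V}
    (h : (regGreen G c u v : ℂ) + t⁻¹ * (Fintype.card V : ℂ)⁻¹ ≠ 0) :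
    Tendsto (fun z : ℂ =>
        (zipGreenFree G c ζ t z v u - z⁻¹ ^ 2 * zipGreenFree G c ζ t z u v) *
          (zipLaplacianFree G c ζ t z).det / (1 - z⁻¹ ^ 2) *
        (1 / (zipGreenFree G c ζ t z u v * (zipLaplacianFree G c ζ t z).det)))
      (𝓝[≠] 1) (𝓝 (1 - ((greenDeriv c (regGreen G c) ζ u v : ℂ) +
        t⁻¹ * (Fintype.card V : ℂ)⁻¹ * (greenDerivTilde c (regGreen G c) ζ u v : ℂ)) /
          ((regGreen G c u v : ℂ) + t⁻¹ * (Fintype.card V : ℂ)⁻¹))) := by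
  have h' := tendsto_inv_zipLaplacian hζ (transpose_smul_const t _)
    (laplacian_add_mul_regGreen hG hc ht) (by ext x y; simp [regGreen_symm x y]) h
  rw [sum_add_const rfl] at h'
  exact h'

/-- The derivative term of the free Green function counts the crossings of the zipper. -/
theorem greenDerivTilde_eq (u v : V) : greenDerivTilde c (regGreen G c) ζ u v =
    (∑ γ : G.Path u v, pathWeight G c ∅ γ * (-RotationSystem.crossing ζ γ.1 : ℤ)) /
      ∑ γ : G.Path u v, pathWeight G c ∅ γ := by
  have hN := card_ne_zero_of_connected hG
  -- The derivative of the cofactor divided by the cofactor is continuous in `t` at 0, where the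
  -- cofactor is the total path weight. For `t ≠ 0` the determinant cancels from this quotient,
  -- leaving the ratio of Green function terms whose limit is given by `tendsto_ratio`.
  set A : ℂ → Matrix V V ℂ := fun t => (laplacian G c ∅).map Complex.ofReal +
    t • Matrix.of fun _ _ => (Fintype.card V : ℂ)⁻¹ with hA
  have hAc : Continuous A := continuous_const.add (continuous_id.smul continuous_const)
  have hA0 : A 0 = (laplacian G c ∅).map Complex.ofReal := by simp [hA]
  have hadj : (A 0).adjugate u v = ((∑ γ : G.Path u v, pathWeight G c ∅ γ : ℝ) : ℂ) := by
    rw [hA0, ← adjugate_laplacian]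
    exact congr_fun (congr_fun (RingHom.map_adjugate Complex.ofRealHom (laplacian G c ∅)).symm u) v
  have h1 : Tendsto (fun t => adjugateDeriv (A t) (zipDeriv c ζ) u v / (A t).adjugate u v)
      (𝓝[≠] 0) (𝓝 (adjugateDeriv (A 0) (zipDeriv c ζ) u v / (A 0).adjugate u v)) := by
    refine (Tendsto.div ((continuous_adjugateDeriv hAc _ u v).tendsto 0)
      ((hAc.matrix_adjugate.matrix_elem u v).tendsto 0) ?_).mono_left nhdsWithin_le_nhds
    rw [hadj]
    exact_mod_cast (sum_pathWeight_pos hG hc ∅ u v).ne'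
  have h2 := tendsto_ratio (regGreen G c u v) (greenDeriv c (regGreen G c) ζ u v)
    (greenDerivTilde c (regGreen G c) ζ u v) hN
  have h3 := tendsto_nhds_unique h2 (h1.congr' ?_)
  · rw [hadj, hA0, adjugateDeriv_zipLaplacian hζ] at h3
    exact_mod_cast h3
  · filter_upwards [self_mem_nhdsWithin] with t ht
    have hg := laplacian_add_mul_regGreen hG hc (ht : t ≠ 0)
    have hdet := Matrix.det_ne_zero_of_right_inverse hg
    have h4 := congr_fun (congr_fun (Matrix.inv_eq_right_inv hg) u) v
    rw [Matrix.inv_def, Matrix.smul_apply, smul_eq_mul, Ring.inverse_eq_inv',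
      inv_mul_eq_iff_eq_mul₀ hdet] at h4
    simp only [hA]
    rw [adjugateDeriv_eq_det_mul hζ (transpose_smul_const t _) hg, h4, sum_add_const rfl,
      mul_div_mul_left _ _ hdet]
    rfl

theorem pathProb_eq_free {u v : V} {B : G.Path u v → Prop}
    (h₁ : ∀ γ, B γ → RotationSystem.crossing ζ γ.1 = 0)
    (h₂ : ∀ γ, ¬ B γ → RotationSystem.crossing ζ γ.1 = -1) :
    pathProb G c ∅ B = 1 - greenDerivTilde c (regGreen G c) ζ u v := by
  rw [pathProb_eq_one_sub hG hc (N := fun γ => -RotationSystem.crossing ζ γ.1)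
    (fun γ h => by rw [h₁ γ h, neg_zero]) (fun γ h => by rw [h₂ γ h, neg_neg]),
    greenDerivTilde_eq hG hc hζ]

end Free

end Passage

end Schramm

/-! ### The passage formulas. -/

theorem mainTheorem1 {V : Type*} [Fintype V] [DecidableEq V]
    (G : SimpleGraph V) [DecidableRel G.Adj] (hG : G.Connected)
    (c : Sym2 V → ℝ) (hc : ∀ e ∈ G.edgeSet, 0 < c e) (D : Finset V)
    (M : Schramm.RotationSystem G) (u₁ u₂ : V) (hu : u₁ ≠ u₂) (a₁ a₂ : G.Dart)
    (ha₁ : a₁.fst = u₁) (ha₂ : a₂.fst = u₂) (ha : M.face a₁ = M.face a₂)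
    (f : M.Face) (hf : f ≠ M.face a₁)
    (hM : M.IsPlanar ∨ ∀ γ : G.Path u₁ u₂,
      Xor (M.LeavesLeft a₁ a₂ f γ.1) (M.LeavesRight a₁ a₂ f γ.1))
    (ζ : List G.Dart) (hζ : M.IsZipper a₁ a₂ f ζ) :
    -- every path from `u₁` to `u₂` leaves `f` either to its left or to its right
    (∀ γ : G.Path u₁ u₂, Xor (M.LeavesLeft a₁ a₂ f γ.1) (M.LeavesRight a₁ a₂ f γ.1)) ∧
    -- the formula with a root
    (D.Nonempty →
      (Schramm.laplacian G c D).det ≠ 0 ∧ 0 < Schramm.green G c D u₁ u₂ ∧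
      (∀ u v : V, HasDerivAt (fun z : ℂ => Schramm.zipGreen G c D ζ z u v)
        (Schramm.greenDeriv c (Schramm.green G c D) ζ u v : ℂ) 1) ∧
      Tendsto (fun z : ℂ =>
          (Schramm.zipGreen G c D ζ z u₂ u₁ - z⁻¹ ^ 2 * Schramm.zipGreen G c D ζ z u₁ u₂) *
              (Schramm.zipLaplacian G c D ζ z).det / (1 - z⁻¹ ^ 2) *
            (1 / (Schramm.zipGreen G c D ζ z u₁ u₂ * (Schramm.zipLaplacian G c D ζ z).det)))
        (𝓝[≠] 1)
        (𝓝 ((Schramm.pathProb G c D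
          (fun γ : G.Path u₁ u₂ => M.LeavesLeft a₁ a₂ f γ.1) : ℝ) : ℂ)) ∧
      Schramm.pathProb G c D (fun γ : G.Path u₁ u₂ => M.LeavesLeft a₁ a₂ f γ.1) =
        1 - Schramm.greenDeriv c (Schramm.green G c D) ζ u₁ u₂ / Schramm.green G c D u₁ u₂) ∧
    -- the formula with free boundary conditions
    (D = ∅ →
      (∀ t : ℂ, t ≠ 0 → (Schramm.zipLaplacianFree G c ζ t 1).det ≠ 0 ∧
        ∀ u v : V, HasDerivAt (fun z : ℂ => Schramm.zipGreenFree G c ζ t z u v)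
          ((Schramm.greenDeriv c (Schramm.regGreen G c) ζ u v : ℂ) +
            t⁻¹ * (Fintype.card V : ℂ)⁻¹ *
              (Schramm.greenDerivTilde c (Schramm.regGreen G c) ζ u v : ℂ)) 1) ∧
      (∃ L : ℂ → ℂ,
        (∀ᶠ t in 𝓝[≠] (0 : ℂ), Tendsto (fun z : ℂ =>
          (Schramm.zipGreenFree G c ζ t z u₂ u₁ - z⁻¹ ^ 2 * Schramm.zipGreenFree G c ζ t z u₁ u₂) *
              (Schramm.zipLaplacianFree G c ζ t z).det / (1 - z⁻¹ ^ 2) *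
            (1 / (Schramm.zipGreenFree G c ζ t z u₁ u₂ *
              (Schramm.zipLaplacianFree G c ζ t z).det)))
          (𝓝[≠] 1) (𝓝 (L t))) ∧
        Tendsto L (𝓝[≠] 0) (𝓝 ((Schramm.pathProb G c D
          (fun γ : G.Path u₁ u₂ => M.LeavesLeft a₁ a₂ f γ.1) : ℝ) : ℂ))) ∧
      Schramm.pathProb G c D (fun γ : G.Path u₁ u₂ => M.LeavesLeft a₁ a₂ f γ.1) =
        1 - Schramm.greenDerivTilde c (Schramm.regGreen G c) ζ u₁ u₂) ∧
    -- the same probability for the loop-erased random walk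
    (u₂ ∈ D →
      Summable (fun ω : G.Walk u₁ u₂ => Schramm.walkWeight G c D 0 ω) ∧
      Schramm.lerwProb G c D 0 (fun γ : G.Path u₁ u₂ => M.LeavesLeft a₁ a₂ f γ.1) =
        Schramm.pathProb G c D (fun γ : G.Path u₁ u₂ => M.LeavesLeft a₁ a₂ f γ.1)) ∧
    (u₂ ∉ D →
      (∀ ε ∈ Set.Ioo (0 : ℝ) 1,
        Summable (fun ω : G.Walk u₁ u₂ => Schramm.walkWeight G c D ε ω)) ∧
      Tendsto (fun ε : ℝ =>
          Schramm.lerwProb G c D ε (fun γ : G.Path u₁ u₂ => M.LeavesLeft a₁ a₂ f γ.1))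
        (𝓝[>] 0)
        (𝓝 (Schramm.pathProb G c D fun γ : G.Path u₁ u₂ => M.LeavesLeft a₁ a₂ f γ.1))) := by
  have : Nontrivial V := ⟨u₁, u₂, hu⟩
  have hx : ∀ γ : G.Path u₁ u₂,
      Xor (M.LeavesLeft a₁ a₂ f γ.1) (M.LeavesRight a₁ a₂ f γ.1) := by
    rcases hM with hM | hM
    · exact fun γ => hM.xor hG γ.2 hu ha₁ ha₂ ha hf
    · exact hM
  have hs : ∀ d ∈ ζ, d.symm ∉ ζ := fun d hd => hζ.symm_notMem hd
  have h₁ : ∀ γ : G.Path u₁ u₂, M.LeavesLeft a₁ a₂ f γ.1 →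
      Schramm.RotationSystem.crossing ζ γ.1 = 0 := fun γ =>
    (Schramm.RotationSystem.crossing_eq γ.2 hu ha₁ ha₂ ha hf hζ (hx γ)).1
  have h₂ : ∀ γ : G.Path u₁ u₂, ¬ M.LeavesLeft a₁ a₂ f γ.1 →
      Schramm.RotationSystem.crossing ζ γ.1 = -1 := fun γ h =>
    (Schramm.RotationSystem.crossing_eq γ.2 hu ha₁ ha₂ ha hf hζ (hx γ)).2
      ((hx γ).or.resolve_left h)
  refine ⟨hx, fun hD => ?_, ?_, fun hv => ?_, fun _ => ?_⟩
  · have hP := Schramm.pathProb_eq_root hG hc hD hs h₁ h₂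
    refine ⟨(Schramm.det_laplacian_pos hG hc hD).ne', Schramm.green_pos hG hc hD u₁ u₂,
      Schramm.hasDerivAt_zipGreen hG hc hD hs, ?_, hP⟩
    rw [hP]
    exact Schramm.tendsto_zipGreen hG hc hD hs u₁ u₂
  · rintro rfl
    have hP := Schramm.pathProb_eq_free hG hc hs h₁ h₂
    have hN := Schramm.card_ne_zero_of_connected hG
    refine ⟨fun t ht => ⟨Schramm.det_zipLaplacianFree_ne_zero hG hc hs ht,
      Schramm.hasDerivAt_zipGreenFree hG hc hs ht⟩, ⟨fun t =>
        1 - ((Schramm.greenDeriv c (Schramm.regGreen G c) ζ u₁ u₂ : ℂ) +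
          t⁻¹ * (Fintype.card V : ℂ)⁻¹ *
            (Schramm.greenDerivTilde c (Schramm.regGreen G c) ζ u₁ u₂ : ℂ)) /
          ((Schramm.regGreen G c u₁ u₂ : ℂ) + t⁻¹ * (Fintype.card V : ℂ)⁻¹), ?_, ?_⟩, hP⟩
    rotate_left
    · rw [hP]
      push_cast
      exact (Schramm.tendsto_ratio (Schramm.regGreen G c u₁ u₂)
        (Schramm.greenDeriv c (Schramm.regGreen G c) ζ u₁ u₂) _ hN).const_sub 1
    · filter_upwards [self_mem_nhdsWithin,
        Schramm.eventually_add_inv_ne_zero (Schramm.regGreen G c u₁ u₂) hN] with t ht h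
      exact Schramm.tendsto_zipGreenFree hG hc hs ht h
  · exact ⟨Schramm.summable_walkWeight hG hc one_pos le_rfl (Or.inr hv) u₁,
      Schramm.lerwProb_eq_pathProb hG hc one_pos le_rfl (Or.inr hv) _⟩
  -- For `ε` in (0, 1) the loop-erased walk has exactly the spanning forest law, so the limit is
  -- that of an eventually constant function.
  · refine ⟨fun ε hε => Schramm.summable_walkWeight hG hc hε.2 hε.1.le (Or.inl hε.1) u₁,
      tendsto_const_nhds.congr' ?_⟩
    filter_upwards [Ioo_mem_nhdsGT (zero_lt_one' ℝ)] with ε hε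
    exact (Schramm.lerwProb_eq_pathProb hG hc hε.2 hε.1.le (Or.inl hε.1) _).symm
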